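/- **Setting.** Let $m\in\{2,3,4\}$, $\lambda_0=\frac{5-m}{m+3}$, $p=\frac4{m+3}$, and let $\tilde\lambda\in(\lambda_0,1)$ be the unique solution of $\tilde\lambda\big(\frac{1-\lambda_0}{\tilde\lambda-\lambda_0}\big)^{1-\lambda_0}=2^p$. Let $0\le\lambda<1$, $\lambda\ne\tilde\lambda$. Let $a\in C^3(\mathbb R)$ satisfy, for some constants $K_a,\gamma_a>0$ and all $r$: $1<a(r)<2$, $a'(r)>0$, $|a^{(k)}(r)|\le K_ae^{-\gamma_a|r|}$ ($k=1,2,3$), $a(r)-1\le K_ae^{\gamma_a r}$ for $r\le 0$, $2-a(r)\le K_ae^{-\gamma_a r}$ for $r\ge0$, and $|(a^{1/m})'''|\le K_a(a^{1/m})'$. Put $\tilde a=a^{1/(m-1)}$, $$Q(x)=\Big[\tfrac{m+1}{2\cosh^2(\frac{m-1}2x)}\Big]^{\frac1{m-1}},\qquad Q_c(y)=c^{\frac1{m-1}}Q(\sqrt c\,y),\qquad T_\varepsilon=\frac{\varepsilon^{-1-1/100}}{1-\lambda},\qquad f_1(c,\rho)=p\,c\Big(c-\frac{\lambda}{\lambda_0}\Big)\frac{a'(\varepsilon\rho)}{a(\varepsilon\rho)}.$$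 Let $(C,P)$ be the solution on $[-T_\varepsilon,\infty)$ of $C'=\varepsilon f_1(C,P)$, $P'=C-\lambda$, $C(-T_\varepsilon)=1$, $P(-T_\varepsilon)=-(1-\lambda)T_\varepsilon$. The escape time $\tilde T_\varepsilon$ is: $T_\varepsilon$ if $\lambda\le\lambda_0$; the time $>-T_\varepsilon$ with $P(\tilde T_\varepsilon)=(1-\lambda)T_\varepsilon$ if $\lambda_0<\lambda<\tilde\lambda$; and, if $\tilde\lambda<\lambda<1$, the time $\tilde T_\varepsilon>t_0$ with $P(\tilde T_\varepsilon)=-(1-\lambda)T_\varepsilon$, where $t_0>-T_\varepsilon$ is the time with $C(t_0)=\lambda$. Let $c(t)>0$ and $\rho(t)\in\mathbb R$ be differentiable functions with $$|c(t)-C(t)|+|\rho'(t)-P'(t)|\le\varepsilon^{1/100},\qquad t\in[-T_\varepsilon,\tilde T_\varepsilon].\tag{$*$}$$ Put $\mu=\frac{99}{100}\big(1-\frac{\lambda_0}\lambda\big)^{(1-\lambda_0)/\lambda_0}$ if $\lambda>\lambda_0$ and $\mu=1$ if $\lambda\le\lambda_0$, and let $\mathcal Y$ be the set of $f\in C^\infty(\mathbb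 R)$ such that for every $j\ge0$ there are $K_j,r_j>0$ with $|f^{(j)}(x)|\le K_j(1+|x|)^{r_j}e^{-\mu|x|/2}$ for all $x$. For $u=u(t,x)$ put $S[u]=u_t+(u_{xx}-\lambda u+a(\varepsilon x)u^m)_x$. Write $y=x-\rho(t)$, and let $\delta_{m,3}$ be $1$ if $m=3$ and $0$ otherwise. **Proposition 4.2.** There are constants $\varepsilon_0,\gamma,K>0$ and $N\in\mathbb N$, and functions $A_c(y)$, $B_{c,s}(y)$ ($c>0$, $s,y\in\mathbb R$), $f_4^1(c),f_4^2(c)$, all independent of $\varepsilon$, such that the following holds for every $0<\varepsilon<\varepsilon_0$ and all $(c,\rho)$ satisfying $(*)$. Put $B_c(t,y)=B_{c,\varepsilon\rho(t)}(y)$, and $$\tilde u=R+w,\qquad R=\frac{Q_{c(t)}(y)}{\tilde a(\varepsilon\rho(t))},\qquad w=\varepsilon\,\frac{a'}{\tilde a^m}(\varepsilon\rho(t))\,A_{c(t)}(y)+\delta_{m,3}\,\varepsilon^2B_{c(t)}(t,y).$$ For every $t\in[-T_\varepsilon,\tilde T_\varepsilon]$, $\tilde u$ is differentiable in $t$ and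 $C^4$ in $x$, and: 1. With $\partial_c\tilde u$ the derivative of $\tilde u$ in the parameter $c$, and $\partial_\rho\tilde u:=\partial_\rho R-w_y+q(t)A_{c(t)}(y)$ for some $q$ with $|q(t)|\le K\varepsilon^2e^{-\varepsilon\gamma|\rho(t)|}$, $$S[\tilde u]=(c'-\varepsilon f_1-\varepsilon^2\delta_{m,3}f_3)\,\partial_c\tilde u+(\rho'-c+\lambda-\varepsilon f_2-\varepsilon^2\delta_{m,3}f_4)\,\partial_\rho\tilde u+\tilde S .$$ 2. With $c=c(t)$: $A_c$ is differentiable in $c$ and in $y$, $|A_c|\le K$ and $|\partial_cA_c|\le K$ on $\mathbb R$, $A_c'\in\mathcal Y$, $|A_c(y)|\le Ke^{-\gamma y}$ for $y\ge0$, $\int Q_cA_c=\int yQ_cA_c=0$, and $\lim_{y\to-\infty}A_c(y)$ exists and is nonzero provided $3\lambda_0c\ne\lambda$. If $m=3$: $B_c(t,\cdot)$ is differentiable in $c$ and in $y$, $|B_c'(t,\cdot)|\le K$ on $\mathbb R$, $|B_c(t,y)|\le Ke^{-\gamma y}e^{-\varepsilon\gamma|\rho(t)|}$ for $y\ge0$,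 $|B_c(t,y)|+|\partial_cB_c(t,y)|\le K|y|e^{-\varepsilon\gamma|\rho(t)|}$ for $y\le-1$, and $\int Q_cB_c=\int yQ_cB_c=0$. 3. $f_1=f_1(c(t),\rho(t))$ as above and, with $c=c(t)$ and $a,a',a''$ evaluated at $\varepsilon\rho(t)$, $$f_2=-\frac{\xi_m}{\sqrt c}(\lambda-3\lambda_0c)\frac{a'}a,\quad \xi_m=\frac{3-m}{(5-m)^2}\frac{(\int Q)^2}{\int Q^2},\qquad f_3=\frac{\tilde\xi_3}{\sqrt c}(c-\lambda)\frac{a'^2}{a^2},\quad\tilde\xi_3=\frac\lambda2\frac{(\int Q)^2}{\int Q^2}\ (m=3),$$ $$f_4=f_4^1(c)\frac{a'^2}{a^2}+f_4^2(c)\frac{a''}a,\qquad |f_4^i(c)|\le K .$$ 4. $\tilde S(t,\cdot)$ is $C^1$, $|\tilde S|\le K(1+|y|)^N$ for $y\le0$, $|\tilde S|\le Ke^{-\gamma y}$ for $y\ge0$, and $$\|\tilde S(t,\cdot)\|_{L^2(y\ge-3/\varepsilon)}+\|\partial_x\tilde S(t,\cdot)\|_{L^2(y\ge-3/\varepsilon)}\le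 K\varepsilon^{3/2}e^{-\varepsilon\gamma|\rho(t)|}+K\varepsilon^3 .$$ Moreover $\big|\int Q_c(y)\tilde S\,dx\big|+\big|\int yQ_c(y)\tilde S\,dx\big|$ is at most $K\varepsilon^2e^{-\varepsilon\gamma|\rho(t)|}+K\varepsilon^3$ if $m=2,4$, and at most $K\varepsilon^3e^{-\varepsilon\gamma|\rho(t)|}+K\varepsilon^4$ if $m=3$. -/

import Mathlib

open Set Filter Topology MeasureTheory
open scoped ContDiff

noncomputable section

namespace GKdV

/-- The explicit ground state `Q` of `Q'' - Q + Q ^ m = 0`, `Q > 0`, `Q ∈ H¹`, centred at `0`. -/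
def Q (m : ℕ) (x : ℝ) : ℝ :=
  (((m : ℝ) + 1) / (2 * Real.cosh (((m : ℝ) - 1) / 2 * x) ^ 2)) ^ (1 / ((m : ℝ) - 1))

/-- The rescaled soliton `Q_c(y) = c ^ (1 / (m - 1)) Q(√c y)`. -/
def Qc (m : ℕ) (c y : ℝ) : ℝ :=
  c ^ (1 / ((m : ℝ) - 1)) * Q m (Real.sqrt c * y)

/-- `λ₀ = (5 - m) / (m + 3)`. -/
def lambda0 (m : ℕ) : ℝ := (5 - (m : ℝ)) / ((m : ℝ) + 3)

/-- `p = 4 / (m + 3)`. -/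
def pExp (m : ℕ) : ℝ := 4 / ((m : ℝ) + 3)

/-- `lt` is the threshold `λ̃`: the unique root in `(λ₀, 1)` of
`λ̃ ((1 - λ₀) / (λ̃ - λ₀)) ^ (1 - λ₀) = 2 ^ p`. -/
def IsLambdaTilde (m : ℕ) (lt : ℝ) : Prop :=
  lambda0 m < lt ∧ lt < 1 ∧
    lt * ((1 - lambda0 m) / (lt - lambda0 m)) ^ (1 - lambda0 m) = (2 : ℝ) ^ pExp m

/-- The standing hypotheses on the potential `a`. -/
structure IsPotential (m : ℕ) (a : ℝ → ℝ) : Prop where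
  contDiff : ContDiff ℝ 3 a
  one_lt : ∀ r, 1 < a r
  lt_two : ∀ r, a r < 2
  deriv_pos : ∀ r, 0 < deriv a r
  decay : ∃ K > 0, ∃ γ > 0,
    (∀ k : ℕ, 1 ≤ k → k ≤ 3 → ∀ r, |iteratedDeriv k a r| ≤ K * Real.exp (-γ * |r|)) ∧
    (∀ r ≤ 0, a r - 1 ≤ K * Real.exp (γ * r)) ∧
    (∀ r ≥ 0, 2 - a r ≤ K * Real.exp (-γ * r))
  third : ∃ K > 0, ∀ s,
    |iteratedDeriv 3 (fun r => a r ^ (1 / (m : ℝ))) s| ≤ K * deriv (fun r => a r ^ (1 / (m : ℝ))) s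

/-- `ã = a ^ (1 / (m - 1))`. -/
def aTilde (m : ℕ) (a : ℝ → ℝ) (s : ℝ) : ℝ := a s ^ (1 / ((m : ℝ) - 1))

/-- `T_ε = ε ^ (-1 - 1/100) / (1 - λ)`. -/
def Teps (lam ε : ℝ) : ℝ := ε ^ (-1 - 1 / 100 : ℝ) / (1 - lam)

/-- `f₁(c, ρ) = p c (c - λ / λ₀) (a' / a)(ερ)`. -/
def f1 (m : ℕ) (lam : ℝ) (a : ℝ → ℝ) (ε c r : ℝ) : ℝ :=
  pExp m * c * (c - lam / lambda0 m) * (deriv a (ε * r) / a (ε * r))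

/-- `ξ_m = (3 - m) / (5 - m)² (∫ Q)² / ∫ Q²`. -/
def xi (m : ℕ) : ℝ :=
  (3 - (m : ℝ)) / (5 - (m : ℝ)) ^ 2 * ((∫ x, Q m x) ^ 2 / ∫ x, Q m x ^ 2)

/-- `f₂(c, ρ) = - ξ_m / √c (λ - 3 λ₀ c) (a' / a)(ερ)`. -/
def f2 (m : ℕ) (lam : ℝ) (a : ℝ → ℝ) (ε c r : ℝ) : ℝ :=
  -(xi m / Real.sqrt c) * (lam - 3 * lambda0 m * c) * (deriv a (ε * r) / a (ε * r))

/-- `ξ̃₃ = λ / 2 (∫ Q)² / ∫ Q²`, with `Q` the cubic ground state. -/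
def xiTilde3 (lam : ℝ) : ℝ :=
  lam / 2 * ((∫ x, Q 3 x) ^ 2 / ∫ x, Q 3 x ^ 2)

/-- `f₃(c, ρ) = ξ̃₃ / √c (c - λ) (a'² / a²)(ερ)`. -/
def f3 (lam : ℝ) (a : ℝ → ℝ) (ε c r : ℝ) : ℝ :=
  xiTilde3 lam / Real.sqrt c * (c - lam) * (deriv a (ε * r) ^ 2 / a (ε * r) ^ 2)

/-- `f₄ = f₄¹ (a'² / a²)(ερ) + f₄² (a'' / a)(ερ)`, where the coefficients are functions of the
scaling `c`. -/
def f4 (f41 f42 : ℝ → ℝ) (a : ℝ → ℝ) (ε c r : ℝ) : ℝ :=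
  f41 c * (deriv a (ε * r) ^ 2 / a (ε * r) ^ 2) +
    f42 c * (iteratedDeriv 2 a (ε * r) / a (ε * r))

/-- Kronecker's `δ_{m,3}`. -/
def delta3 (m : ℕ) : ℝ := if m = 3 then 1 else 0

/-- `(C, P)` solves, for all `t ≥ -T_ε`, the system `C' = ε f₁(C, P)`, `P' = C - λ`,
`C(-T_ε) = 1`, `P(-T_ε) = -(1 - λ) T_ε`. -/
structure IsDynSol (m : ℕ) (lam : ℝ) (a : ℝ → ℝ) (ε : ℝ) (C P : ℝ → ℝ) : Prop where
  initC : C (-Teps lam ε) = 1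
  initP : P (-Teps lam ε) = -((1 - lam) * Teps lam ε)
  derivC : ∀ t ∈ Ici (-Teps lam ε),
    HasDerivWithinAt C (ε * f1 m lam a ε (C t) (P t)) (Ici (-Teps lam ε)) t
  derivP : ∀ t ∈ Ici (-Teps lam ε),
    HasDerivWithinAt P (C t - lam) (Ici (-Teps lam ε)) t

/-- `Tt` is the escape time `T̃_ε` of the trajectory `(C, P)`; `lt` is the threshold `λ̃`.
For `λ ≤ λ₀` it is `T_ε`; for `λ₀ < λ < λ̃` it is the time when `P = (1 - λ) T_ε`; for
`λ̃ < λ < 1` it is the time, after the turning time `t₀` with `C(t₀) = λ`, when `P` has come back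
to `-(1 - λ) T_ε`. -/
def IsEscapeTime (m : ℕ) (lam lt ε : ℝ) (C P : ℝ → ℝ) (Tt : ℝ) : Prop :=
  (lam ≤ lambda0 m ∧ Tt = Teps lam ε) ∨
  (lambda0 m < lam ∧ lam < lt ∧ -Teps lam ε < Tt ∧ P Tt = (1 - lam) * Teps lam ε) ∨
  (lt < lam ∧ ∃ t0, -Teps lam ε < t0 ∧ C t0 = lam ∧ t0 < Tt ∧ P Tt = -((1 - lam) * Teps lam ε))

/-- The decay parameter `μ(λ) = (99/100) (1 - λ₀/λ) ^ ((1 - λ₀)/λ₀)` for `λ > λ₀`; it is a lower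
bound of the scaling `C`. For `λ ≤ λ₀` one has `C ≥ 1` and the value is `1`. -/
def muDecay (m : ℕ) (lam : ℝ) : ℝ :=
  if lambda0 m < lam then
    99 / 100 * (1 - lambda0 m / lam) ^ ((1 - lambda0 m) / lambda0 m)
  else 1

/-- The class `𝒴` of smooth functions all of whose derivatives are bounded by a polynomial times
`exp (-μ |x| / 2)`. -/
def MemY (m : ℕ) (lam : ℝ) (f : ℝ → ℝ) : Prop :=
  ContDiff ℝ ∞ f ∧ ∀ j : ℕ, ∃ K > 0, ∃ r > 0, ∀ x : ℝ,
    |iteratedDeriv j f x| ≤ K * (1 + |x|) ^ (r : ℝ) * Real.exp (-(1 / 2) * muDecay m lam * |x|)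

/-- `d = (a' / ã ^ m)(ερ)`. -/
def dCoef (m : ℕ) (a : ℝ → ℝ) (ε r : ℝ) : ℝ := deriv a (ε * r) / aTilde m a (ε * r) ^ m

/-- The modulated soliton `R = Q_c(x - ρ) / ã(ερ)`. -/
def R (m : ℕ) (a : ℝ → ℝ) (ε c r x : ℝ) : ℝ := Qc m c (x - r) / aTilde m a (ε * r)

/-- The correction `w = ε d A_c(y)`, plus `ε² B_c(y)` if `m = 3`. Here `A c y` is `A_c(y)`, and
`B c s y` with `s = ερ` is `B_c(t, y)`. -/
def w (m : ℕ) (a : ℝ → ℝ) (A : ℝ → ℝ → ℝ) (B : ℝ → ℝ → ℝ → ℝ) (ε c r y : ℝ) : ℝ :=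
  ε * dCoef m a ε r * A c y + delta3 m * ε ^ 2 * B c (ε * r) y

/-- The approximate solution `ũ = R + w`, as a function of the parameters `(c, ρ)` and of `x`. -/
def uTilde (m : ℕ) (a : ℝ → ℝ) (A : ℝ → ℝ → ℝ) (B : ℝ → ℝ → ℝ → ℝ) (ε c r x : ℝ) : ℝ :=
  R m a ε c r x + w m a A B ε c r (x - r)

/-- The error `S[u] = u_t + (u_xx - λ u + a(εx) u ^ m)_x`. -/
def S (m : ℕ) (lam : ℝ) (a : ℝ → ℝ) (ε : ℝ) (u : ℝ → ℝ → ℝ) (t x : ℝ) : ℝ :=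
  deriv (fun τ => u τ x) t +
    deriv (fun z => iteratedDeriv 2 (u t) z - lam * u t z + a (ε * z) * u t z ^ m) x

end GKdV

end

/-!
The approximate solution is built from corrections to the soliton that can all be computed at the
scaling `c = 1`. Put `e = ε / √c`, `l = λ / c`, `s = ε ρ`, `r = ρ' / c`. After the change of variable
`z = √c y` the remainder `S̃` equals `c ^ (1 / (m - 1) + 3 / 2) / ã(s)` times a function `err` of `z` and
of these four parameters (`S_eq`, `remS`), so that only `err` has to be made small, uniformly for
bounded `l` and `r`.

Expand in powers of `e`. With `L f = -f'' + f - m Q ^ (m - 1) f`, the coefficient of `e a' / a` in `err`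
vanishes iff the first corrector `A` solves `(L A)' = coef₁ Λ Q - coef₂ Q' - (1 - l) Q / (m - 1) + (z Q ^ m)'`,
where `Λ Q` is the scaling derivative of `Q`. The kernel of `L` is spanned by `Q'`, and `L (Λ Q) = -Q`.
Hence the equation is solvable among functions that vanish at `+∞` and have a limit at `-∞` exactly
when the source is orthogonal to `Q`; this forces the formula of `f₁`. Multiples of `Q'` and the
choice of `coef₂`, that is of `f₂`, then give the orthogonality of `A` to `z Q` and `Q`
(`exists_corrector`, `exists_first_corrector`). For `m = 3` the coefficients of `e² a'² / a²` and `e² a'' / a`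
are removed in the same way by a second corrector, which may grow linearly at `-∞`
(`exists_second_corrector`). Its solvability is the formula of `f₃`; it follows from the equation of `A`
and an integration by parts (`cubic_solvability`). Sources and correctors are polynomials in `l`, so
it is enough to solve finitely many equations, and uniformity in `c` is automatic.

The operator `L` is inverted on localized functions by the factorizations `L = D* D + e₀` and
`D D* + e₀ = E* E`, where `D` annihilates `Q ^ ((m + 1) / 2)` and `E` annihilates `Q`: the equation `L f = g`
becomes a chain of three explicitly solvable first order equations (`exists_loc_linOp_eq`). A smooth
step times a polynomial carries the tail of `f` on the left (`Tail`).

What remains of `err` is quadratic in the correction or comes from a Taylor remainder of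
`a (s + e z) / a s`. The classes `Sca` and `Fam` record bounds `e ^ i exp (-γ |s|) ^ j` times a weight that is
polynomial in `z⁻` and in the slow variable `e z⁻` and decays exponentially in `z⁺`; they are stable
under the operations that occur, and give `err = O(e²)`, and `O(e³ (1 + z⁻))` if `m = 3`
(`fam_err_of_ne_three`, `fam_err_of_three`). On `y ≥ -3 / ε` the slow variable is bounded, and the length of
this region accounts for the power `ε ^ (3 / 2)` in the `L²` bound.

The constants do not depend on the time because `c` stays in a compact subset of `(0, ∞)`. If `λ ≤ λ₀`,
then `C` increases from `1` and `C a ^ (-p)` decreases; if `λ > λ₀`, then `C < λ / λ₀` and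
`C ^ λ₀ (λ / λ₀ - C) ^ (1 - λ₀) a ^ (-p)` is conserved, which bounds `C` from below by a multiple of
`(1 - λ₀ / λ) ^ ((1 - λ₀) / λ₀)` that tends to `1` with `ε` (`exists_scaling_bounds`). These bounds hold for
all times, so the escape time plays no role.
-/

open Set Filter Topology MeasureTheory
open scoped ContDiff


namespace GKdV

/-! ### Uniform bounds on the derivatives of families of functions -/

/-- The family `F p`, `p ∈ S`, consists of `C^n` functions whose derivatives of order at most `n`
are bounded by a constant multiple of the weight `W p`, with constants independent of `p ∈ S`. -/
def UBound {ι : Type*} (S : Set ι) (n : ℕ) (W F : ι → ℝ → ℝ) : Prop :=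
  (∀ p ∈ S, ContDiff ℝ n (F p)) ∧
    ∀ j ≤ n, ∃ K, ∀ p ∈ S, ∀ y, |iteratedDeriv j (F p) y| ≤ K * W p y

section UBound

variable {ι : Type*} {S : Set ι} {n : ℕ} {W W₁ W₂ F G : ι → ℝ → ℝ}

theorem UBound.contDiff (h : UBound S n W F) {p : ι} (hp : p ∈ S) : ContDiff ℝ n (F p) := h.1 p hp

theorem UBound.bound (h : UBound S n W F) : ∃ K, ∀ p ∈ S, ∀ y, |F p y| ≤ K * W p y := by
  simpa using h.2 0 (Nat.zero_le _)

theorem UBound.of_le {k : ℕ} (h : UBound S n W F) (hk : k ≤ n) : UBound S k W F :=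
  ⟨fun p hp => (h.1 p hp).of_le (by exact_mod_cast hk), fun j hj => h.2 j (hj.trans hk)⟩

theorem UBound.congr (h : UBound S n W F) (hFG : ∀ p ∈ S, ∀ y, F p y = G p y) :
    UBound S n W G := by
  have h1 : ∀ p ∈ S, F p = G p := fun p hp => funext (hFG p hp)
  refine ⟨fun p hp => h1 p hp ▸ h.1 p hp, fun j hj => ?_⟩
  obtain ⟨K, hK⟩ := h.2 j hj
  exact ⟨K, fun p hp y => h1 p hp ▸ hK p hp y⟩

theorem UBound.mono (h : UBound S n W F) {K' : ℝ} (hW : ∀ p ∈ S, ∀ y, |W p y| ≤ K' * W₁ p y) :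
    UBound S n W₁ F := by
  refine ⟨h.1, fun j hj => ?_⟩
  obtain ⟨K, hK⟩ := h.2 j hj
  refine ⟨|K| * K', fun p hp y => ?_⟩
  calc |iteratedDeriv j (F p) y| ≤ K * W p y := hK p hp y
    _ ≤ |K| * |W p y| := by rw [← abs_mul]; exact le_abs_self _
    _ ≤ |K| * (K' * W₁ p y) := by gcongr; exact hW p hp y
    _ = _ := by ring

theorem UBound.add (hF : UBound S n W F) (hG : UBound S n W G) :
    UBound S n W (fun p y => F p y + G p y) := by
  refine ⟨fun p hp => (hF.1 p hp).add (hG.1 p hp), fun j hj => ?_⟩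
  obtain ⟨K, hK⟩ := hF.2 j hj
  obtain ⟨K', hK'⟩ := hG.2 j hj
  refine ⟨K + K', fun p hp y => ?_⟩
  have hj' : (j : WithTop ℕ∞) ≤ n := by exact_mod_cast hj
  have := iteratedDeriv_add (x := y) (((hF.1 p hp).of_le hj').contDiffAt)
    (((hG.1 p hp).of_le hj').contDiffAt)
  calc _ = |iteratedDeriv j (F p + G p) y| := rfl
    _ ≤ _ := by
      rw [this]
      exact (abs_add_le _ _).trans (by rw [add_mul]; exact add_le_add (hK p hp y) (hK' p hp y))

theorem UBound.mul (hF : UBound S n W₁ F) (hG : UBound S n W₂ G) :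
    UBound S n (fun p y => W₁ p y * W₂ p y) (fun p y => F p y * G p y) := by
  refine ⟨fun p hp => (hF.1 p hp).mul (hG.1 p hp), fun j hj => ?_⟩
  have hF' : ∀ i, ∃ K, i ≤ n → ∀ p ∈ S, ∀ y, |iteratedDeriv i (F p) y| ≤ K * W₁ p y := fun i => by
    by_cases hi : i ≤ n
    · exact (hF.2 i hi).imp fun K hK _ => hK
    · exact ⟨0, fun h => absurd h hi⟩
  have hG' : ∀ i, ∃ K, i ≤ n → ∀ p ∈ S, ∀ y, |iteratedDeriv i (G p) y| ≤ K * W₂ p y := fun i => by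
    by_cases hi : i ≤ n
    · exact (hG.2 i hi).imp fun K hK _ => hK
    · exact ⟨0, fun h => absurd h hi⟩
  choose K hK using hF'
  choose K' hK' using hG'
  refine ⟨∑ i ∈ Finset.range (j + 1), (j.choose i : ℝ) * (K i * K' (j - i)), fun p hp y => ?_⟩
  have hj' : (j : WithTop ℕ∞) ≤ n := by exact_mod_cast hj
  have := iteratedDeriv_mul (x := y) (((hF.1 p hp).of_le hj').contDiffAt)
    (((hG.1 p hp).of_le hj').contDiffAt)
  calc _ = |iteratedDeriv j (F p * G p) y| := rfl
    _ ≤ _ := by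
      rw [this, Finset.sum_mul]
      refine (Finset.abs_sum_le_sum_abs _ _).trans (Finset.sum_le_sum fun i hi => ?_)
      have hi' : i ≤ j := Nat.lt_succ_iff.1 (Finset.mem_range.1 hi)
      rw [abs_mul, abs_mul, Nat.abs_cast]
      have h1 := hK i (hi'.trans hj) p hp y
      have h2 := hK' (j - i) ((Nat.sub_le _ _).trans hj) p hp y
      calc _ ≤ (j.choose i : ℝ) * (K i * W₁ p y) * (K' (j - i) * W₂ p y) := by
            gcongr
            exact mul_nonneg (Nat.cast_nonneg _) ((abs_nonneg _).trans h1)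
        _ = _ := by ring

theorem UBound.scalar {g w : ι → ℝ} {K : ℝ} (h : ∀ p ∈ S, |g p| ≤ K * w p) :
    UBound S n (fun p _ => w p) (fun p _ => g p) := by
  refine ⟨fun p _ => contDiff_const, fun j _ => ⟨if j = 0 then K else 0, fun p hp y => ?_⟩⟩
  rw [iteratedDeriv_const]
  split_ifs
  · exact h p hp
  · simp

theorem UBound.const_mul (r : ℝ) (hF : UBound S n W F) : UBound S n W (fun p y => r * F p y) := by
  refine ⟨fun p hp => contDiff_const.mul (hF.1 p hp), fun j hj => ?_⟩
  obtain ⟨K, hK⟩ := hF.2 j hj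
  refine ⟨|r| * K, fun p hp y => ?_⟩
  have hj' : (j : WithTop ℕ∞) ≤ n := by exact_mod_cast hj
  rw [iteratedDeriv_const_mul r ((hF.1 p hp).of_le hj').contDiffAt, abs_mul, mul_assoc]
  gcongr
  exact hK p hp y

theorem UBound.neg (hF : UBound S n W F) : UBound S n W (fun p y => -F p y) := by
  simpa using hF.const_mul (-1)

theorem UBound.sub (hF : UBound S n W F) (hG : UBound S n W G) :
    UBound S n W (fun p y => F p y - G p y) := by
  simpa [sub_eq_add_neg] using hF.add hG.neg

theorem UBound.deriv (h : UBound S (n + 1) W F) : UBound S n W (fun p => deriv (F p)) := by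
  refine ⟨fun p hp => ?_, fun j hj => ?_⟩
  · have := h.1 p hp
    exact ((contDiff_succ_iff_deriv (n := n)).1 (by exact_mod_cast this)).2.2
  · obtain ⟨K, hK⟩ := h.2 (j + 1) (by omega)
    exact ⟨K, fun p hp y => by simpa [iteratedDeriv_succ'] using hK p hp y⟩

theorem UBound.of_deriv {F' : ι → ℝ → ℝ} (hd : ∀ p ∈ S, ∀ y, HasDerivAt (F p) (F' p y) y) {K : ℝ}
    (h0 : ∀ p ∈ S, ∀ y, |F p y| ≤ K * W p y) (h : UBound S n W F') :
    UBound S (n + 1) W F := by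
  have hder : ∀ p ∈ S, _root_.deriv (F p) = F' p := fun p hp => funext fun y => (hd p hp y).deriv
  refine ⟨fun p hp => ?_, fun j hj => ?_⟩
  · have : ContDiff ℝ ((n : WithTop ℕ∞) + 1) (F p) := by
      refine contDiff_succ_iff_deriv.2 ⟨fun y => (hd p hp y).differentiableAt, by simp, ?_⟩
      rw [hder p hp]; exact h.1 p hp
    exact_mod_cast this
  · rcases j with _ | j
    · exact ⟨K, by simpa using h0⟩
    · obtain ⟨K', hK'⟩ := h.2 j (by omega)
      exact ⟨K', fun p hp y => by rw [iteratedDeriv_succ', hder p hp]; exact hK' p hp y⟩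

theorem UBound.of_bound {K : ℝ} (hc : ∀ p ∈ S, Continuous (F p))
    (h0 : ∀ p ∈ S, ∀ y, |F p y| ≤ K * W p y) : UBound S 0 W F := by
  refine ⟨fun p hp => by simpa using hc p hp, fun j hj => ⟨K, ?_⟩⟩
  obtain rfl : j = 0 := by omega
  simpa using h0

theorem UBound.one : UBound S n (fun _ _ => 1) (fun _ _ => 1) :=
  UBound.scalar (g := fun _ => 1) (w := fun _ => 1) (K := 1) (by simp)

end UBound

/-! ### Exponentially localized functions -/

theorem exists_one_add_pow_le_exp (N : ℕ) {δ : ℝ} (hδ : 0 < δ) :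
    ∃ K > 0, ∀ t ≥ 0, (1 + t) ^ N ≤ K * Real.exp (δ * t) := by
  set δ' := δ / (N + 1) with hδ'
  have hp : 0 < δ' := by positivity
  refine ⟨(1 + 1 / δ') ^ N, by positivity, fun t ht => ?_⟩
  have h1 : 1 + t ≤ (1 + 1 / δ') * Real.exp (δ' * t) := by
    have := Real.add_one_le_exp (δ' * t)
    have h2 : 1 + t ≤ (1 + 1 / δ') * (δ' * t + 1) := by
      have : (1 + 1 / δ') * (δ' * t + 1) = 1 + t + δ' * t + 1 / δ' := by field_simp; ring
      rw [this]
      have : 0 ≤ δ' * t + 1 / δ' := by positivity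
      linarith
    exact h2.trans (by gcongr)
  calc (1 + t) ^ N ≤ ((1 + 1 / δ') * Real.exp (δ' * t)) ^ N := by gcongr
    _ = (1 + 1 / δ') ^ N * Real.exp (N * (δ' * t)) := by rw [mul_pow, Real.exp_nat_mul]
    _ ≤ (1 + 1 / δ') ^ N * Real.exp (δ * t) := by
      have : (N : ℝ) * δ' ≤ δ := by
        rw [hδ', mul_div_assoc']
        rw [div_le_iff₀ (by positivity)]
        nlinarith
      have h3 := mul_le_mul_of_nonneg_right this ht
      exact mul_le_mul_of_nonneg_left (Real.exp_le_exp.2 (by linarith)) (by positivity)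

theorem integrable_exp_neg_mul_abs {κ : ℝ} (hκ : 0 < κ) :
    Integrable fun x : ℝ => Real.exp (-κ * |x|) := by
  have h1 : IntegrableOn (fun x : ℝ => Real.exp (-κ * |x|)) (Ioi 0) :=
    (integrableOn_exp_mul_Ioi (neg_lt_zero.2 hκ) 0).congr_fun
      (fun x hx => by simp [abs_of_pos (mem_Ioi.1 hx)]) measurableSet_Ioi
  have h2 : IntegrableOn (fun x : ℝ => Real.exp (-κ * |x|)) (Iio 0) := by
    have := h1.comp_neg
    simpa using this
  have h3 : IntegrableOn (fun x : ℝ => Real.exp (-κ * |x|)) (Iic 0) := by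
    rwa [integrableOn_Iic_iff_integrableOn_Iio]
  rw [← integrableOn_univ, ← Iic_union_Ioi (a := (0 : ℝ))]
  exact h3.union h1

/-- The `C^n` functions whose derivatives of order at most `n` are bounded by multiples of `W`. -/
def DBound (n : ℕ) (W f : ℝ → ℝ) : Prop :=
  UBound (univ : Set Unit) n (fun _ => W) (fun _ => f)

/-- Smooth functions all of whose derivatives are bounded. -/
def BddAll (f : ℝ → ℝ) : Prop := ∀ n, DBound n (fun _ => 1) f

/-- Smooth functions all of whose derivatives are `O(exp (-κ |x|))` for every `κ < 1`. Excluding the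
rate `1` of the ground state itself makes the class stable under multiplication by polynomials. -/
def Loc (f : ℝ → ℝ) : Prop := ∀ n, ∀ κ < 1, DBound n (fun x => Real.exp (-κ * |x|)) f

theorem contDiff_infty_of_forall {f : ℝ → ℝ} (h : ∀ n : ℕ, ContDiff ℝ n f) : ContDiff ℝ ∞ f :=
  contDiff_infty.2 h

section
variable {f g u : ℝ → ℝ}

theorem BddAll.contDiff (h : BddAll f) : ContDiff ℝ ∞ f :=
  contDiff_infty_of_forall fun n => (h n).1 () trivial

theorem Loc.contDiff (h : Loc f) : ContDiff ℝ ∞ f :=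
  contDiff_infty_of_forall fun n => (h n 0 one_pos).1 () trivial

theorem Loc.differentiable (h : Loc f) : Differentiable ℝ f :=
  h.contDiff.differentiable (by simp)

theorem Loc.continuous (h : Loc f) : Continuous f := h.contDiff.continuous

theorem Loc.bound (h : Loc f) {κ : ℝ} (hκ : κ < 1) : ∃ K, ∀ x, |f x| ≤ K * Real.exp (-κ * |x|) := by
  obtain ⟨K, hK⟩ := (h 0 κ hκ).bound
  exact ⟨K, hK () trivial⟩

theorem Loc.congr (h : Loc f) (hfg : ∀ x, f x = g x) : Loc g := funext hfg ▸ h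

theorem BddAll.congr (h : BddAll f) (hfg : ∀ x, f x = g x) : BddAll g := funext hfg ▸ h

theorem Loc.add (hf : Loc f) (hg : Loc g) : Loc fun x => f x + g x := fun n κ hκ =>
  UBound.add (hf n κ hκ) (hg n κ hκ)

theorem Loc.sub (hf : Loc f) (hg : Loc g) : Loc fun x => f x - g x := fun n κ hκ =>
  UBound.sub (hf n κ hκ) (hg n κ hκ)

theorem Loc.neg (hf : Loc f) : Loc fun x => -f x := fun n κ hκ => UBound.neg (hf n κ hκ)

theorem Loc.const_mul (r : ℝ) (hf : Loc f) : Loc fun x => r * f x := fun n κ hκ =>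
  UBound.const_mul r (hf n κ hκ)

theorem Loc.zero : Loc fun _ => 0 := fun n κ _ =>
  ⟨fun _ _ => contDiff_const, fun j _ => ⟨0, fun _ _ x => by simp⟩⟩

theorem BddAll.add (hf : BddAll f) (hg : BddAll g) : BddAll fun x => f x + g x := fun n =>
  UBound.add (hf n) (hg n)

theorem BddAll.const_mul (r : ℝ) (hf : BddAll f) : BddAll fun x => r * f x := fun n =>
  UBound.const_mul r (hf n)

theorem BddAll.const (r : ℝ) : BddAll fun _ => r := fun n => by
  simpa [DBound] using UBound.const_mul r (UBound.one (S := (univ : Set Unit)) (n := n))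

theorem Loc.bddAll (hf : Loc f) : BddAll f := fun n => by
  have := hf n 0 one_pos
  simpa using this

theorem Loc.bdd_mul (hf : BddAll f) (hg : Loc g) : Loc fun x => f x * g x := fun n κ hκ => by
  simpa only [DBound, one_mul] using UBound.mul (hf n) (hg n κ hκ)

theorem Loc.mul (hf : Loc f) (hg : Loc g) : Loc fun x => f x * g x := Loc.bdd_mul hf.bddAll hg

theorem Loc.deriv (hf : Loc f) : Loc (deriv f) := fun n κ hκ => UBound.deriv (hf (n + 1) κ hκ)

theorem Loc.id_mul (hf : Loc f) : Loc fun x => x * f x := fun n κ hκ => by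
  have hid : DBound n (fun x => 1 + |x|) fun x => x := by
    rcases n with _ | n
    · exact UBound.of_bound (K := 1) (fun _ _ => continuous_id) (fun _ _ x => by simp)
    · refine UBound.of_deriv (F' := fun _ _ => 1) (K := 1) (fun _ _ x => hasDerivAt_id x)
        (fun _ _ x => by simp) (UBound.one.mono (K' := 1) fun _ _ x => by simp)
  obtain ⟨K, hK0, hK⟩ := exists_one_add_pow_le_exp 1 (δ := (1 - κ) / 2) (by linarith)
  refine (UBound.mul hid (hf n ((κ + 1) / 2) (by linarith))).mono (K' := K) fun _ _ x => ?_
  have := hK |x| (abs_nonneg x)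
  rw [pow_one] at this
  rw [abs_of_nonneg (by positivity)]
  calc _ ≤ K * Real.exp ((1 - κ) / 2 * |x|) * Real.exp (-((κ + 1) / 2) * |x|) := by gcongr
    _ = K * Real.exp (-κ * |x|) := by rw [mul_assoc, ← Real.exp_add]; ring_nf

/-- Localization propagates from a function to all its derivatives through a first order linear
equation with bounded smooth coefficient and localized source. -/
theorem Loc.of_ode (hd : ∀ x, HasDerivAt f (u x * f x + g x) x) (hu : BddAll u) (hg : Loc g)
    (hb : ∀ κ, 0 < κ → κ < 1 → ∃ K, ∀ x, |f x| ≤ K * Real.exp (-κ * |x|)) : Loc f := by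
  have hb' : ∀ κ < 1, ∃ K, ∀ x, |f x| ≤ K * Real.exp (-κ * |x|) := fun κ hκ => by
    obtain ⟨K, hK⟩ := hb (max κ (1 / 2)) (by positivity) (by simp [hκ]; norm_num)
    refine ⟨K, fun x => (hK x).trans ?_⟩
    have hK0 : 0 ≤ K := by
      have := (abs_nonneg _).trans (hK 0)
      simpa using this
    gcongr
    exact le_max_left _ _
  have hc : Continuous f := continuous_iff_continuousAt.2 fun x => (hd x).continuousAt
  intro n κ hκ
  obtain ⟨K, hK⟩ := hb' κ hκ
  induction n with
  | zero => exact UBound.of_bound (K := K) (fun _ _ => hc) fun _ _ => hK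
  | succ n ih =>
    have h1 := UBound.mul (hu n) ih
    simp only [one_mul] at h1
    exact UBound.of_deriv (fun _ _ => hd) (fun _ _ => hK) (UBound.add h1 (hg n κ hκ))

theorem Loc.integrable (hf : Loc f) : Integrable f := by
  obtain ⟨K, hK⟩ := hf.bound (κ := 1 / 2) (by norm_num)
  exact ((integrable_exp_neg_mul_abs (κ := 1 / 2) (by norm_num)).const_mul K).mono'
    hf.continuous.aestronglyMeasurable (Eventually.of_forall hK)

theorem tendsto_exp_neg_mul_abs {κ : ℝ} (hκ : 0 < κ) {l : Filter ℝ} (hl : Tendsto abs l atTop) :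
    Tendsto (fun x : ℝ => Real.exp (-κ * |x|)) l (𝓝 0) :=
  Real.tendsto_exp_atBot.comp (hl.const_mul_atTop_of_neg (neg_lt_zero.2 hκ))

theorem Loc.tendsto (hf : Loc f) {l : Filter ℝ} (hl : Tendsto abs l atTop) :
    Tendsto f l (𝓝 0) := by
  obtain ⟨K, hK⟩ := hf.bound (κ := 1 / 2) (by norm_num)
  refine squeeze_zero_norm hK ?_
  simpa using (tendsto_exp_neg_mul_abs (κ := 1 / 2) (by norm_num) hl).const_mul K

theorem Loc.tendsto_atTop (hf : Loc f) : Tendsto f atTop (𝓝 0) := hf.tendsto tendsto_abs_atTop_atTop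

theorem Loc.tendsto_atBot (hf : Loc f) : Tendsto f atBot (𝓝 0) := hf.tendsto tendsto_abs_atBot_atTop

theorem Loc.of_hasDerivAt (hf : Loc f) (hd : ∀ x, HasDerivAt f (g x) x) : Loc g :=
  hf.deriv.congr fun x => (hd x).deriv

theorem Loc.integral_eq_zero (hf : Loc f) (hd : ∀ x, HasDerivAt f (g x) x) : ∫ x, g x = 0 := by
  simpa using integral_of_hasDerivAt_of_tendsto hd (hf.of_hasDerivAt hd).integrable hf.tendsto_atBot
    hf.tendsto_atTop

theorem abs_le_of_hasDerivAt_of_tendsto {K κ a : ℝ} (hκ : 0 < κ)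
    (hd : ∀ x, HasDerivAt f (g x) x) (hg : Continuous g) (hK : ∀ x ≥ a, |g x| ≤ K * Real.exp (-κ * x))
    (ht : Tendsto f atTop (𝓝 0)) : ∀ x ≥ a, |f x| ≤ K / κ * Real.exp (-κ * x) := by
  intro x hx
  have hint := (integrableOn_exp_mul_Ioi (neg_lt_zero.2 hκ) x).const_mul K
  have hgi : IntegrableOn g (Ioi x) := by
    refine hint.mono' hg.aestronglyMeasurable ?_
    filter_upwards [ae_restrict_mem measurableSet_Ioi] with t ht
    exact hK t (hx.trans (le_of_lt ht))
  have h1 := integral_Ioi_of_hasDerivAt_of_tendsto (hd x).continuousAt.continuousWithinAt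
    (fun t _ => hd t) hgi ht
  have h2 : ‖∫ t in Ioi x, g t‖ ≤ ∫ t in Ioi x, K * Real.exp (-κ * t) := by
    refine norm_integral_le_of_norm_le hint ?_
    filter_upwards [ae_restrict_mem measurableSet_Ioi] with t ht
    exact hK t (hx.trans (le_of_lt ht))
  rw [h1, integral_const_mul, integral_exp_mul_Ioi (neg_lt_zero.2 hκ)] at h2
  simp only [zero_sub, norm_neg, Real.norm_eq_abs] at h2
  refine h2.trans (le_of_eq ?_)
  field_simp

/-- A primitive of a localized function is localized as soon as it vanishes at both ends. -/
theorem Loc.of_primitive (hg : Loc g) (hd : ∀ x, HasDerivAt f (g x) x)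
    (ht : Tendsto f atTop (𝓝 0)) (hb : Tendsto f atBot (𝓝 0)) : Loc f := by
  refine Loc.of_ode (u := fun _ => 0) (g := g) (fun x => by simpa using hd x) (BddAll.const 0) hg
    fun κ hκ hκ1 => ?_
  obtain ⟨K, hK⟩ := hg.bound hκ1
  have h1 := abs_le_of_hasDerivAt_of_tendsto (a := 0) (K := K) hκ hd hg.continuous
    (fun x hx => by simpa [abs_of_nonneg hx] using hK x) ht
  have h2 := abs_le_of_hasDerivAt_of_tendsto (f := fun x => f (-x)) (g := fun x => -g (-x)) (a := 0)
    (K := K) hκ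
    (fun x => by simpa [Function.comp_def] using (hd (-x)).comp x (hasDerivAt_neg x))
    (hg.continuous.comp continuous_neg).neg
    (fun x hx => by simpa [abs_of_nonneg hx] using hK (-x)) (hb.comp tendsto_neg_atTop_atBot)
  refine ⟨K / κ, fun x => ?_⟩
  rcases le_total 0 x with hx | hx
  · simpa [abs_of_nonneg hx] using h1 x hx
  · simpa [abs_of_nonpos hx] using h2 (-x) (by linarith)

end

/-! ### The ground state -/

/-- `n = (m + 1) / 2`, the power of `Q` that gives the ground state of the linearized operator. -/
noncomputable def nExp (m : ℕ) : ℝ := ((m : ℝ) + 1) / 2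

/-- The logarithmic derivative `Q' / Q = - tanh ((m - 1) x / 2)`. -/
noncomputable def logQ (m : ℕ) (x : ℝ) : ℝ :=
  -(Real.sinh (((m : ℝ) - 1) / 2 * x) / Real.cosh (((m : ℝ) - 1) / 2 * x))

/-- The potential `Q ^ (m - 1)`. -/
noncomputable def potQ (m : ℕ) (x : ℝ) : ℝ :=
  ((m : ℝ) + 1) / (2 * Real.cosh (((m : ℝ) - 1) / 2 * x) ^ 2)

/-- The real power `Q ^ β`. -/
noncomputable def powQ (m : ℕ) (β x : ℝ) : ℝ := potQ m x ^ (β / ((m : ℝ) - 1))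

section
variable {m : ℕ} (x : ℝ)

theorem nExp_pos : 0 < nExp m := by unfold nExp; positivity

theorem potQ_pos : 0 < potQ m x := by unfold potQ; have := Real.cosh_pos (((m : ℝ) - 1) / 2 * x); positivity

theorem powQ_pos (β : ℝ) : 0 < powQ m β x := Real.rpow_pos_of_pos (potQ_pos x) _

theorem powQ_one : powQ m 1 x = Q m x := rfl

theorem Q_pos : 0 < Q m x := powQ_pos x 1

theorem hasDerivAt_potQ : HasDerivAt (potQ m) (((m : ℝ) - 1) * logQ m x * potQ m x) x := by
  have hc := (Real.cosh_pos (((m : ℝ) - 1) / 2 * x)).ne'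
  have h1 : HasDerivAt (fun y : ℝ => ((m : ℝ) - 1) / 2 * y) (((m : ℝ) - 1) / 2) x := by
    simpa using (hasDerivAt_id x).const_mul (((m : ℝ) - 1) / 2)
  have h2 := ((h1.cosh.pow 2).const_mul 2).inv (by simpa using hc) |>.const_mul ((m : ℝ) + 1)
  refine h2.congr_deriv ?_ |>.congr_of_eventuallyEq ?_
  · unfold logQ potQ
    simp only [Pi.pow_apply, Nat.cast_ofNat]
    generalize ((m : ℝ) - 1) / 2 * x = t at hc ⊢
    field_simp
    ring
  · exact Eventually.of_forall fun y => by simp [potQ, div_eq_mul_inv]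

theorem hasDerivAt_logQ : HasDerivAt (logQ m) (-((nExp m - 1) / nExp m) * potQ m x) x := by
  have hc := (Real.cosh_pos (((m : ℝ) - 1) / 2 * x)).ne'
  have h1 : HasDerivAt (fun y : ℝ => ((m : ℝ) - 1) / 2 * y) (((m : ℝ) - 1) / 2) x := by
    simpa using (hasDerivAt_id x).const_mul (((m : ℝ) - 1) / 2)
  refine (h1.sinh.div h1.cosh hc).neg.congr_deriv ?_
  have h := Real.cosh_sq (((m : ℝ) - 1) / 2 * x)
  have h3 : (m : ℝ) + 1 ≠ 0 := by positivity
  unfold nExp potQ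
  generalize ((m : ℝ) - 1) / 2 * x = t at h hc ⊢
  field_simp
  linear_combination (1 - (m : ℝ)) * h

theorem logQ_sq : logQ m x ^ 2 = 1 - potQ m x / nExp m := by
  have hc := (Real.cosh_pos (((m : ℝ) - 1) / 2 * x)).ne'
  have h := Real.cosh_sq (((m : ℝ) - 1) / 2 * x)
  have h3 : (m : ℝ) + 1 ≠ 0 := by positivity
  unfold logQ potQ nExp
  generalize ((m : ℝ) - 1) / 2 * x = t at h hc ⊢
  field_simp
  linear_combination -h

theorem abs_logQ_le : |logQ m x| ≤ 1 := by
  have := logQ_sq (m := m) x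
  have h2 : 0 ≤ potQ m x / nExp m := (div_pos (potQ_pos x) nExp_pos).le
  exact abs_le_one_iff_mul_self_le_one.2 (by nlinarith)

theorem potQ_neg : potQ m (-x) = potQ m x := by simp [potQ]

theorem powQ_neg (β : ℝ) : powQ m β (-x) = powQ m β x := by simp [powQ, potQ_neg]

theorem Q_neg : Q m (-x) = Q m x := powQ_neg x 1

theorem logQ_neg : logQ m (-x) = -logQ m x := by simp [logQ, neg_div]

theorem bddAll_logQ : BddAll (logQ m) := by
  intro n
  induction n with
  | zero =>
    exact UBound.of_bound (K := 1)
      (fun _ _ => continuous_iff_continuousAt.2 fun x => (hasDerivAt_logQ x).continuousAt)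
      fun _ _ x => by simpa using abs_logQ_le x
  | succ n ih =>
    have h1 := UBound.mul ih ih
    simp only [mul_one] at h1
    have h2 := UBound.const_mul (nExp m - 1)
      (UBound.sub h1 (UBound.one (S := (univ : Set Unit)) (n := n)))
    refine UBound.of_deriv (fun _ _ x => hasDerivAt_logQ x) (K := 1)
      (fun _ _ x => by simpa using abs_logQ_le x) (h2.congr fun _ _ x => ?_)
    have := logQ_sq (m := m) x
    have h0 := (nExp_pos (m := m)).ne'
    field_simp at this ⊢
    linear_combination (nExp m - 1) * this

theorem hasDerivAt_powQ (hm : 2 ≤ m) (β : ℝ) :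
    HasDerivAt (powQ m β) (β * logQ m x * powQ m β x) x := by
  have hm' : (m : ℝ) - 1 ≠ 0 := by
    have : (2 : ℝ) ≤ m := by exact_mod_cast hm
    linarith
  have hP := potQ_pos (m := m) x
  refine ((hasDerivAt_potQ x).rpow_const (p := β / ((m : ℝ) - 1)) (Or.inl hP.ne')).congr_deriv ?_
  unfold powQ
  rw [Real.rpow_sub_one hP.ne']
  field_simp

theorem hasDerivAt_Q (hm : 2 ≤ m) : HasDerivAt (Q m) (logQ m x * Q m x) x :=
  (hasDerivAt_powQ x hm 1).congr_deriv (by rw [one_mul, powQ_one])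

theorem powQ_m_sub_one (hm : 2 ≤ m) : powQ m ((m : ℝ) - 1) x = potQ m x := by
  have hm' : (m : ℝ) - 1 ≠ 0 := by
    have : (2 : ℝ) ≤ m := by exact_mod_cast hm
    linarith
  simp [powQ, div_self hm']

theorem powQ_add (β γ : ℝ) : powQ m (β + γ) x = powQ m β x * powQ m γ x := by
  simp [powQ, add_div, Real.rpow_add (potQ_pos x)]

theorem Q_pow (hm : 2 ≤ m) : Q m x ^ m = potQ m x * Q m x := by
  have hm' : (m : ℝ) - 1 ≠ 0 := by
    have : (2 : ℝ) ≤ m := by exact_mod_cast hm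
    linarith
  rw [← powQ_m_sub_one x hm, ← powQ_one, ← powQ_add, powQ, powQ, ← Real.rpow_natCast,
    ← Real.rpow_mul (potQ_pos x).le]
  congr 1
  ring

theorem exists_powQ_bounds (hm : 2 ≤ m) {β : ℝ} (hβ : 0 ≤ β) :
    ∃ c > 0, ∃ C > 0, ∀ x, c * Real.exp (-β * |x|) ≤ powQ m β x ∧
      powQ m β x ≤ C * Real.exp (-β * |x|) := by
  have hm2 : (2 : ℝ) ≤ m := by exact_mod_cast hm
  have hm' : 0 < (m : ℝ) - 1 := by linarith
  set r := β / ((m : ℝ) - 1) with hr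
  have hr0 : 0 ≤ r := by positivity
  refine ⟨nExp m ^ r, Real.rpow_pos_of_pos nExp_pos _, (4 * nExp m) ^ r,
    Real.rpow_pos_of_pos (by have := nExp_pos (m := m); positivity) _, fun x => ?_⟩
  have he : ∀ C : ℝ, 0 < C →
      C ^ r * Real.exp (-β * |x|) = (C * Real.exp (-((m : ℝ) - 1) * |x|)) ^ r := fun C hC => by
    rw [Real.mul_rpow hC.le (Real.exp_pos _).le, ← Real.exp_mul]
    congr 2
    rw [hr]; field_simp
  have hn := nExp_pos (m := m)
  rw [he _ hn, he _ (by positivity)]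
  set t := ((m : ℝ) - 1) / 2 * |x| with ht
  have ht0 : 0 ≤ t := by positivity
  have hcosh : Real.cosh (((m : ℝ) - 1) / 2 * x) = Real.cosh t := by
    rw [ht, ← Real.cosh_abs (((m : ℝ) - 1) / 2 * x), abs_mul, abs_of_pos (by linarith : 0 < ((m : ℝ) - 1) / 2)]
  have hP : potQ m x = nExp m / Real.cosh t ^ 2 := by
    unfold potQ nExp; rw [hcosh]; field_simp
  have hE : Real.exp (-((m : ℝ) - 1) * |x|) = 1 / Real.exp t ^ 2 := by
    rw [← Real.exp_nat_mul, one_div, ← Real.exp_neg]; congr 1; rw [ht]; push_cast; ring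
  have hc1 : Real.cosh t ≤ Real.exp t := by
    rw [Real.cosh_eq]; have : Real.exp (-t) ≤ Real.exp t := Real.exp_le_exp.2 (by linarith)
    linarith
  have hc2 : Real.exp t ≤ 2 * Real.cosh t := by
    rw [Real.cosh_eq]; have := Real.exp_pos (-t); linarith
  have hcp := Real.cosh_pos t
  have hep := Real.exp_pos t
  unfold powQ
  rw [hP, hE]
  constructor
  · gcongr
    rw [mul_one_div]; gcongr
  · gcongr
    rw [mul_one_div, div_le_div_iff₀ (by positivity) (by positivity)]
    have : Real.exp t ^ 2 ≤ (2 * Real.cosh t) ^ 2 := by gcongr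
    nlinarith

theorem loc_powQ (hm : 2 ≤ m) {β : ℝ} (hβ : 1 ≤ β) : Loc (powQ m β) := by
  refine Loc.of_ode (u := fun x => β * logQ m x) (g := fun _ => 0)
    (fun x => by simpa using hasDerivAt_powQ x hm β) (bddAll_logQ.const_mul β) Loc.zero
    fun κ _ hκ => ?_
  obtain ⟨c, _, C, hC, h⟩ := exists_powQ_bounds hm (by linarith : 0 ≤ β)
  refine ⟨C, fun x => ?_⟩
  rw [abs_of_pos (powQ_pos x β)]
  exact (h x).2.trans (by gcongr; linarith)

theorem loc_Q (hm : 2 ≤ m) : Loc (Q m) := loc_powQ hm le_rfl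

theorem loc_potQ (hm : 2 ≤ m) : Loc (potQ m) :=
  (loc_powQ hm (β := (m : ℝ) - 1) (by have : (2 : ℝ) ≤ m := by exact_mod_cast hm
                                      linarith)).congr fun x => powQ_m_sub_one x hm

theorem powQ_le_powQ (hm : 2 ≤ m) {β : ℝ} (hβ : 0 ≤ β) {x y : ℝ} (hx : 0 ≤ x) (hxy : x ≤ y) :
    powQ m β y ≤ powQ m β x := by
  have hm2 : (2 : ℝ) ≤ m := by exact_mod_cast hm
  have hm' : 0 < (m : ℝ) - 1 := by linarith
  unfold powQ
  refine Real.rpow_le_rpow (potQ_pos y).le ?_ (by positivity)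
  unfold potQ
  have h1 := Real.cosh_pos (((m : ℝ) - 1) / 2 * x)
  have h2 : Real.cosh (((m : ℝ) - 1) / 2 * x) ≤ Real.cosh (((m : ℝ) - 1) / 2 * y) := by
    rw [Real.cosh_le_cosh, abs_of_nonneg (by positivity), abs_of_nonneg (by have := hx.trans hxy; positivity)]
    gcongr
  gcongr

end

/-! ### Inverting the linearized operator on localized functions -/

section
variable {m : ℕ}

theorem exists_primitive {g : ℝ → ℝ} (hc : Continuous g) (hi : Integrable g) :
    ∃ F : ℝ → ℝ, (∀ x, HasDerivAt F (g x) x) ∧ Tendsto F atTop (𝓝 0) ∧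
      Tendsto F atBot (𝓝 (-∫ x, g x)) := by
  refine ⟨fun x => (∫ t in (0 : ℝ)..x, g t) - ∫ t in Ioi 0, g t, fun x => ?_, ?_, ?_⟩
  · exact (intervalIntegral.integral_hasDerivAt_right (hc.intervalIntegrable _ _)
      (hc.stronglyMeasurableAtFilter _ _) hc.continuousAt).sub_const _
  · simpa using (intervalIntegral_tendsto_integral_Ioi 0 hi.integrableOn tendsto_id).sub_const
      (∫ t in Ioi 0, g t)
  · have h := (intervalIntegral_tendsto_integral_Iic 0 hi.integrableOn tendsto_id).neg.sub_const
      (∫ t in Ioi 0, g t)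
    have h2 : -(∫ t in Iic 0, g t) - ∫ t in Ioi 0, g t = -∫ x, g x := by
      rw [← intervalIntegral.integral_Iic_add_Ioi hi.integrableOn hi.integrableOn (b := 0)]; ring
    rw [h2] at h
    refine h.congr fun x => ?_
    simp [intervalIntegral.integral_symm 0 x]

/-- The localized solution of `k' + β (Q' / Q) k = - f`. -/
theorem exists_loc_solution_powQ (hm : 2 ≤ m) {β : ℝ} (hβ : 1 ≤ β) {f : ℝ → ℝ} (hf : Loc f)
    (h0 : ∫ x, powQ m β x * f x = 0) :
    ∃ k, Loc k ∧ ∀ x, HasDerivAt k (-(β * logQ m x * k x) - f x) x := by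
  have hE := loc_powQ hm hβ
  have hEf := hE.mul hf
  obtain ⟨F, hF, hT, hB⟩ := exists_primitive hEf.continuous hEf.integrable
  rw [h0, neg_zero] at hB
  have hd : ∀ x, HasDerivAt (fun x => -(F x / powQ m β x))
      (-(β * logQ m x * -(F x / powQ m β x)) - f x) x := fun x => by
    have hp := (powQ_pos (m := m) x β).ne'
    refine ((hF x).div (hasDerivAt_powQ x hm β) hp).neg.congr_deriv ?_
    field_simp
    ring
  refine ⟨fun x => -(F x / powQ m β x), ?_, hd⟩
  refine Loc.of_ode (u := fun x => -β * logQ m x) (g := fun x => -f x)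
    (fun x => (hd x).congr_deriv (by ring)) (bddAll_logQ.const_mul _) hf.neg fun κ hκ hκ1 => ?_
  obtain ⟨K, hK⟩ := hf.bound hκ1
  have hK' : ∀ x t : ℝ, 0 ≤ x → x ≤ t → ∀ s, |s| = t →
      |powQ m β s * f s| ≤ powQ m β x * K * Real.exp (-κ * t) := by
    intro x t hx hxt s hs
    have h1 : powQ m β s = powQ m β t := by
      rcases abs_cases s with ⟨h, _⟩ | ⟨h, _⟩
      · rw [← hs, h]
      · rw [← hs, h, powQ_neg]
    rw [abs_mul, abs_of_pos (powQ_pos s β), h1, mul_assoc]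
    have := hK s
    rw [hs] at this
    exact mul_le_mul (powQ_le_powQ hm (by linarith) hx hxt) this (abs_nonneg _) (powQ_pos x β).le
  refine ⟨K / κ, fun x => ?_⟩
  have hp := powQ_pos (m := m) x β
  rw [abs_neg, abs_div, abs_of_pos hp, div_le_iff₀ hp]
  rcases le_total 0 x with hx | hx
  · have := abs_le_of_hasDerivAt_of_tendsto (a := x) (K := powQ m β x * K) hκ hF hEf.continuous
      (fun t ht => hK' x t hx ht t (abs_of_nonneg (hx.trans ht))) hT x le_rfl
    rw [abs_of_nonneg hx]
    refine this.trans (le_of_eq ?_)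
    field_simp
  · have := abs_le_of_hasDerivAt_of_tendsto (f := fun x => F (-x))
      (g := fun x => -(powQ m β (-x) * f (-x))) (a := -x) (K := powQ m β (-x) * K) hκ
      (fun x => by simpa [Function.comp_def] using (hF (-x)).comp x (hasDerivAt_neg x))
      (hEf.continuous.comp continuous_neg).neg
      (fun t ht => by
        rw [abs_neg]
        exact hK' (-x) t (by linarith) ht (-t) (by rw [abs_neg, abs_of_nonneg (by linarith)]))
      (hB.comp tendsto_neg_atTop_atBot) (-x) le_rfl
    rw [neg_neg, powQ_neg] at this
    rw [abs_of_nonpos hx]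
    refine this.trans (le_of_eq ?_)
    field_simp

theorem abs_le_of_hasDerivAt_of_exp {H h : ℝ → ℝ} {M δ : ℝ} (hδ : 0 < δ) (hM : 0 ≤ M)
    (hd : ∀ x, HasDerivAt H (h x) x) (h0 : H 0 = 0) (hb : ∀ x ≥ 0, |h x| ≤ M * Real.exp (δ * x)) :
    ∀ x ≥ 0, |H x| ≤ M / δ * Real.exp (δ * x) := by
  intro x hx
  have hB : ∀ t, HasDerivAt (fun t => M / δ * Real.exp (δ * t)) (M * Real.exp (δ * t)) t := fun t => by
    have := (((hasDerivAt_id t).const_mul δ).exp).const_mul (M / δ)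
    refine this.congr_deriv ?_
    simp only [id]; field_simp
  exact image_norm_le_of_norm_deriv_right_le_deriv_boundary (a := 0) (b := x)
    (fun t _ => (hd t).continuousAt.continuousWithinAt) (fun t _ => (hd t).hasDerivWithinAt)
    (by simpa [h0] using by positivity) hB (fun t ht => hb t ht.1) ⟨hx, le_rfl⟩

/-- The localized solution of `g' - (Q' / Q) g = v` that vanishes at the origin. -/
theorem exists_loc_solution_logQ (hm : 2 ≤ m) {v : ℝ → ℝ} (hv : Loc v) :
    ∃ g, Loc g ∧ ∀ x, HasDerivAt g (logQ m x * g x + v x) x := by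
  have hQc := (loc_Q hm).continuous
  have hQ0 : ∀ x, Q m x ≠ 0 := fun x => (Q_pos x).ne'
  have hc : Continuous fun x => v x / Q m x := hv.continuous.div hQc hQ0
  set H : ℝ → ℝ := fun x => ∫ t in (0 : ℝ)..x, v t / Q m t with hH
  have hHd : ∀ x, HasDerivAt H (v x / Q m x) x := fun x =>
    intervalIntegral.integral_hasDerivAt_right (hc.intervalIntegrable _ _)
      (hc.stronglyMeasurableAtFilter _ _) hc.continuousAt
  have hd : ∀ x, HasDerivAt (fun x => Q m x * H x) (logQ m x * (Q m x * H x) + v x) x := fun x => by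
    refine ((hasDerivAt_Q x hm).mul (hHd x)).congr_deriv ?_
    have := hQ0 x
    field_simp
  refine ⟨fun x => Q m x * H x, ?_, hd⟩
  refine Loc.of_ode hd bddAll_logQ hv fun κ _ hκ => ?_
  obtain ⟨K, hK⟩ := hv.bound hκ
  obtain ⟨c, hc0, C, hC0, hQ⟩ := exists_powQ_bounds hm (zero_le_one' ℝ)
  have hK0 : 0 ≤ K := by simpa using (abs_nonneg _).trans (hK 0)
  have hb : ∀ t : ℝ, |v t / Q m t| ≤ K / c * Real.exp ((1 - κ) * |t|) := fun t => by
    have h1 := (hQ t).1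
    rw [powQ_one] at h1
    rw [abs_div, abs_of_pos (Q_pos t), div_le_iff₀ (Q_pos t)]
    calc |v t| ≤ K * Real.exp (-κ * |t|) := hK t
      _ = K / c * Real.exp ((1 - κ) * |t|) * (c * Real.exp (-1 * |t|)) := by
        rw [show -κ * |t| = (1 - κ) * |t| + -1 * |t| by ring, Real.exp_add]; field_simp
      _ ≤ _ := by gcongr
  have hδ : 0 < 1 - κ := by linarith
  have hHb : ∀ x, |H x| ≤ K / c / (1 - κ) * Real.exp ((1 - κ) * |x|) := by
    intro x
    rcases le_total 0 x with hx | hx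
    · rw [abs_of_nonneg hx]
      exact abs_le_of_hasDerivAt_of_exp hδ (by positivity) hHd (by simp [hH])
        (fun t ht => by simpa [abs_of_nonneg ht] using hb t) x hx
    · have := abs_le_of_hasDerivAt_of_exp (H := fun x => H (-x)) (h := fun x => -(v (-x) / Q m (-x)))
        (M := K / c) hδ (by positivity)
        (fun x => by simpa [Function.comp_def] using (hHd (-x)).comp x (hasDerivAt_neg x))
        (by simp [hH]) (fun t ht => by rw [abs_neg]; simpa [abs_of_nonneg ht] using hb (-t)) (-x)
        (by linarith)
      simpa [abs_of_nonpos hx] using this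
  refine ⟨C * (K / c / (1 - κ)), fun x => ?_⟩
  have h1 := (hQ x).2
  rw [powQ_one] at h1
  rw [abs_mul, abs_of_pos (Q_pos x)]
  calc _ ≤ C * Real.exp (-1 * |x|) * (K / c / (1 - κ) * Real.exp ((1 - κ) * |x|)) := by
        gcongr; exact hHb x
    _ = C * (K / c / (1 - κ)) * (Real.exp (-1 * |x|) * Real.exp ((1 - κ) * |x|)) := by ring
    _ = _ := by rw [← Real.exp_add]; ring_nf

/-- The linearized operator `L f = - f'' + f - m Q ^ (m - 1) f`. -/
noncomputable def linOp (m : ℕ) (f : ℝ → ℝ) (x : ℝ) : ℝ :=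
  -deriv (deriv f) x + f x - m * potQ m x * f x

theorem linOp_eq {f f' : ℝ → ℝ} {f'' x : ℝ} (h : ∀ x, HasDerivAt f (f' x) x)
    (h' : HasDerivAt f' f'' x) : linOp m f x = -f'' + f x - m * potQ m x * f x := by
  have : deriv f = f' := funext fun x => (h x).deriv
  rw [linOp, this, h'.deriv]

theorem three_halves_le_nExp (hm : 2 ≤ m) : 3 / 2 ≤ nExp m := by
  have : (2 : ℝ) ≤ m := by exact_mod_cast hm
  unfold nExp; linarith

theorem m_eq : (m : ℝ) = 2 * nExp m - 1 := by unfold nExp; ring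

/-- The derivative `Q'` of the ground state. -/
noncomputable def dQ (m : ℕ) (x : ℝ) : ℝ := logQ m x * Q m x

theorem deriv_Q (hm : 2 ≤ m) : deriv (Q m) = dQ m := funext fun x => (hasDerivAt_Q x hm).deriv

theorem loc_dQ (hm : 2 ≤ m) : Loc (dQ m) := (loc_Q hm).bdd_mul bddAll_logQ

theorem hasDerivAt_dQ (hm : 2 ≤ m) (x : ℝ) :
    HasDerivAt (dQ m) (Q m x - potQ m x * Q m x) x := by
  refine ((hasDerivAt_logQ x).mul (hasDerivAt_Q x hm)).congr_deriv ?_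
  have h := logQ_sq (m := m) x
  have h0 := (nExp_pos (m := m)).ne'
  field_simp at h ⊢
  linear_combination (Q m x) * h

/-- The ground state of `linOp`, by which the right-hand side is corrected so that the first of the
three first order equations below is solvable. -/
theorem linOp_powQ_nExp (hm : 2 ≤ m) (x : ℝ) :
    linOp m (powQ m (nExp m)) x = (1 - nExp m ^ 2) * powQ m (nExp m) x := by
  have h0 := (nExp_pos (m := m)).ne'
  rw [linOp_eq (fun x => hasDerivAt_powQ x hm (nExp m))
    (((hasDerivAt_logQ x).const_mul (nExp m)).mul (hasDerivAt_powQ x hm (nExp m)))]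
  have h := logQ_sq (m := m) x
  rw [m_eq (m := m)]
  field_simp at h ⊢
  linear_combination -(nExp m * powQ m (nExp m) x) * h

theorem linOp_dQ (hm : 2 ≤ m) (x : ℝ) : linOp m (dQ m) x = 0 := by
  rw [linOp_eq (hasDerivAt_dQ hm) ((hasDerivAt_Q x hm).sub ((hasDerivAt_potQ x).mul (hasDerivAt_Q x hm)))]
  unfold dQ; ring

theorem linOp_add {f g : ℝ → ℝ} (hf : ContDiff ℝ ∞ f) (hg : ContDiff ℝ ∞ g) (x : ℝ) :
    linOp m (fun x => f x + g x) x = linOp m f x + linOp m g x := by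
  have hf' : ContDiff ℝ ∞ (deriv f) := (contDiff_infty_iff_deriv.1 hf).2
  have hg' : ContDiff ℝ ∞ (deriv g) := (contDiff_infty_iff_deriv.1 hg).2
  have d : ∀ {h : ℝ → ℝ}, ContDiff ℝ ∞ h → ∀ x, HasDerivAt h (deriv h x) x := fun h x =>
    (h.differentiable (by simp) x).hasDerivAt
  rw [linOp_eq (fun x => (d hf x).fun_add (d hg x)) ((d hf' x).fun_add (d hg' x)), linOp, linOp]
  ring

theorem linOp_const_mul {f : ℝ → ℝ} (r : ℝ) (hf : ContDiff ℝ ∞ f) (x : ℝ) :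
    linOp m (fun x => r * f x) x = r * linOp m f x := by
  have hf' : ContDiff ℝ ∞ (deriv f) := (contDiff_infty_iff_deriv.1 hf).2
  have d : ∀ {h : ℝ → ℝ}, ContDiff ℝ ∞ h → ∀ x, HasDerivAt h (deriv h x) x := fun h x =>
    (h.differentiable (by simp) x).hasDerivAt
  rw [linOp_eq (fun x => (d hf x).const_mul r) ((d hf' x).const_mul r), linOp]
  ring

/-- Solvability of `L A = G` in localized functions for a localized right-hand side orthogonal to
`Q'`. With `D = ∂ - n Q' / Q` one has `L = D* D + e₀` and `L D* = D* E* E`, `E = ∂ - Q' / Q`, so that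
for a right-hand side orthogonal to the ground state the equation splits into three first order
equations without singular coefficients. -/
theorem exists_loc_linOp_eq (hm : 2 ≤ m) {G : ℝ → ℝ} (hG : Loc G) (h0 : ∫ x, dQ m x * G x = 0) :
    ∃ A, Loc A ∧ ∀ x, linOp m A x = G x := by
  set n := nExp m with hn
  have hn32 := three_halves_le_nExp hm
  rw [← hn] at hn32
  have hn0 : n ≠ 0 := by linarith
  set ψ := powQ m n with hψ
  have hψL : Loc ψ := loc_powQ hm (by linarith)
  have hψd : ∀ x, HasDerivAt ψ (n * logQ m x * ψ x) x := fun x => hasDerivAt_powQ x hm n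
  have hψψ : 0 < ∫ x, ψ x * ψ x := by
    refine (integral_pos_iff_support_of_nonneg (fun x => mul_self_nonneg _) (hψL.mul hψL).integrable).2 ?_
    have : Function.support (fun x => ψ x * ψ x) = univ := by
      ext x; simp [(powQ_pos (m := m) x n).ne', hψ]
    rw [this]; simp
  set σ := (∫ x, ψ x * G x) / ∫ x, ψ x * ψ x with hσ
  set G₁ : ℝ → ℝ := fun x => G x - σ * ψ x with hG₁
  have hG₁L : Loc G₁ := hG.sub (hψL.const_mul σ)
  have h1 : ∫ x, ψ x * G₁ x = 0 := by
    have : ∀ x, ψ x * G₁ x = ψ x * G x - σ * (ψ x * ψ x) := fun x => by simp only [hG₁]; ring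
    simp_rw [this]
    rw [integral_sub (hψL.mul hG).integrable ((hψL.mul hψL).const_mul σ).integrable,
      integral_const_mul, hσ, div_mul_cancel₀ _ hψψ.ne', sub_self]
  have h2 : ∫ x, dQ m x * G₁ x = 0 := by
    have : ∀ x, dQ m x * G₁ x = dQ m x * G x - σ * (dQ m x * ψ x) := fun x => by
      simp only [hG₁]; ring
    simp_rw [this]
    rw [integral_sub ((loc_dQ hm).mul hG).integrable (((loc_dQ hm).mul hψL).const_mul σ).integrable,
      integral_const_mul, h0]
    have h3 : ∫ x, dQ m x * ψ x = 0 := by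
      refine Loc.integral_eq_zero (f := fun x => (1 / (n + 1)) * (Q m x * ψ x))
        (((loc_Q hm).mul hψL).const_mul _) fun x => ?_
      refine (((hasDerivAt_Q x hm).mul (hψd x)).const_mul _).congr_deriv ?_
      unfold dQ
      have : n + 1 ≠ 0 := by linarith
      field_simp
      ring
    rw [h3]; ring
  obtain ⟨k, hkL, hk⟩ := exists_loc_solution_powQ hm (by linarith) hG₁L h1
  have hQk : ∫ x, powQ m 1 x * k x = 0 := by
    have hz := Loc.integral_eq_zero (f := fun x => dQ m x * k x)
      (g := fun x => -(n - 1) * (powQ m 1 x * k x) - dQ m x * G₁ x) ((loc_dQ hm).mul hkL) fun x => by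
        refine ((hasDerivAt_dQ hm x).mul (hk x)).congr_deriv ?_
        have h := logQ_sq (m := m) x
        rw [← hn] at h
        rw [powQ_one]
        unfold dQ
        field_simp at h ⊢
        linear_combination -(Q m x * k x) * h
    rw [integral_sub (((loc_powQ hm le_rfl).mul hkL).const_mul _).integrable
      ((loc_dQ hm).mul hG₁L).integrable, integral_const_mul, h2, sub_zero] at hz
    exact (mul_eq_zero.1 hz).resolve_left (by linarith)
  obtain ⟨v, hvL, hv⟩ := exists_loc_solution_powQ hm le_rfl hkL hQk
  obtain ⟨g, hgL, hg⟩ := exists_loc_solution_logQ hm hvL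
  set A₀ : ℝ → ℝ := fun x => -v x - (1 + n) * (logQ m x * g x) with hA₀
  have hA₀L : Loc A₀ := hvL.neg.sub ((hgL.bdd_mul bddAll_logQ).const_mul _)
  have hA₀1 : ∀ x, HasDerivAt A₀
      (k x - n * (logQ m x * v x) - (1 + n) * ((1 - potQ m x) * g x)) x := fun x => by
    refine ((hv x).neg.sub (((hasDerivAt_logQ x).mul (hg x)).const_mul (1 + n))).congr_deriv ?_
    have h := logQ_sq (m := m) x
    rw [← hn] at h ⊢
    field_simp at h ⊢
    linear_combination -((1 + n) * g x) * h
  have hA₀2 : ∀ x, linOp m A₀ x = G₁ x := fun x => by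
    rw [linOp_eq hA₀1 (((hk x).sub (((hasDerivAt_logQ x).mul (hv x)).const_mul n)).sub
      ((((hasDerivAt_potQ x).const_sub 1).mul (hg x)).const_mul (1 + n))), m_eq (m := m), ← hn]
    have h := logQ_sq (m := m) x
    rw [← hn] at h
    simp only [hA₀]
    field_simp at h ⊢
    linear_combination -(v x) * h
  have he : 1 - n ^ 2 ≠ 0 := by nlinarith
  refine ⟨fun x => A₀ x + σ / (1 - n ^ 2) * ψ x, hA₀L.add (hψL.const_mul _), fun x => ?_⟩
  rw [linOp_add hA₀L.contDiff (hψL.const_mul _).contDiff, linOp_const_mul _ hψL.contDiff, hA₀2,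
    linOp_powQ_nExp hm]
  simp only [hG₁, ← hn, hψ]
  field_simp
  ring

end

/-! ### Functions with a polynomial tail on the left -/

/-- The smooth step `(1 - tanh ((m - 1) x / 2)) / 2`, equal to `1` at `-∞` and to `0` at `+∞`. -/
noncomputable def step (m : ℕ) (x : ℝ) : ℝ := (1 + logQ m x) / 2

/-- Up to a localized function, `f` equals `α x + β` near `-∞` and `0` near `+∞`. -/
def Tail (m : ℕ) (α β : ℝ) (f : ℝ → ℝ) : Prop :=
  Loc fun x => f x - α * (x * step m x) - β * step m x

section
variable {m : ℕ}

theorem bddAll_step : BddAll (step m) :=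
  ((((BddAll.const 1).add (bddAll_logQ (m := m))).const_mul (1 / 2))).congr fun x => by
    unfold step; ring

theorem hasDerivAt_step (x : ℝ) :
    HasDerivAt (step m) (-((nExp m - 1) / nExp m) / 2 * potQ m x) x :=
  (((hasDerivAt_logQ x).const_add 1).div_const 2).congr_deriv (by ring)

theorem loc_step_mul_one_sub (hm : 2 ≤ m) : Loc fun x => step m x * (1 - step m x) :=
  ((loc_potQ hm).const_mul (1 / (4 * nExp m))).congr fun x => by
    have h := logQ_sq (m := m) x
    have h0 := (nExp_pos (m := m)).ne'
    unfold step
    field_simp at h ⊢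
    linear_combination 4 * h

theorem step_eq (x : ℝ) : step m x = 1 / (1 + Real.exp (((m : ℝ) - 1) * x)) := by
  unfold step logQ
  rw [show ((m : ℝ) - 1) * x = ((m : ℝ) - 1) / 2 * x + ((m : ℝ) - 1) / 2 * x by ring, Real.exp_add]
  generalize ((m : ℝ) - 1) / 2 * x = t
  have h1 := Real.exp_pos t
  have h2 := Real.cosh_pos t
  rw [← Real.cosh_add_sinh t] at h1 ⊢
  have h3 := Real.cosh_sq t
  have h4 : 1 + (Real.cosh t + Real.sinh t) * (Real.cosh t + Real.sinh t) ≠ 0 := by positivity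
  field_simp
  linear_combination (Real.cosh t + Real.sinh t) * h3

theorem tendsto_step_atTop (hm : 2 ≤ m) : Tendsto (step m) atTop (𝓝 0) := by
  have hm' : 0 < (m : ℝ) - 1 := by
    have : (2 : ℝ) ≤ m := by exact_mod_cast hm
    linarith
  have : Tendsto (fun x => 1 + Real.exp (((m : ℝ) - 1) * x)) atTop atTop :=
    tendsto_atTop_add_const_left _ _ (Real.tendsto_exp_atTop.comp (tendsto_id.const_mul_atTop hm'))
  exact (this.inv_tendsto_atTop).congr fun x => by simp [step_eq]

theorem tendsto_step_atBot (hm : 2 ≤ m) : Tendsto (step m) atBot (𝓝 1) := by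
  have hm' : 0 < (m : ℝ) - 1 := by
    have : (2 : ℝ) ≤ m := by exact_mod_cast hm
    linarith
  have h : Tendsto (fun x => 1 + Real.exp (((m : ℝ) - 1) * x)) atBot (𝓝 (1 + 0)) :=
    (Real.tendsto_exp_atBot.comp (tendsto_id.const_mul_atBot hm')).const_add 1
  have h2 := h.inv₀ (by norm_num)
  simp only [add_zero, inv_one] at h2
  exact h2.congr fun x => by simp [step_eq]

theorem tendsto_id_mul_step_atTop (hm : 2 ≤ m) : Tendsto (fun x => x * step m x) atTop (𝓝 0) := by
  have h1 := (loc_step_mul_one_sub hm).id_mul.tendsto_atTop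
  have h2 := (tendsto_step_atTop hm).const_sub 1
  have h3 := h1.div h2 (by norm_num)
  simp only [sub_zero, zero_div] at h3
  refine h3.congr fun x => ?_
  have : 1 - step m x ≠ 0 := by
    rw [step_eq]
    have := Real.exp_pos (((m : ℝ) - 1) * x)
    have h4 : 1 + Real.exp (((m : ℝ) - 1) * x) ≠ 0 := by positivity
    field_simp
    simpa using h4
  simp only [Pi.div_apply]
  field_simp

variable {α β α' β' : ℝ} {f g h : ℝ → ℝ}

theorem Tail.congr (hf : Tail m α β f) (hfg : ∀ x, f x = g x) : Tail m α β g := funext hfg ▸ hf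

theorem Tail.cast (hf : Tail m α β f) (h1 : α = α') (h2 : β = β') : Tail m α' β' f := h1 ▸ h2 ▸ hf

theorem Tail.loc (hf : Tail m 0 0 f) : Loc f := Loc.congr hf fun x => by ring

theorem Loc.tail (hf : Loc f) : Tail m 0 0 f := Loc.congr hf fun x => by ring

theorem Tail.decomp (hf : Tail m α β f) :
    ∃ g, Loc g ∧ ∀ x, f x = g x + α * (x * step m x) + β * step m x := ⟨_, hf, fun x => by ring⟩

theorem Tail.contDiff (hf : Tail m α β f) : ContDiff ℝ ∞ f := by
  obtain ⟨g, hg, h⟩ := hf.decomp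
  rw [show f = _ from funext h]
  have := (bddAll_step (m := m)).contDiff
  exact (hg.contDiff.add (contDiff_const.mul (contDiff_id.mul this))).add (contDiff_const.mul this)

theorem Tail.hasDerivAt (hf : Tail m α β f) (x : ℝ) : HasDerivAt f (deriv f x) x :=
  (hf.contDiff.differentiable (by simp) x).hasDerivAt

theorem Loc.hasDerivAt (hf : Loc f) (x : ℝ) : HasDerivAt f (_root_.deriv f x) x :=
  (hf.differentiable x).hasDerivAt

theorem Tail.add (hf : Tail m α β f) (hg : Tail m α' β' g) :
    Tail m (α + α') (β + β') fun x => f x + g x :=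
  (Loc.add hf hg).congr fun x => by ring

theorem Tail.sub (hf : Tail m α β f) (hg : Tail m α' β' g) :
    Tail m (α - α') (β - β') fun x => f x - g x :=
  (Loc.sub hf hg).congr fun x => by ring

theorem Tail.const_mul (r : ℝ) (hf : Tail m α β f) : Tail m (r * α) (r * β) fun x => r * f x :=
  (Loc.const_mul r hf).congr fun x => by ring

theorem Tail.add_loc (hf : Tail m α β f) (hg : Loc g) : Tail m α β fun x => f x + g x :=
  (hf.add hg.tail).cast (by ring) (by ring)

theorem Tail.sub_loc (hf : Tail m α β f) (hg : Loc g) : Tail m α β fun x => f x - g x :=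
  (hf.sub hg.tail).cast (by ring) (by ring)

theorem Loc.mul_tail (hf : Loc f) (hg : Tail m α β g) : Loc fun x => f x * g x := by
  have hs := bddAll_step (m := m)
  refine (((Loc.mul hf hg).add ((hf.id_mul.bdd_mul hs).const_mul α)).add
    ((hf.bdd_mul hs).const_mul β)).congr fun x => ?_
  ring

theorem loc_deriv_step (hm : 2 ≤ m) : Loc (_root_.deriv (step m)) :=
  ((loc_potQ hm).const_mul _).congr fun x => (hasDerivAt_step x).deriv.symm

theorem tail_id_mul_step : Tail m 1 0 fun x => x * step m x :=
  Loc.zero.congr fun x => by ring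

theorem tail_step : Tail m 0 1 (step m) := Loc.zero.congr fun x => by ring

theorem Tail.deriv (hm : 2 ≤ m) (hf : Tail m α β f) : Tail m 0 α (deriv f) := by
  obtain ⟨g, hg, h⟩ := hf.decomp
  have hs := loc_deriv_step hm
  have hs' : ∀ x, HasDerivAt (step m) (_root_.deriv (step m) x) x := fun x =>
    (hasDerivAt_step x).differentiableAt.hasDerivAt
  refine ((hg.deriv.add (hs.id_mul.const_mul α)).add (hs.const_mul β)).congr fun x => ?_
  rw [show f = _ from funext h, (((hg.hasDerivAt x).fun_add
    (((hasDerivAt_id' x).fun_mul (hs' x)).const_mul α)).fun_add ((hs' x).const_mul β)).deriv]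
  ring

/-- The square of the step is the step, up to a localized function. -/
theorem Tail.mul (hm : 2 ≤ m) (hf : Tail m 0 β f) (hg : Tail m 0 β' g) :
    Tail m 0 (β * β') fun x => f x * g x := by
  obtain ⟨u, hu, h⟩ := hf.decomp
  refine (((hu.mul_tail hg).add ((Loc.bdd_mul (bddAll_step (m := m)) hg).const_mul β)).sub
    ((loc_step_mul_one_sub hm).const_mul (β * β'))).congr fun x => ?_
  linear_combination -(g x) * h x

theorem Tail.id_mul_deriv (hm : 2 ≤ m) (hf : Tail m α β f) :
    Tail m α 0 fun x => x * _root_.deriv f x := by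
  obtain ⟨g, hg, h⟩ := (hf.deriv hm).decomp
  refine hg.id_mul.congr fun x => ?_
  change x * g x = x * _root_.deriv f x - α * (x * step m x) - 0 * step m x
  rw [h]; ring

theorem Tail.tendsto_atTop (hm : 2 ≤ m) (hf : Tail m α β f) : Tendsto f atTop (𝓝 0) := by
  obtain ⟨g, hg, h⟩ := hf.decomp
  rw [show f = _ from funext h]
  simpa using (hg.tendsto_atTop.add ((tendsto_id_mul_step_atTop hm).const_mul α)).add
    ((tendsto_step_atTop hm).const_mul β)

theorem Tail.tendsto_atBot (hm : 2 ≤ m) (hf : Tail m 0 β f) : Tendsto f atBot (𝓝 β) := by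
  obtain ⟨g, hg, h⟩ := hf.decomp
  rw [show f = _ from funext h]
  simpa using hg.tendsto_atBot.add ((tendsto_step_atBot hm).const_mul β)

theorem Tail.integral_deriv (hm : 2 ≤ m) (hf : Tail m 0 β f) {f' : ℝ → ℝ}
    (hd : ∀ x, HasDerivAt f (f' x) x) : ∫ x, f' x = -β := by
  have : _root_.deriv f = f' := funext fun x => (hd x).deriv
  have hl : Loc f' := this ▸ (hf.deriv hm).loc
  simpa using integral_of_hasDerivAt_of_tendsto hd hl.integrable (hf.tendsto_atBot hm)
    (hf.tendsto_atTop hm)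

theorem Tail.of_primitive (hm : 2 ≤ m) (hh : Tail m 0 α h) (hd : ∀ x, HasDerivAt f (h x) x)
    (ht : Tendsto f atTop (𝓝 0)) : ∃ b, Tail m α b f := by
  set f₁ : ℝ → ℝ := fun x => f x - α * (x * step m x) with hf₁
  set h₁ : ℝ → ℝ := fun x => h x - α * _root_.deriv (fun x => x * step m x) x with hh₁
  have hd₁ : ∀ x, HasDerivAt f₁ (h₁ x) x := fun x =>
    (hd x).fun_sub ((tail_id_mul_step.hasDerivAt x).const_mul α)
  have hl : Loc h₁ :=
    ((hh.sub ((tail_id_mul_step.deriv hm).const_mul α)).cast (by ring) (by ring)).loc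
  have ht₁ : Tendsto f₁ atTop (𝓝 0) := by
    simpa using ht.sub ((tendsto_id_mul_step_atTop hm).const_mul α)
  obtain ⟨F, hF, hFt, hFb⟩ := exists_primitive hl.continuous hl.integrable
  -- both primitives of `h₁` vanish at `+∞`
  have hFf : ∀ x, F x = f₁ x := by
    have hc : ∀ x y, F x - f₁ x = F y - f₁ y := is_const_of_deriv_eq_zero
      (fun x => ((hF x).fun_sub (hd₁ x)).differentiableAt)
      (fun x => by rw [((hF x).fun_sub (hd₁ x)).deriv, sub_self])
    intro x
    have h1 : Tendsto (fun y => F y - f₁ y) atTop (𝓝 (F x - f₁ x)) :=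
      tendsto_const_nhds.congr fun y => hc x y
    have h2 := tendsto_nhds_unique h1 (hFt.sub ht₁)
    linarith
  rw [show F = f₁ from funext hFf] at hFb
  set b := -∫ x, h₁ x with hb
  refine ⟨b, ?_⟩
  have hs := tendsto_step_atBot hm
  refine Loc.of_primitive (hl.sub ((loc_deriv_step hm).const_mul b))
    (fun x => (hd₁ x).fun_sub (((hasDerivAt_step x).differentiableAt.hasDerivAt).const_mul b)) ?_ ?_
  · simpa using ht₁.sub ((tendsto_step_atTop hm).const_mul b)
  · simpa using hFb.sub (hs.const_mul b)

theorem Tail.linOp (hm : 2 ≤ m) (hf : Tail m α β f) : Tail m α β (linOp m f) := by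
  have h2 := ((hf.deriv hm).deriv hm).loc
  have h3 := ((loc_potQ hm).mul_tail hf).const_mul m
  refine ((hf.sub_loc h2).sub_loc h3).congr fun x => ?_
  unfold GKdV.linOp
  ring

/-! ### Solving `(L B)' = h` -/

/-- `linOp` is symmetric: the boundary terms at `-∞` vanish as soon as one factor is localized. -/
theorem integral_mul_linOp (hm : 2 ≤ m) {u : ℝ → ℝ} (hu : Loc u) (hf : Tail m α β f) :
    ∫ x, u x * linOp m f x = ∫ x, linOp m u x * f x := by
  have h1 : Loc fun x => u x * linOp m f x := hu.mul_tail (hf.linOp hm)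
  have h2 : Loc fun x => linOp m u x * f x := ((hu.tail (m := m)).linOp hm).loc.mul_tail hf
  rw [← sub_eq_zero, ← integral_sub h1.integrable h2.integrable]
  refine Loc.integral_eq_zero (f := fun x => deriv u x * f x - u x * deriv f x)
    ((hu.deriv.mul_tail hf).sub (hu.mul_tail (hf.deriv hm))) fun x => ?_
  refine (((hu.deriv.hasDerivAt x).mul (hf.hasDerivAt x)).sub
    ((hu.hasDerivAt x).mul ((hf.deriv hm).hasDerivAt x))).congr_deriv ?_
  unfold linOp
  ring

theorem integral_Q_mul_deriv_linOp (hm : 2 ≤ m) (hf : Tail m α β f) :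
    ∫ x, Q m x * deriv (linOp m f) x = 0 := by
  have hL := hf.linOp hm
  have h1 : ∫ x, (dQ m x * linOp m f x + Q m x * deriv (linOp m f) x) = 0 :=
    Loc.integral_eq_zero ((loc_Q hm).mul_tail hL) fun x => (hasDerivAt_Q x hm).mul (hL.hasDerivAt x)
  rw [integral_add ((loc_dQ hm).mul_tail hL).integrable
    ((loc_Q hm).mul_tail (hL.deriv hm)).integrable, integral_mul_linOp hm (loc_dQ hm) hf] at h1
  simpa [linOp_dQ hm] using h1

theorem exists_tail_deriv_linOp_eq (hm : 2 ≤ m) (hh : Tail m 0 α h) (h0 : ∫ x, Q m x * h x = 0) :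
    ∃ A b, Tail m α b A ∧ ∀ x, deriv (linOp m A) x = h x := by
  set Y : ℝ → ℝ := fun x => x * step m x with hY
  have hYt : Tail m 1 0 Y := tail_id_mul_step
  have hLY := hYt.linOp hm
  set h₁ : ℝ → ℝ := fun x => h x - α * deriv (linOp m Y) x with hh₁
  have hl : Loc h₁ := ((hh.sub ((hLY.deriv hm).const_mul α)).cast (by ring) (by ring)).loc
  have h1 : ∫ x, Q m x * h₁ x = 0 := by
    have : ∀ x, Q m x * h₁ x = Q m x * h x - α * (Q m x * deriv (linOp m Y) x) := fun x => by
      simp only [hh₁]; ring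
    simp_rw [this]
    rw [integral_sub ((loc_Q hm).mul_tail hh).integrable
      (((loc_Q hm).mul_tail (hLY.deriv hm)).const_mul α).integrable, integral_const_mul, h0,
      integral_Q_mul_deriv_linOp hm hYt]
    ring
  obtain ⟨G, hG, hGt, -⟩ := exists_primitive hl.continuous hl.integrable
  obtain ⟨b, hGb⟩ := Tail.of_primitive hm hl.tail hG hGt
  have hLs := (tail_step (m := m)).linOp hm
  have hG₁ : Loc fun x => G x - b * linOp m (step m) x :=
    ((hGb.sub (hLs.const_mul b)).cast (by ring) (by ring)).loc
  have h2 : ∫ x, dQ m x * (G x - b * linOp m (step m) x) = 0 := by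
    have h3 : ∫ x, (dQ m x * G x + Q m x * h₁ x) = 0 :=
      Loc.integral_eq_zero ((loc_Q hm).mul_tail hGb) fun x => (hasDerivAt_Q x hm).mul (hG x)
    rw [integral_add ((loc_dQ hm).mul_tail hGb).integrable ((loc_Q hm).mul hl).integrable, h1,
      add_zero] at h3
    have h4 := integral_mul_linOp hm (loc_dQ hm) (tail_step (m := m))
    simp only [linOp_dQ hm, zero_mul, integral_zero] at h4
    have : ∀ x, dQ m x * (G x - b * linOp m (step m) x)
        = dQ m x * G x - b * (dQ m x * linOp m (step m) x) := fun x => by ring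
    simp_rw [this]
    rw [integral_sub ((loc_dQ hm).mul_tail hGb).integrable
      (((loc_dQ hm).mul_tail hLs).const_mul b).integrable, integral_const_mul, h3, h4]
    ring
  obtain ⟨A₁, hA₁, hLA₁⟩ := exists_loc_linOp_eq hm hG₁ h2
  have hαY := hYt.const_mul α
  have hbs := (tail_step (m := m)).const_mul b
  have hsum := (hαY.add hbs).add_loc hA₁
  refine ⟨_, b, hsum.cast (by ring) (by ring), fun x => ?_⟩
  have : linOp m (fun x => α * Y x + b * step m x + A₁ x)
      = fun x => α * linOp m Y x + G x := funext fun x => by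
    rw [linOp_add (hαY.add hbs).contDiff hA₁.contDiff, linOp_add hαY.contDiff hbs.contDiff,
      linOp_const_mul _ hYt.contDiff, linOp_const_mul _ tail_step.contDiff, hLA₁]
    ring
  rw [this, (((hLY.hasDerivAt x).const_mul α).fun_add (hG x)).deriv]
  simp only [hh₁]
  ring

/-- The scaling generator `∂_c Q_c` at `c = 1`. -/
noncomputable def scaleQ (m : ℕ) (x : ℝ) : ℝ := 1 / ((m : ℝ) - 1) * Q m x + x / 2 * dQ m x

theorem loc_scaleQ (hm : 2 ≤ m) : Loc (scaleQ m) :=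
  (((loc_Q hm).const_mul (1 / ((m : ℝ) - 1))).add ((loc_dQ hm).id_mul.const_mul (1 / 2))).congr fun x => by
    unfold scaleQ; ring

theorem linOp_scaleQ (hm : 2 ≤ m) (x : ℝ) : linOp m (scaleQ m) x = -Q m x := by
  have hm' : (m : ℝ) - 1 ≠ 0 := by
    have : (2 : ℝ) ≤ m := by exact_mod_cast hm
    linarith
  have h1 : ∀ x, HasDerivAt (scaleQ m) (1 / ((m : ℝ) - 1) * dQ m x +
      (1 / 2 * dQ m x + x / 2 * (Q m x - potQ m x * Q m x))) x := fun x =>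
    ((hasDerivAt_Q x hm).const_mul _).add (((hasDerivAt_id x).div_const 2).mul (hasDerivAt_dQ hm x))
  rw [linOp_eq h1 (((hasDerivAt_dQ hm x).const_mul _).add (((hasDerivAt_dQ hm x).const_mul (1 / 2)).add
    (((hasDerivAt_id x).div_const 2).mul ((hasDerivAt_Q x hm).sub
      ((hasDerivAt_potQ x).mul (hasDerivAt_Q x hm))))))]
  unfold scaleQ dQ
  simp only [id]
  field_simp
  ring

theorem integral_Q_sq_pos (hm : 2 ≤ m) : 0 < ∫ x, Q m x ^ 2 := by
  have hL : Loc fun x => Q m x ^ 2 := ((loc_Q hm).mul (loc_Q hm)).congr fun x => by ring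
  refine (integral_pos_iff_support_of_nonneg (fun x => sq_nonneg _) hL.integrable).2 ?_
  have : Function.support (fun x => Q m x ^ 2) = univ := by
    ext x; simp [(Q_pos (m := m) x).ne']
  rw [this]; simp

theorem integral_Q_pos (hm : 2 ≤ m) : 0 < ∫ x, Q m x := by
  refine (integral_pos_iff_support_of_nonneg (fun x => (Q_pos x).le) (loc_Q hm).integrable).2 ?_
  have : Function.support (fun x => Q m x) = univ := by
    ext x; simp [(Q_pos (m := m) x).ne']
  rw [this]; simp

theorem integral_id_mul_Q_mul_dQ (hm : 2 ≤ m) :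
    ∫ x, x * Q m x * dQ m x = -(1 / 2) * ∫ x, Q m x ^ 2 := by
  have hQQ := (loc_Q hm).mul (loc_Q hm)
  have hL : Loc fun x => Q m x ^ 2 := hQQ.congr fun x => by ring
  have hX : Loc fun x => x * Q m x * dQ m x := ((loc_Q hm).id_mul.mul (loc_dQ hm))
  have h := Loc.integral_eq_zero (f := fun x => 1 / 2 * (x * (Q m x * Q m x)))
    (g := fun x => 1 / 2 * Q m x ^ 2 + x * Q m x * dQ m x) (hQQ.id_mul.const_mul _) fun x => by
      refine (((hasDerivAt_id x).mul ((hasDerivAt_Q x hm).mul (hasDerivAt_Q x hm))).const_mul _).congr_deriv ?_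
      unfold dQ; simp only [id, Pi.mul_apply]; ring
  rw [integral_add (hL.const_mul _).integrable hX.integrable, integral_const_mul] at h
  linarith

theorem integral_Q_mul_scaleQ (hm : 2 ≤ m) :
    ∫ x, Q m x * scaleQ m x = (1 / ((m : ℝ) - 1) - 1 / 4) * ∫ x, Q m x ^ 2 := by
  have hL : Loc fun x => Q m x ^ 2 := ((loc_Q hm).mul (loc_Q hm)).congr fun x => by ring
  have hX : Loc fun x => x * Q m x * dQ m x := ((loc_Q hm).id_mul.mul (loc_dQ hm))
  have : ∀ x, Q m x * scaleQ m x = 1 / ((m : ℝ) - 1) * Q m x ^ 2 + 1 / 2 * (x * Q m x * dQ m x) :=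
    fun x => by unfold scaleQ; ring
  simp_rw [this]
  rw [integral_add (hL.const_mul _).integrable (hX.const_mul _).integrable, integral_const_mul,
    integral_const_mul, integral_id_mul_Q_mul_dQ hm]
  ring

/-- The corrector equation: `(L B)' = h - f Q'` has a solution orthogonal to `Q` and to `x Q`, for
a suitable constant `f`, whenever `h` is orthogonal to `Q`. -/
theorem exists_corrector (hm : 2 ≤ m) (hm5 : m < 5) (hh : Tail m 0 α h)
    (h0 : ∫ x, Q m x * h x = 0) :
    ∃ B b f, Tail m α b B ∧ (∀ x, HasDerivAt (linOp m B) (h x - f * dQ m x) x) ∧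
      ∫ x, Q m x * B x = 0 ∧ ∫ x, x * Q m x * B x = 0 := by
  obtain ⟨A, b, hA, hLA⟩ := exists_tail_deriv_linOp_eq hm hh h0
  have hm2 : (2 : ℝ) ≤ m := by exact_mod_cast hm
  have hm5' : (m : ℝ) < 5 := by exact_mod_cast hm5
  have hI := integral_Q_sq_pos hm
  have hQS : ∫ x, Q m x * scaleQ m x ≠ 0 := by
    rw [integral_Q_mul_scaleQ hm]
    have : 0 < 1 / ((m : ℝ) - 1) - 1 / 4 := by
      rw [sub_pos]; exact one_div_lt_one_div_of_lt (by linarith) (by linarith)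
    positivity
  have hQdQ : ∫ x, Q m x * dQ m x = 0 :=
    Loc.integral_eq_zero (f := fun x => 1 / 2 * (Q m x * Q m x))
      (((loc_Q hm).mul (loc_Q hm)).const_mul _) fun x =>
      (((hasDerivAt_Q x hm).mul (hasDerivAt_Q x hm)).const_mul (1 / 2)).congr_deriv (by unfold dQ; ring)
  have hxQdQ : ∫ x, x * Q m x * dQ m x ≠ 0 := by
    rw [integral_id_mul_Q_mul_dQ hm]
    have := hI.ne'
    simpa using this
  set f := -(∫ x, Q m x * A x) / ∫ x, Q m x * scaleQ m x with hf
  set A' : ℝ → ℝ := fun x => A x + f * scaleQ m x with hA'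
  have hA't : Tail m α b A' := hA.add_loc ((loc_scaleQ hm).const_mul f)
  have hxQ : Loc fun x => x * Q m x := (loc_Q hm).id_mul
  set a := -(∫ x, x * Q m x * A' x) / ∫ x, x * Q m x * dQ m x with ha
  refine ⟨fun x => A' x + a * dQ m x, b, f, hA't.add_loc ((loc_dQ hm).const_mul a), fun x => ?_, ?_, ?_⟩
  · have : linOp m (fun x => A' x + a * dQ m x) = fun x => linOp m A x - f * Q m x := funext fun x => by
      rw [linOp_add hA't.contDiff ((loc_dQ hm).const_mul a).contDiff,
        linOp_const_mul _ (loc_dQ hm).contDiff, linOp_dQ hm, hA',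
        linOp_add hA.contDiff ((loc_scaleQ hm).const_mul f).contDiff,
        linOp_const_mul _ (loc_scaleQ hm).contDiff, linOp_scaleQ hm]
      ring
    rw [this, ← hLA x]
    exact ((hA.linOp hm).hasDerivAt x).fun_sub ((hasDerivAt_Q x hm).const_mul f)
  · have : ∀ x, Q m x * (A' x + a * dQ m x)
        = Q m x * A x + f * (Q m x * scaleQ m x) + a * (Q m x * dQ m x) := fun x => by
      simp only [hA']; ring
    simp_rw [this]
    have i1 := (loc_Q hm).mul_tail hA
    have i2 := ((loc_Q hm).mul (loc_scaleQ hm)).const_mul f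
    rw [integral_add (i1.add i2).integrable (((loc_Q hm).mul (loc_dQ hm)).const_mul a).integrable,
      integral_add i1.integrable i2.integrable, integral_const_mul, integral_const_mul, hQdQ, hf,
      div_mul_cancel₀ _ hQS]
    ring
  · have : ∀ x, x * Q m x * (A' x + a * dQ m x)
        = x * Q m x * A' x + a * (x * Q m x * dQ m x) := fun x => by ring
    simp_rw [this]
    rw [integral_add (hxQ.mul_tail hA't).integrable ((hxQ.mul (loc_dQ hm)).const_mul a).integrable,
      integral_const_mul, ha, div_mul_cancel₀ _ hxQdQ]
    ring

end

/-! ### The first corrector -/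

section
variable {m : ℕ}

/-- The derivative of `x Q ^ m`. -/
noncomputable def dIdMulQPow (m : ℕ) (x : ℝ) : ℝ := potQ m x * Q m x + x * (m * potQ m x * dQ m x)

theorem loc_potQ_mul_Q (hm : 2 ≤ m) : Loc fun x => potQ m x * Q m x := (loc_potQ hm).mul (loc_Q hm)

theorem hasDerivAt_potQ_mul_Q (hm : 2 ≤ m) (x : ℝ) :
    HasDerivAt (fun x => potQ m x * Q m x) (m * potQ m x * dQ m x) x := by
  refine ((hasDerivAt_potQ x).mul (hasDerivAt_Q x hm)).congr_deriv ?_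
  unfold dQ; ring

theorem hasDerivAt_id_mul_Q_pow (hm : 2 ≤ m) (x : ℝ) :
    HasDerivAt (fun x => x * (potQ m x * Q m x)) (dIdMulQPow m x) x :=
  ((hasDerivAt_id x).mul (hasDerivAt_potQ_mul_Q hm x)).congr_deriv (by
    unfold dIdMulQPow; simp only [id]; ring)

theorem loc_dIdMulQPow (hm : 2 ≤ m) : Loc (dIdMulQPow m) :=
  (loc_potQ_mul_Q hm).id_mul.of_hasDerivAt (hasDerivAt_id_mul_Q_pow hm)

theorem dQ_neg (x : ℝ) : dQ m (-x) = -dQ m x := by simp [dQ, logQ_neg, Q_neg]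

theorem scaleQ_neg (x : ℝ) : scaleQ m (-x) = scaleQ m x := by
  simp [scaleQ, dQ_neg, Q_neg, neg_div]

theorem dIdMulQPow_neg (x : ℝ) : dIdMulQPow m (-x) = dIdMulQPow m x := by
  simp [dIdMulQPow, dQ_neg, Q_neg, potQ_neg]

/-- A primitive of an even function is, up to a constant, odd; tested against an even function only
its mean value is seen. -/
theorem integral_even_mul_primitive (hm : 2 ≤ m) {b : ℝ} {u G h : ℝ → ℝ} (hu : Loc u)
    (hue : ∀ x, u (-x) = u x) (hG : Tail m 0 b G) (hd : ∀ x, HasDerivAt G (h x) x)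
    (he : ∀ x, h (-x) = h x) : ∫ x, u x * G x = b / 2 * ∫ x, u x := by
  have hd' : ∀ x, HasDerivAt (fun x => G x + G (-x)) 0 x := fun x => by
    have h1 : HasDerivAt (fun x => G (-x)) (h (-x) * -1) x := (hd (-x)).comp x (hasDerivAt_neg x)
    exact ((hd x).fun_add h1).congr_deriv (by rw [he]; ring)
  have hc : ∀ x, G x + G (-x) = b := by
    intro x
    have hc : ∀ y, G y + G (-y) = G x + G (-x) := fun y => is_const_of_deriv_eq_zero
      (fun x => (hd' x).differentiableAt) (fun x => (hd' x).deriv) y x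
    have h1 : Tendsto (fun y => G y + G (-y)) atTop (𝓝 (G x + G (-x))) :=
      tendsto_const_nhds.congr fun y => (hc y).symm
    have h2 := (hG.tendsto_atTop hm).add ((hG.tendsto_atBot hm).comp tendsto_neg_atTop_atBot)
    rw [zero_add] at h2
    exact tendsto_nhds_unique h1 h2
  have i1 := (hu.mul_tail hG).integrable
  have h1 : ∫ x, u x * G (-x) = ∫ x, u x * G x := by
    rw [← integral_neg_eq_self]
    simp [hue]
  have i2 : Integrable fun x => u x * G (-x) := by
    have := i1.comp_neg
    simpa [hue] using this
  have h2 : ∫ x, (u x * G x + u x * G (-x)) = b * ∫ x, u x := by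
    rw [← integral_const_mul]
    congr 1; ext x
    rw [← mul_add, hc]; ring
  rw [integral_add i1 i2, h1] at h2
  linarith

theorem integral_dQ (hm : 2 ≤ m) : ∫ x, dQ m x = 0 :=
  (loc_Q hm).integral_eq_zero fun x => hasDerivAt_Q x hm

theorem integral_scaleQ (hm : 2 ≤ m) :
    ∫ x, scaleQ m x = (1 / ((m : ℝ) - 1) - 1 / 2) * ∫ x, Q m x := by
  have h := Loc.integral_eq_zero (f := fun x => 1 / 2 * (x * Q m x))
    (g := fun x => scaleQ m x - (1 / ((m : ℝ) - 1) - 1 / 2) * Q m x) ((loc_Q hm).id_mul.const_mul _)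
    fun x => (((hasDerivAt_id x).fun_mul (hasDerivAt_Q x hm)).const_mul _).congr_deriv (by
      unfold scaleQ dQ; simp only [id]; ring)
  rw [integral_sub (loc_scaleQ hm).integrable ((loc_Q hm).const_mul _).integrable,
    integral_const_mul] at h
  linarith

/-- The limit at `-∞` of a solution of `(L A)' = h - f Q'`, and, for even `h`, the value of `f`
forced by orthogonality to `Q`. -/
theorem corrector_coefficients (hm : 2 ≤ m) {A h : ℝ → ℝ} {b f : ℝ} (hh : Loc h)
    (he : ∀ x, h (-x) = h x) (hA : Tail m 0 b A)
    (hd : ∀ x, HasDerivAt (linOp m A) (h x - f * dQ m x) x) (h0 : ∫ x, Q m x * A x = 0) :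
    b = -∫ x, h x ∧
      f * ((1 / ((m : ℝ) - 1) - 1 / 4) * ∫ x, Q m x ^ 2) =
        -(1 / 2) * (∫ x, h x) * ((1 / ((m : ℝ) - 1) - 1 / 2) * ∫ x, Q m x) := by
  have hL := hA.linOp hm
  have hb : b = -∫ x, h x := by
    have := hL.integral_deriv hm hd
    rw [integral_sub hh.integrable ((loc_dQ hm).const_mul f).integrable, integral_const_mul,
      integral_dQ hm] at this
    linarith
  refine ⟨hb, ?_⟩
  have h1 := integral_even_mul_primitive hm (loc_scaleQ hm) scaleQ_neg
    (hL.add_loc ((loc_Q hm).const_mul f))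
    (fun x => ((hd x).fun_add ((hasDerivAt_Q x hm).const_mul f)).congr_deriv (by
      unfold dQ; ring : _ = h x)) he
  have h2 := integral_mul_linOp hm (loc_scaleQ hm) hA
  simp only [linOp_scaleQ hm, neg_mul] at h2
  rw [integral_neg, h0] at h2
  have : ∀ x, scaleQ m x * (linOp m A x + f * Q m x)
      = scaleQ m x * linOp m A x + f * (Q m x * scaleQ m x) := fun x => by ring
  simp_rw [this] at h1
  rw [integral_add ((loc_scaleQ hm).mul_tail hL).integrable
    (((loc_Q hm).mul (loc_scaleQ hm)).const_mul f).integrable, integral_const_mul, h2,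
    integral_Q_mul_scaleQ hm, integral_scaleQ hm, hb] at h1
  linarith

/-- The part without `λ` of the right-hand side of the equation of the first corrector at `c = 1`. -/
noncomputable def srcX (m : ℕ) (x : ℝ) : ℝ :=
  pExp m * scaleQ m x - 1 / ((m : ℝ) - 1) * Q m x + dIdMulQPow m x

/-- The coefficient of `λ` in the right-hand side of the equation of the first corrector at `c = 1`. -/
noncomputable def srcY (m : ℕ) (x : ℝ) : ℝ :=
  -(pExp m / lambda0 m) * scaleQ m x + 1 / ((m : ℝ) - 1) * Q m x

theorem loc_srcX (hm : 2 ≤ m) : Loc (srcX m) :=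
  (((loc_scaleQ hm).const_mul _).sub ((loc_Q hm).const_mul _)).add (loc_dIdMulQPow hm)

theorem loc_srcY (hm : 2 ≤ m) : Loc (srcY m) :=
  ((loc_scaleQ hm).const_mul _).add ((loc_Q hm).const_mul _)

theorem integral_srcX (hm : 2 ≤ m) : ∫ x, srcX m x =
    (pExp m * (1 / ((m : ℝ) - 1) - 1 / 2) - 1 / ((m : ℝ) - 1)) * ∫ x, Q m x := by
  unfold srcX
  have i1 := (loc_scaleQ hm).const_mul (pExp m)
  have i2 := (loc_Q hm).const_mul (1 / ((m : ℝ) - 1))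
  rw [integral_add (i1.sub i2).integrable (loc_dIdMulQPow hm).integrable,
    integral_sub i1.integrable i2.integrable, integral_const_mul, integral_const_mul,
    integral_scaleQ hm, (loc_potQ_mul_Q hm).id_mul.integral_eq_zero (hasDerivAt_id_mul_Q_pow hm)]
  ring

theorem integral_srcY (hm : 2 ≤ m) : ∫ x, srcY m x =
    (-(pExp m / lambda0 m) * (1 / ((m : ℝ) - 1) - 1 / 2) + 1 / ((m : ℝ) - 1)) * ∫ x, Q m x := by
  unfold srcY
  rw [integral_add ((loc_scaleQ hm).const_mul _).integrable ((loc_Q hm).const_mul _).integrable,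
    integral_const_mul, integral_const_mul, integral_scaleQ hm]
  ring

theorem integral_Q_mul_srcX (hm : 2 ≤ m) : ∫ x, Q m x * srcX m x = 0 := by
  have hm2 : (2 : ℝ) ≤ m := by exact_mod_cast hm
  have hQQ := (loc_Q hm).mul (loc_Q hm)
  refine Loc.integral_eq_zero (f := fun x => pExp m / 4 * (x * (Q m x * Q m x))
      + m / ((m : ℝ) + 1) * (x * (potQ m x * (Q m x * Q m x)))
      - 1 / ((m : ℝ) + 3) * (Q m x * dQ m x))
    (((hQQ.id_mul.const_mul _).add (((loc_potQ hm).mul hQQ).id_mul.const_mul _)).sub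
      (((loc_Q hm).mul (loc_dQ hm)).const_mul _)) fun x => ?_
  have dQQ := (hasDerivAt_Q x hm).fun_mul (hasDerivAt_Q x hm)
  refine (((((hasDerivAt_id x).fun_mul dQQ).const_mul _).fun_add
    (((hasDerivAt_id x).fun_mul ((hasDerivAt_potQ x).fun_mul dQQ)).const_mul _)).fun_sub
      (((hasDerivAt_Q x hm).fun_mul (hasDerivAt_dQ hm x)).const_mul _)).congr_deriv ?_
  have h := logQ_sq (m := m) x
  have h1 : (m : ℝ) - 1 ≠ 0 := by linarith
  have h2 : (m : ℝ) + 1 ≠ 0 := by linarith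
  have h3 : (m : ℝ) + 3 ≠ 0 := by linarith
  unfold nExp at h
  unfold srcX scaleQ dIdMulQPow dQ pExp
  simp only [id]
  have h' : potQ m x = ((m : ℝ) + 1) / 2 * (1 - logQ m x ^ 2) := by
    rw [h]; field_simp; ring
  rw [h']
  field_simp
  ring

theorem integral_Q_mul_srcY (hm : 2 ≤ m) (hm5 : m < 5) : ∫ x, Q m x * srcY m x = 0 := by
  have hm2 : (2 : ℝ) ≤ m := by exact_mod_cast hm
  have hm5' : (m : ℝ) < 5 := by exact_mod_cast hm5
  refine Loc.integral_eq_zero (f := fun x => -(pExp m / lambda0 m) / 4 * (x * (Q m x * Q m x)))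
    (((loc_Q hm).mul (loc_Q hm)).id_mul.const_mul _) fun x => ?_
  refine (((hasDerivAt_id x).fun_mul
    ((hasDerivAt_Q x hm).fun_mul (hasDerivAt_Q x hm))).const_mul _).congr_deriv ?_
  have h1 : (m : ℝ) - 1 ≠ 0 := by linarith
  have h2 : 5 - (m : ℝ) ≠ 0 := by linarith
  have h3 : (m : ℝ) + 3 ≠ 0 := by linarith
  unfold srcY scaleQ dQ pExp lambda0
  simp only [id]
  field_simp
  ring

/-- The first corrector at `c = 1`, split into its part without `λ` and the coefficient of `λ`, with
its limits at `-∞`; the values of the multiples of `Q'` give `f₂`. -/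
theorem exists_first_corrector (hm : 2 ≤ m) (hm5 : m < 5) : ∃ AX AY : ℝ → ℝ,
    Tail m 0 (3 * lambda0 m * (∫ x, Q m x) / (5 - m)) AX ∧
    Tail m 0 (-(∫ x, Q m x) / (5 - m)) AY ∧
    (∀ x, HasDerivAt (linOp m AX) (srcX m x - 3 * lambda0 m * xi m * dQ m x) x) ∧
    (∀ x, HasDerivAt (linOp m AY) (srcY m x + xi m * dQ m x) x) ∧
    ∫ x, Q m x * AX x = 0 ∧ ∫ x, Q m x * AY x = 0 ∧
    ∫ x, x * Q m x * AX x = 0 ∧ ∫ x, x * Q m x * AY x = 0 := by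
  obtain ⟨AX, bX, fX, hX, hdX, hQX, hxX⟩ :=
    exists_corrector hm hm5 ((loc_srcX hm).tail (m := m)) (integral_Q_mul_srcX hm)
  obtain ⟨AY, bY, fY, hY, hdY, hQY, hxY⟩ :=
    exists_corrector hm hm5 ((loc_srcY hm).tail (m := m)) (integral_Q_mul_srcY hm hm5)
  obtain ⟨hbX, hfX⟩ := corrector_coefficients hm (loc_srcX hm)
    (fun x => by simp [srcX, scaleQ_neg, Q_neg, dIdMulQPow_neg]) hX hdX hQX
  obtain ⟨hbY, hfY⟩ := corrector_coefficients hm (loc_srcY hm)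
    (fun x => by simp [srcY, scaleQ_neg, Q_neg]) hY hdY hQY
  rw [integral_srcX hm] at hbX hfX
  rw [integral_srcY hm] at hbY hfY
  have hm2 : (2 : ℝ) ≤ m := by exact_mod_cast hm
  have hm5' : (m : ℝ) < 5 := by exact_mod_cast hm5
  have h1 : (m : ℝ) - 1 ≠ 0 := by linarith
  have h2 : 5 - (m : ℝ) ≠ 0 := by linarith
  have h3 : (m : ℝ) + 3 ≠ 0 := by linarith
  have hI := (integral_Q_sq_pos hm).ne'
  have hcoef : (1 / ((m : ℝ) - 1) - 1 / 4) * (∫ x, Q m x ^ 2) ≠ 0 := by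
    have : (1 / ((m : ℝ) - 1) - 1 / 4) = (5 - m) / (4 * (m - 1)) := by field_simp; ring
    rw [this]
    exact mul_ne_zero (div_ne_zero h2 (mul_ne_zero (by norm_num) h1)) hI
  have hfX' : fX = 3 * lambda0 m * xi m := by
    refine mul_right_cancel₀ hcoef (hfX.trans ?_)
    unfold lambda0 xi pExp
    field_simp
    ring
  have hfY' : fY = -xi m := by
    refine mul_right_cancel₀ hcoef (hfY.trans ?_)
    unfold lambda0 xi pExp
    field_simp
    ring
  refine ⟨AX, AY, hX.cast rfl ?_, hY.cast rfl ?_, fun x => ?_, fun x => ?_, hQX, hQY, hxX, hxY⟩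
  · rw [hbX]; unfold lambda0 pExp; field_simp; ring
  · rw [hbY]; unfold lambda0 pExp; field_simp; ring
  · rw [← hfX']; exact hdX x
  · exact (hdY x).congr_deriv (by rw [hfY']; ring)

end

/-! ### The solvability condition of the second corrector -/

section

theorem two_le_three : 2 ≤ 3 := by norm_num

theorem potQ_three (x : ℝ) : potQ 3 x = Q 3 x ^ 2 := by
  have h := Q_pow (m := 3) x two_le_three
  have h0 := (Q_pos (m := 3) x).ne'
  have : (potQ 3 x - Q 3 x ^ 2) * Q 3 x = 0 := by linear_combination -h
  linarith [(mul_eq_zero.1 this).resolve_right h0]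

/-- The solvability condition of the equation of the second corrector, which determines the
coefficient `f₃`. The quadratic term is integrated by writing `-6 Q Q' A = (L A)' - L (A')`; what
remains are boundary terms at `-∞` and `∫ A Q ^ 3 = -(1/2) ∫ Q L A`. -/
theorem cubic_solvability {A Ad : ℝ → ℝ} {b r l k : ℝ} (hA : Tail 3 0 b A)
    (hAd : Tail 3 0 r Ad)
    (hd : ∀ x, HasDerivAt (linOp 3 A) (2 / 3 * (1 - 3 * l) * scaleQ 3 x - (1 - l) / 2 * Q 3 x
      + dIdMulQPow 3 x) x)
    (h0 : ∫ x, Q 3 x * A x = 0) (h0' : ∫ x, Q 3 x * Ad x = 0)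
    (hb : b = 1 / 2 * (1 - l) * ∫ x, Q 3 x) (hk : k * ∫ x, Q 3 x ^ 2 = (∫ x, Q 3 x) ^ 2) :
    ∫ x, Q 3 x * (2 / 3 * (1 - 3 * l) * (x / 2 * deriv A x - l * Ad x)
      + k / 2 * l * (1 - l) * scaleQ 3 x - 3 / 2 * (1 - l) * A x
      + 3 * deriv (fun x => x * Q 3 x ^ 2 * A x) x + 3 * deriv (fun x => Q 3 x * A x ^ 2) x) = 0 := by
  have hm := two_le_three
  have hQ := loc_Q hm
  have hL := hA.linOp hm
  have hA1 := hA.deriv hm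
  have hA2 := hA1.deriv hm
  have dA := hA.hasDerivAt
  have dA1 := hA1.hasDerivAt
  have dA2 := hA2.hasDerivAt
  have dQx := fun x => hasDerivAt_Q (m := 3) x hm
  have hd1 : ∀ x, deriv (fun x => x * Q 3 x ^ 2 * A x) x
      = Q 3 x ^ 2 * A x + 2 * x * Q 3 x * dQ 3 x * A x + x * Q 3 x ^ 2 * deriv A x := fun x => by
    refine ((((hasDerivAt_id' x).fun_mul ((dQx x).fun_pow 2)).fun_mul (dA x)).congr_deriv ?_).deriv
    unfold dQ; simp only [Nat.cast_ofNat]; ring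
  have hd2 : ∀ x, deriv (fun x => Q 3 x * A x ^ 2) x
      = dQ 3 x * A x ^ 2 + 2 * Q 3 x * A x * deriv A x := fun x => by
    refine (((dQx x).fun_mul ((dA x).fun_pow 2)).congr_deriv ?_).deriv
    unfold dQ; simp only [Nat.cast_ofNat]; ring
  -- the third derivative of `A`, from the equation
  have hA3 : ∀ x, deriv (deriv (deriv A)) x = deriv A x - 3 * Q 3 x ^ 2 * deriv A x
      - 6 * Q 3 x * dQ 3 x * A x
      - (2 / 3 * (1 - 3 * l) * scaleQ 3 x - (1 - l) / 2 * Q 3 x + dIdMulQPow 3 x) := fun x => by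
    have h1 : HasDerivAt (linOp 3 A) (-deriv (deriv (deriv A)) x + deriv A x
        - (3 * (6 * 0 + 2 * Q 3 x * dQ 3 x) * A x + 3 * Q 3 x ^ 2 * deriv A x)) x := by
      have h2 : linOp 3 A = fun x => -deriv (deriv A) x + A x - (3 * Q 3 x ^ 2) * A x :=
        funext fun x => by simp [linOp, potQ_three]
      rw [h2]
      refine ((((dA2 x).fun_neg).fun_add (dA x)).fun_sub
        ((((dQx x).fun_pow 2).const_mul 3).fun_mul (dA x))).congr_deriv ?_
      unfold dQ; simp only [Nat.cast_ofNat]; ring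
    have := h1.unique (hd x)
    linarith
  set T : ℝ → ℝ := fun x => 1 / 3 * (1 - 3 * l) * (x * Q 3 x * A x) + 3 * (x * Q 3 x * (Q 3 x * Q 3 x) * A x)
    + 3 * (Q 3 x * Q 3 x * (A x * A x)) - 1 / 2 * (A x * linOp 3 A x)
    - 1 / 2 * (deriv A x * deriv A x) + 1 / 2 * (A x * deriv (deriv A) x) with hT
  have hQA := hQ.mul_tail hA
  have hQAd := hQ.mul_tail hAd
  have hQQ := hQ.mul hQ
  have hQ3A := hQ.mul hQQ |>.mul_tail hA
  have hQS := hQ.mul (loc_scaleQ hm)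
  have hTt : Tail 3 0 (-(1 / 2) * (b * b)) T := by
    have t1 := ((hQ.id_mul.mul_tail hA).const_mul (1 / 3 * (1 - 3 * l)))
    have t2 := ((hQ.id_mul.mul hQQ).mul_tail hA).const_mul 3
    have t3 := (hQQ.mul_tail (hA.mul hm hA)).const_mul 3
    have t4 := (hA.mul hm hL).const_mul (1 / 2)
    have t5 := (hA1.loc.mul_tail hA1).const_mul (1 / 2)
    have t6 := ((hA2.loc.mul_tail hA).const_mul (1 / 2))
    refine (((((t1.add t2).add t3).sub t5).add t6).tail.sub t4).congr (fun x => ?_) |>.cast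
      (by ring) (by ring)
    simp only [hT]; ring
  have hTd : ∀ x, HasDerivAt T (Q 3 x * (2 / 3 * (1 - 3 * l) * (x / 2 * deriv A x - l * Ad x)
      + k / 2 * l * (1 - l) * scaleQ 3 x - 3 / 2 * (1 - l) * A x
      + 3 * deriv (fun x => x * Q 3 x ^ 2 * A x) x + 3 * deriv (fun x => Q 3 x * A x ^ 2) x)
      - (-(2 / 3 * (1 - 3 * l) * l) * (Q 3 x * Ad x) + k / 2 * l * (1 - l) * (Q 3 x * scaleQ 3 x)
        - 2 * (1 - l) * (Q 3 x * A x) + Q 3 x * (Q 3 x * Q 3 x) * A x)) x := fun x => by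
    have d1 := (((hasDerivAt_id' x).fun_mul (dQx x)).fun_mul (dA x)).const_mul (1 / 3 * (1 - 3 * l))
    have d2 := ((((hasDerivAt_id' x).fun_mul (dQx x)).fun_mul
      ((dQx x).fun_mul (dQx x))).fun_mul (dA x)).const_mul 3
    have d3 := (((dQx x).fun_mul (dQx x)).fun_mul ((dA x).fun_mul (dA x))).const_mul 3
    have d4 := ((dA x).fun_mul (hd x)).const_mul (1 / 2)
    have d5 := ((dA1 x).fun_mul (dA1 x)).const_mul (1 / 2)
    have d6 := ((dA x).fun_mul (dA2 x)).const_mul (1 / 2)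
    refine (((((d1.fun_add d2).fun_add d3).fun_sub d4).fun_sub d5).fun_add d6).congr_deriv ?_
    rw [hd1, hd2, hA3]
    unfold linOp scaleQ dIdMulQPow dQ
    rw [potQ_three]
    push_cast
    ring
  have hI := hTt.integral_deriv hm hTd
  have hQA3 : ∫ x, Q 3 x * (Q 3 x * Q 3 x) * A x = -(1 / 4) * b * ∫ x, Q 3 x := by
    have h1 := integral_even_mul_primitive hm hQ Q_neg hL hd (fun x => by
      simp [scaleQ_neg, Q_neg, dIdMulQPow_neg])
    rw [integral_mul_linOp hm hQ hA] at h1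
    have h2 : ∀ x, linOp 3 (Q 3) x * A x = -2 * (Q 3 x * (Q 3 x * Q 3 x) * A x) := fun x => by
      rw [linOp_eq (f' := dQ 3) (dQx) (hasDerivAt_dQ hm x), potQ_three]; push_cast; ring
    simp_rw [h2] at h1
    rw [integral_const_mul] at h1
    linarith
  have i1 := hQAd.const_mul (-(2 / 3 * (1 - 3 * l) * l))
  have i2 := hQS.const_mul (k / 2 * l * (1 - l))
  have i3 := hQA.const_mul (2 * (1 - l))
  have hR : ∫ x, (-(2 / 3 * (1 - 3 * l) * l) * (Q 3 x * Ad x)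
      + k / 2 * l * (1 - l) * (Q 3 x * scaleQ 3 x)
      - 2 * (1 - l) * (Q 3 x * A x) + Q 3 x * (Q 3 x * Q 3 x) * A x)
      = k / 2 * l * (1 - l) * (1 / 4 * ∫ x, Q 3 x ^ 2) - (1 / 4) * b * ∫ x, Q 3 x := by
    rw [integral_add ((i1.add i2).sub i3).integrable hQ3A.integrable,
      integral_sub (i1.add i2).integrable i3.integrable, integral_add i1.integrable i2.integrable,
      integral_const_mul, integral_const_mul, integral_const_mul, h0, h0', hQA3,
      integral_Q_mul_scaleQ hm]
    push_cast
    ring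
  have hTl' := (hTt.deriv hm).loc.congr fun x => (hTd x).deriv
  have hR' := ((i1.add i2).sub i3).add hQ3A
  have hsum := integral_add hTl'.integrable hR'.integrable
  simp only [sub_add_cancel] at hsum
  rw [hsum, hI, hR, hb]
  linear_combination (1 / 8 * l * (1 - l)) * hk

end

/-! ### The second corrector -/

section

/-- The quadratic polynomial in `l` whose coefficients are the three functions `U k`. The correctors
at scaling `c` are such polynomials in `l = λ / c`, evaluated at `√c y`. -/
noncomputable def polyU (U : Fin 3 → ℝ → ℝ) (l x : ℝ) : ℝ := ∑ k : Fin 3, l ^ (k : ℕ) * U k x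

theorem polyU_eq (U : Fin 3 → ℝ → ℝ) (l x : ℝ) : polyU U l x = U 0 x + l * U 1 x + l ^ 2 * U 2 x := by
  simp [polyU, Fin.sum_univ_three]

variable {m : ℕ}

theorem Tail.polyU {U : Fin 3 → ℝ → ℝ} {α b : Fin 3 → ℝ} (hU : ∀ k, Tail m (α k) (b k) (U k)) (l : ℝ) :
    Tail m (α 0 + l * α 1 + l ^ 2 * α 2) (b 0 + l * b 1 + l ^ 2 * b 2) (polyU U l) :=
  (((hU 0).add ((hU 1).const_mul l)).add ((hU 2).const_mul (l ^ 2))).congr fun x =>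
    (polyU_eq U l x).symm

theorem linOp_polyU {U : Fin 3 → ℝ → ℝ} (hU : ∀ k, ContDiff ℝ ∞ (U k)) (l x : ℝ) :
    linOp m (polyU U l) x = linOp m (U 0) x + l * linOp m (U 1) x + l ^ 2 * linOp m (U 2) x := by
  have : polyU U l = fun x => U 0 x + l * U 1 x + l ^ 2 * U 2 x := funext (polyU_eq U l)
  have h1 : ContDiff ℝ ∞ fun x => l * U 1 x := contDiff_const.mul (hU 1)
  have h2 : ContDiff ℝ ∞ fun x => l ^ 2 * U 2 x := contDiff_const.mul (hU 2)
  rw [this, linOp_add ((hU 0).add h1) h2, linOp_add (hU 0) h1, linOp_const_mul _ (hU 1),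
    linOp_const_mul _ (hU 2)]

/-- Solvability for all `l` of an equation whose source is quadratic in `l` is solvability for each
coefficient, so the solution is again quadratic in `l`. -/
theorem exists_corrector_polyU (hm : 2 ≤ m) (hm5 : m < 5) {h : Fin 3 → ℝ → ℝ} {α : Fin 3 → ℝ}
    (hh : ∀ k, Tail m 0 (α k) (h k)) (h0 : ∀ l, ∫ x, Q m x * polyU h l x = 0) :
    ∃ (U : Fin 3 → ℝ → ℝ) (b f : Fin 3 → ℝ), (∀ k, Tail m (α k) (b k) (U k)) ∧
      (∀ l x, HasDerivAt (linOp m (polyU U l))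
        (polyU h l x - (f 0 + l * f 1 + l ^ 2 * f 2) * dQ m x) x) ∧
      (∀ k, ∫ x, Q m x * U k x = 0) ∧ ∀ k, ∫ x, x * Q m x * U k x = 0 := by
  have hi : ∀ k, Loc fun x => Q m x * h k x := fun k => (loc_Q hm).mul_tail (hh k)
  have hp : ∀ l, (∫ x, Q m x * h 0 x) + l * (∫ x, Q m x * h 1 x) + l ^ 2 * ∫ x, Q m x * h 2 x = 0 := by
    intro l
    have : ∀ x, Q m x * polyU h l x
        = Q m x * h 0 x + l * (Q m x * h 1 x) + l ^ 2 * (Q m x * h 2 x) := fun x => by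
      rw [polyU_eq]; ring
    rw [← h0 l]
    simp_rw [this]
    rw [integral_add ((hi 0).add ((hi 1).const_mul l)).integrable ((hi 2).const_mul _).integrable,
      integral_add (hi 0).integrable ((hi 1).const_mul l).integrable, integral_const_mul,
      integral_const_mul]
  have hz : ∀ k, ∫ x, Q m x * h k x = 0 := by
    have e0 := hp 0
    have e1 := hp 1
    have e2 := hp (-1)
    intro k
    fin_cases k <;> simp only [Fin.mk_zero, Fin.mk_one, Fin.reduceFinMk] <;> linarith
  choose U b f hU hd hQ hx using fun k => exists_corrector hm hm5 (hh k) (hz k)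
  refine ⟨U, b, f, hU, fun l x => ?_, hQ, hx⟩
  rw [show linOp m (polyU U l) = _ from funext (linOp_polyU (m := m) (fun k => (hU k).contDiff) l)]
  refine ((((hd 0 x).fun_add ((hd 1 x).const_mul l)).fun_add ((hd 2 x).const_mul (l ^ 2)))).congr_deriv ?_
  rw [polyU_eq]; ring

/-- The constant `(∫ Q)² / ∫ Q²` of the cubic ground state. -/
noncomputable def ratioQ : ℝ := (∫ x, Q 3 x) ^ 2 / ∫ x, Q 3 x ^ 2

/-- The coefficient of `a'² / a²` in the equation of the second corrector at `c = 1`. -/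
noncomputable def srcB₁ (A AY : ℝ → ℝ) (l x : ℝ) : ℝ :=
  2 / 3 * (1 - 3 * l) * (x / 2 * deriv A x - l * AY x)
      + ratioQ / 2 * l * (1 - l) * scaleQ 3 x - 3 / 2 * (1 - l) * A x
      + 3 * deriv (fun x => x * Q 3 x ^ 2 * A x) x + 3 * deriv (fun x => Q 3 x * A x ^ 2) x

/-- The coefficient of `a'' / a` in the equation of the second corrector at `c = 1`. -/
noncomputable def srcB₂ (A : ℝ → ℝ) (l x : ℝ) : ℝ :=
  (1 - l) * A x + 1 / 2 * deriv (fun x => x ^ 2 * Q 3 x ^ 3) x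

variable {AX AY : ℝ → ℝ}

theorem exists_srcB₁ {bX bY : ℝ} (hX : Tail 3 0 bX AX) (hY : Tail 3 0 bY AY) :
    ∃ (h : Fin 3 → ℝ → ℝ) (α : Fin 3 → ℝ), (∀ k, Tail 3 0 (α k) (h k)) ∧
      ∀ l x, srcB₁ (fun x => AX x + l * AY x) AY l x = polyU h l x := by
  have hm := two_le_three
  have hQ := loc_Q hm
  have hS := loc_scaleQ hm
  have hQ2 : Loc fun x => x * Q 3 x ^ 2 := ((hQ.mul hQ).id_mul).congr fun x => by ring
  have d : ∀ {f : ℝ → ℝ}, Loc f → ∀ x, HasDerivAt f (deriv f x) x := fun h => h.hasDerivAt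
  have lX : Loc fun x => x * Q 3 x ^ 2 * AX x := hQ2.mul_tail hX
  have lY : Loc fun x => x * Q 3 x ^ 2 * AY x := hQ2.mul_tail hY
  have lXX : Loc fun x => Q 3 x * AX x ^ 2 := (hQ.mul_tail (hX.mul hm hX)).congr fun x => by ring
  have lXY : Loc fun x => Q 3 x * (AX x * AY x) := hQ.mul_tail (hX.mul hm hY)
  have lYY : Loc fun x => Q 3 x * AY x ^ 2 := (hQ.mul_tail (hY.mul hm hY)).congr fun x => by ring
  have tX' : Loc fun x => x * deriv AX x := (hX.id_mul_deriv hm).loc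
  have tY' : Loc fun x => x * deriv AY x := (hY.id_mul_deriv hm).loc
  refine ⟨![fun x => 1 / 3 * (x * deriv AX x) + 3 * deriv (fun x => x * Q 3 x ^ 2 * AX x) x
      + 3 * deriv (fun x => Q 3 x * AX x ^ 2) x - 3 / 2 * AX x,
    fun x => 1 / 3 * (x * deriv AY x) + -1 * (x * deriv AX x) + ratioQ / 2 * scaleQ 3 x
      + 3 * deriv (fun x => x * Q 3 x ^ 2 * AY x) x + 6 * deriv (fun x => Q 3 x * (AX x * AY x)) x
      + (3 / 2 * AX x - 13 / 6 * AY x),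
    fun x => -1 * (x * deriv AY x) - ratioQ / 2 * scaleQ 3 x
      + 3 * deriv (fun x => Q 3 x * AY x ^ 2) x + 7 / 2 * AY x],
    ![-(3 / 2 * bX), 3 / 2 * bX - 13 / 6 * bY, 7 / 2 * bY], ?_, ?_⟩
  · intro k
    fin_cases k
    · exact ((((tX'.const_mul _).add (lX.deriv.const_mul _)).add (lXX.deriv.const_mul _)).tail.sub
        (hX.const_mul _)).cast (by ring) (by simp)
    · exact ((((((tY'.const_mul _).add (tX'.const_mul _)).add (hS.const_mul _)).add
        (lY.deriv.const_mul _)).add (lXY.deriv.const_mul _)).tail.add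
        ((hX.const_mul _).sub (hY.const_mul _))).cast (by ring) (by simp)
    · exact ((((tY'.const_mul _).sub (hS.const_mul _)).add (lYY.deriv.const_mul _)).tail.add
        (hY.const_mul _)).cast (by ring) (by simp)
  · intro l x
    have e0 : deriv (fun x => AX x + l * AY x) x = deriv AX x + l * deriv AY x :=
      ((hX.hasDerivAt x).fun_add ((hY.hasDerivAt x).const_mul l)).deriv
    have e1 : deriv (fun x => x * Q 3 x ^ 2 * (AX x + l * AY x)) x
        = deriv (fun x => x * Q 3 x ^ 2 * AX x) x + l * deriv (fun x => x * Q 3 x ^ 2 * AY x) x := by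
      refine (((d lX x).fun_add ((d lY x).const_mul l)).congr_of_eventuallyEq ?_).deriv
      exact Eventually.of_forall fun x => by ring
    have e2 : deriv (fun x => Q 3 x * (AX x + l * AY x) ^ 2) x
        = deriv (fun x => Q 3 x * AX x ^ 2) x + 2 * l * deriv (fun x => Q 3 x * (AX x * AY x)) x
          + l ^ 2 * deriv (fun x => Q 3 x * AY x ^ 2) x := by
      refine ((((d lXX x).fun_add ((d lXY x).const_mul (2 * l))).fun_add
        ((d lYY x).const_mul (l ^ 2))).congr_of_eventuallyEq ?_).deriv
      exact Eventually.of_forall fun x => by ring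
    rw [srcB₁, e0, e1, e2, polyU_eq]
    simp only [Matrix.cons_val_zero, Matrix.cons_val_one, Matrix.cons_val]
    ring

theorem exists_srcB₂ {bX bY : ℝ} (hX : Tail 3 0 bX AX) (hY : Tail 3 0 bY AY) :
    ∃ (h : Fin 3 → ℝ → ℝ) (α : Fin 3 → ℝ), (∀ k, Tail 3 0 (α k) (h k)) ∧
      ∀ l x, srcB₂ (fun x => AX x + l * AY x) l x = polyU h l x := by
  have hQ := loc_Q two_le_three
  have hQ3 : Loc fun x => x ^ 2 * Q 3 x ^ 3 := ((hQ.mul (hQ.mul hQ)).id_mul.id_mul).congr fun x => by ring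
  refine ⟨![fun x => AX x + 1 / 2 * deriv (fun x => x ^ 2 * Q 3 x ^ 3) x, fun x => AY x - AX x,
    fun x => -1 * AY x], ![bX, bY - bX, -1 * bY], ?_, fun l x => ?_⟩
  · intro k
    fin_cases k
    · exact hX.add_loc (hQ3.deriv.const_mul _)
    · exact (hY.sub hX).cast (by ring) rfl
    · exact (hY.const_mul _).cast (by ring) rfl
  · rw [srcB₂, polyU_eq]
    simp only [Matrix.cons_val_zero, Matrix.cons_val_one, Matrix.cons_val]
    ring

theorem integral_Q_mul_srcB₂ {A : ℝ → ℝ} {b : ℝ} (hA : Tail 3 0 b A) (h0 : ∫ x, Q 3 x * A x = 0)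
    (l : ℝ) : ∫ x, Q 3 x * srcB₂ A l x = 0 := by
  have hm := two_le_three
  have hQ := loc_Q hm
  have hQ3 : Loc fun x => x ^ 2 * Q 3 x ^ 3 := ((hQ.mul (hQ.mul hQ)).id_mul.id_mul).congr fun x => by ring
  have hd : ∀ x, deriv (fun x => x ^ 2 * Q 3 x ^ 3) x
      = 2 * x * Q 3 x ^ 3 + x ^ 2 * (3 * Q 3 x ^ 2 * dQ 3 x) := fun x => by
    refine ((((hasDerivAt_id' x).fun_pow 2).fun_mul ((hasDerivAt_Q x hm).fun_pow 3)).congr_deriv ?_).deriv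
    unfold dQ; simp only [Nat.cast_ofNat]; ring
  have hodd : ∫ x, Q 3 x * deriv (fun x => x ^ 2 * Q 3 x ^ 3) x = 0 := by
    have h1 : ∫ x, -(Q 3 x * deriv (fun x => x ^ 2 * Q 3 x ^ 3) x)
        = ∫ x, Q 3 x * deriv (fun x => x ^ 2 * Q 3 x ^ 3) x := by
      rw [← integral_neg_eq_self]
      congr 1; ext x
      simp only [hd, Q_neg, dQ_neg]; ring
    rw [integral_neg] at h1
    linarith
  have : ∀ x, Q 3 x * srcB₂ A l x = (1 - l) * (Q 3 x * A x)
      + 1 / 2 * (Q 3 x * deriv (fun x => x ^ 2 * Q 3 x ^ 3) x) := fun x => by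
    unfold srcB₂; ring
  simp_rw [this]
  rw [integral_add ((hQ.mul_tail hA).const_mul _).integrable
    ((hQ.mul hQ3.deriv).const_mul _).integrable, integral_const_mul, integral_const_mul, h0, hodd]
  ring

/-- The second corrector of the cubic equation at `c = 1`. -/
theorem exists_second_corrector (hX : Tail 3 0 (1 / 2 * ∫ x, Q 3 x) AX)
    (hY : Tail 3 0 (-(1 / 2) * ∫ x, Q 3 x) AY)
    (hdX : ∀ x, HasDerivAt (linOp 3 AX) (srcX 3 x) x)
    (hdY : ∀ x, HasDerivAt (linOp 3 AY) (srcY 3 x) x)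
    (hQX : ∫ x, Q 3 x * AX x = 0) (hQY : ∫ x, Q 3 x * AY x = 0) :
    ∃ (U₁ U₂ : Fin 3 → ℝ → ℝ) (α₁ α₂ b₁ b₂ g₁ g₂ : Fin 3 → ℝ),
      (∀ k, Tail 3 (α₁ k) (b₁ k) (U₁ k)) ∧ (∀ k, Tail 3 (α₂ k) (b₂ k) (U₂ k)) ∧
      (∀ l x, HasDerivAt (linOp 3 (polyU U₁ l)) (srcB₁ (fun x => AX x + l * AY x) AY l x
        - (g₁ 0 + l * g₁ 1 + l ^ 2 * g₁ 2) * dQ 3 x) x) ∧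
      (∀ l x, HasDerivAt (linOp 3 (polyU U₂ l)) (srcB₂ (fun x => AX x + l * AY x) l x
        - (g₂ 0 + l * g₂ 1 + l ^ 2 * g₂ 2) * dQ 3 x) x) ∧
      (∀ k, ∫ x, Q 3 x * U₁ k x = 0) ∧ (∀ k, ∫ x, x * Q 3 x * U₁ k x = 0) ∧
      (∀ k, ∫ x, Q 3 x * U₂ k x = 0) ∧ (∀ k, ∫ x, x * Q 3 x * U₂ k x = 0) := by
  have hm := two_le_three
  have hm5 : 3 < 5 := by norm_num
  obtain ⟨h₁, α₁, ht₁, he₁⟩ := exists_srcB₁ hX hY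
  obtain ⟨h₂, α₂, ht₂, he₂⟩ := exists_srcB₂ hX hY
  have hA : ∀ l, Tail 3 0 (1 / 2 * (1 - l) * ∫ x, Q 3 x) fun x => AX x + l * AY x := fun l =>
    (hX.add (hY.const_mul l)).cast (by ring) (by ring)
  have hQA : ∀ l, ∫ x, Q 3 x * (AX x + l * AY x) = 0 := fun l => by
    have : ∀ x, Q 3 x * (AX x + l * AY x) = Q 3 x * AX x + l * (Q 3 x * AY x) := fun x => by ring
    simp_rw [this]
    rw [integral_add ((loc_Q hm).mul_tail hX).integrable
      (((loc_Q hm).mul_tail hY).const_mul l).integrable, integral_const_mul, hQX, hQY]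
    ring
  have hdA : ∀ l x, HasDerivAt (linOp 3 fun x => AX x + l * AY x)
      (2 / 3 * (1 - 3 * l) * scaleQ 3 x - (1 - l) / 2 * Q 3 x + dIdMulQPow 3 x) x := fun l x => by
    have : (linOp 3 fun x => AX x + l * AY x) = fun x => linOp 3 AX x + l * linOp 3 AY x :=
      funext fun x => by
        rw [linOp_add hX.contDiff (hY.const_mul l).contDiff, linOp_const_mul _ hY.contDiff]
    rw [this]
    refine ((hdX x).fun_add ((hdY x).const_mul l)).congr_deriv ?_
    unfold srcX srcY pExp lambda0
    push_cast
    ring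
  have hk : ratioQ * ∫ x, Q 3 x ^ 2 = (∫ x, Q 3 x) ^ 2 :=
    div_mul_cancel₀ _ (integral_Q_sq_pos hm).ne'
  obtain ⟨U₁, b₁, g₁, hU₁, hd₁, hQ₁, hx₁⟩ := exists_corrector_polyU hm hm5 ht₁ fun l => by
    simp_rw [← he₁]
    exact cubic_solvability (hA l) hY (hdA l) (hQA l) hQY rfl hk
  obtain ⟨U₂, b₂, g₂, hU₂, hd₂, hQ₂, hx₂⟩ := exists_corrector_polyU hm hm5 ht₂ fun l => by
    simp_rw [← he₂]
    exact integral_Q_mul_srcB₂ (hA l) (hQA l) l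
  refine ⟨U₁, U₂, α₁, α₂, b₁, b₂, g₁, g₂, hU₁, hU₂, fun l x => ?_, fun l x => ?_, hQ₁, hx₁, hQ₂, hx₂⟩
  · rw [he₁]; exact hd₁ l x
  · rw [he₂]; exact hd₂ l x

end

/-! ### The error of the approximate solution at scaling one -/

/-- The profiles of the correctors at `c = 1`: `AX + l AY` is the first corrector; `U₁` and `U₂` are
the coefficients, as polynomials in `l`, of `a'² / a²` and `a'' / a` in the second one, and `G₁`,
`G₂` those of the coefficients of `f₄`. -/
structure Profiles where
  AX : ℝ → ℝ
  AY : ℝ → ℝ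
  U₁ : Fin 3 → ℝ → ℝ
  U₂ : Fin 3 → ℝ → ℝ
  G₁ : Fin 3 → ℝ
  G₂ : Fin 3 → ℝ

/-- The first corrector as a family of coefficients of powers of `l`. -/
noncomputable def Profiles.UA (X : Profiles) : Fin 3 → ℝ → ℝ := ![X.AX, X.AY, fun _ => 0]

/-- The coefficient of `f₁` at `c = 1`. -/
noncomputable def coef₁ (m : ℕ) (l : ℝ) : ℝ := pExp m * (1 - l / lambda0 m)

/-- The coefficient of `f₂` at `c = 1`. -/
noncomputable def coef₂ (m : ℕ) (l : ℝ) : ℝ := -xi m * (l - 3 * lambda0 m)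

/-- The coefficient of `f₃` at `c = 1`. -/
noncomputable def coef₃ (l : ℝ) : ℝ := ratioQ / 2 * l * (1 - l)

/-- The value at `l` of the quadratic polynomial with coefficients `G`. -/
noncomputable def polyG (G : Fin 3 → ℝ) (l : ℝ) : ℝ := G 0 + l * G 1 + l ^ 2 * G 2

/-- The equations satisfied by the profiles. -/
structure Profiles.Solves (m : ℕ) (X : Profiles) : Prop where
  tailX : Tail m 0 (3 * lambda0 m * (∫ x, Q m x) / (5 - m)) X.AX
  tailY : Tail m 0 (-(∫ x, Q m x) / (5 - m)) X.AY
  tail₁ : ∀ k, ∃ α b, Tail m α b (X.U₁ k)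
  tail₂ : ∀ k, ∃ α b, Tail m α b (X.U₂ k)
  eqA : ∀ l x, HasDerivAt (linOp m (polyU X.UA l)) (coef₁ m l * scaleQ m x - coef₂ m l * dQ m x
    - (1 - l) * (1 / ((m : ℝ) - 1)) * Q m x + dIdMulQPow m x) x
  orthX : ∫ x, Q m x * X.AX x = 0
  orthY : ∫ x, Q m x * X.AY x = 0
  orthX' : ∫ x, x * Q m x * X.AX x = 0
  orthY' : ∫ x, x * Q m x * X.AY x = 0
  eq₁ : m = 3 → ∀ l x, HasDerivAt (linOp 3 (polyU X.U₁ l))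
    (srcB₁ (polyU X.UA l) X.AY l x - polyG X.G₁ l * dQ 3 x) x
  eq₂ : m = 3 → ∀ l x, HasDerivAt (linOp 3 (polyU X.U₂ l))
    (srcB₂ (polyU X.UA l) l x - polyG X.G₂ l * dQ 3 x) x
  orth₁ : m = 3 → ∀ k, ∫ x, Q m x * X.U₁ k x = 0
  orth₂ : m = 3 → ∀ k, ∫ x, Q m x * X.U₂ k x = 0
  orth₁' : m = 3 → ∀ k, ∫ x, x * Q m x * X.U₁ k x = 0
  orth₂' : m = 3 → ∀ k, ∫ x, x * Q m x * X.U₂ k x = 0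

theorem polyU_UA (X : Profiles) (l x : ℝ) : polyU X.UA l x = X.AX x + l * X.AY x := by
  rw [polyU_eq]; simp [Profiles.UA]

theorem xi_three : xi 3 = 0 := by unfold xi; norm_num

theorem exists_profiles {m : ℕ} (hm : m = 2 ∨ m = 3 ∨ m = 4) : ∃ X : Profiles, X.Solves m := by
  have hm2 : 2 ≤ m := by omega
  have hm5 : m < 5 := by omega
  obtain ⟨AX, AY, hX, hY, hdX, hdY, hQX, hQY, hxX, hxY⟩ := exists_first_corrector hm2 hm5
  have heq : ∀ l x, HasDerivAt (linOp m fun x => AX x + l * AY x)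
      (coef₁ m l * scaleQ m x - coef₂ m l * dQ m x
        - (1 - l) * (1 / ((m : ℝ) - 1)) * Q m x + dIdMulQPow m x) x := fun l x => by
    have : (linOp m fun x => AX x + l * AY x) = fun x => linOp m AX x + l * linOp m AY x :=
      funext fun x => by
        rw [linOp_add hX.contDiff (hY.const_mul l).contDiff, linOp_const_mul _ hY.contDiff]
    rw [this]
    refine ((hdX x).fun_add ((hdY x).const_mul l)).congr_deriv ?_
    unfold srcX srcY coef₁ coef₂
    ring
  by_cases h3 : m = 3
  · subst h3
    obtain ⟨U₁, U₂, α₁, α₂, b₁, b₂, g₁, g₂, hU₁, hU₂, hd₁, hd₂, hQ₁, hx₁, hQ₂, hx₂⟩ :=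
      exists_second_corrector (hX.cast rfl (by unfold lambda0; push_cast; ring))
        (hY.cast rfl (by push_cast; ring)) (fun x => (hdX x).congr_deriv (by rw [xi_three]; ring))
        (fun x => (hdY x).congr_deriv (by rw [xi_three]; ring)) hQX hQY
    have hA : ∀ l, polyU (Profiles.UA ⟨AX, AY, U₁, U₂, g₁, g₂⟩) l = fun x => AX x + l * AY x :=
      fun l => funext fun x => polyU_UA _ _ _
    refine ⟨⟨AX, AY, U₁, U₂, g₁, g₂⟩, ⟨hX, hY, fun k => ⟨_, _, hU₁ k⟩, fun k => ⟨_, _, hU₂ k⟩,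
      fun l x => ?_, hQX, hQY, hxX, hxY, fun _ l x => ?_, fun _ l x => ?_, fun _ => hQ₁, fun _ => hQ₂,
      fun _ => hx₁, fun _ => hx₂⟩⟩
    · rw [hA]; exact heq l x
    · rw [hA]; exact hd₁ l x
    · rw [hA]; exact hd₂ l x
  · refine ⟨⟨AX, AY, fun _ _ => 0, fun _ _ => 0, fun _ => 0, fun _ => 0⟩, ⟨hX, hY,
      fun _ => ⟨0, 0, Loc.zero.tail⟩, fun _ => ⟨0, 0, Loc.zero.tail⟩, fun l x => ?_, hQX, hQY, hxX, hxY,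
      fun h => absurd h h3, fun h => absurd h h3, fun h => absurd h h3, fun h => absurd h h3,
      fun h => absurd h h3, fun h => absurd h h3⟩⟩
    rw [funext (polyU_UA (⟨AX, AY, fun _ _ => 0, fun _ _ => 0, fun _ => 0, fun _ => 0⟩ : Profiles) l)]
    exact heq l x

/-- `∂_c (c ^ r U_k (√c y) (λ / c) ^ k)` at `c = 1`. -/
noncomputable def scaleU (r : ℝ) (U : Fin 3 → ℝ → ℝ) (k : Fin 3) (x : ℝ) : ℝ :=
  (r - k) * U k x + x / 2 * deriv (U k) x

/-- The parameters of the problem at `c = 1`: `e` is the small parameter `ε / √c`, `l = λ / c`, `s`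
is the slow position `ε ρ` and `r` the velocity `ρ' / c`. -/
structure Par where
  e : ℝ
  l : ℝ
  s : ℝ
  r : ℝ

/-- `a' / a`. -/
noncomputable def slope (a : ℝ → ℝ) (s : ℝ) : ℝ := deriv a s / a s

/-- `a'' / a`. -/
noncomputable def bend (a : ℝ → ℝ) (s : ℝ) : ℝ := iteratedDeriv 2 a s / a s

/-- The derivative of `a' / ã ^ m`, multiplied by `ã`. -/
noncomputable def dSlope (m : ℕ) (a : ℝ → ℝ) (s : ℝ) : ℝ :=
  bend a s - m / ((m : ℝ) - 1) * slope a s ^ 2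

/-- The derivative of `a'² / (a² ã)`, multiplied by `ã`. -/
noncomputable def dCoef₁ (m : ℕ) (a : ℝ → ℝ) (s : ℝ) : ℝ :=
  2 * slope a s * (bend a s - slope a s ^ 2) - 1 / ((m : ℝ) - 1) * slope a s ^ 3

/-- The derivative of `a'' / (a ã)`, multiplied by `ã`. -/
noncomputable def dCoef₂ (m : ℕ) (a : ℝ → ℝ) (s : ℝ) : ℝ :=
  iteratedDeriv 3 a s / a s - bend a s * slope a s - 1 / ((m : ℝ) - 1) * (slope a s * bend a s)

/-- The second corrector at `c = 1`, with its dependence on the slow position. -/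
noncomputable def secCor (X : Profiles) (a : ℝ → ℝ) (p : Par) (z : ℝ) : ℝ :=
  slope a p.s ^ 2 * polyU X.U₁ p.l z + bend a p.s * polyU X.U₂ p.l z

/-- The correction `w` at `c = 1`, multiplied by `ã`. -/
noncomputable def cor (m : ℕ) (X : Profiles) (a : ℝ → ℝ) (p : Par) (z : ℝ) : ℝ :=
  p.e * slope a p.s * polyU X.UA p.l z + delta3 m * p.e ^ 2 * secCor X a p z

/-- The scaling derivative of the second corrector. -/
noncomputable def scaleSecCor (m : ℕ) (X : Profiles) (a : ℝ → ℝ) (p : Par) (z : ℝ) : ℝ :=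
  slope a p.s ^ 2 * polyU (scaleU (1 / ((m : ℝ) - 1) - 1) X.U₁) p.l z
    + bend a p.s * polyU (scaleU (1 / ((m : ℝ) - 1) - 1) X.U₂) p.l z

/-- The scaling derivative of the approximate solution at `c = 1`, multiplied by `ã`. -/
noncomputable def scaleSol (m : ℕ) (X : Profiles) (a : ℝ → ℝ) (p : Par) (z : ℝ) : ℝ :=
  scaleQ m z + p.e * slope a p.s * polyU (scaleU (1 / ((m : ℝ) - 1) - 1 / 2) X.UA) p.l z
    + delta3 m * p.e ^ 2 * scaleSecCor m X a p z

/-- The normalized potential `a (s + e z) / a s` seen by the soliton. -/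
noncomputable def relPot (a : ℝ → ℝ) (p : Par) (z : ℝ) : ℝ := a (p.s + p.e * z) / a p.s

/-- The flux `g'' - l g + θ g ^ m` of `g = Q + cor`. -/
noncomputable def flux (m : ℕ) (X : Profiles) (a : ℝ → ℝ) (p : Par) (z : ℝ) : ℝ :=
  deriv (deriv (fun z => Q m z + cor m X a p z)) z - p.l * (Q m z + cor m X a p z)
    + relPot a p z * (Q m z + cor m X a p z) ^ m

/-- The remainder `S̃` at `c = 1`, multiplied by `ã`. -/
noncomputable def err (m : ℕ) (X : Profiles) (a : ℝ → ℝ) (p : Par) (z : ℝ) : ℝ :=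
  (p.e * slope a p.s * coef₁ m p.l + p.e ^ 2 * delta3 m * (slope a p.s ^ 2 * coef₃ p.l))
      * scaleSol m X a p z
    - (1 - p.l + p.e * slope a p.s * coef₂ m p.l
        + p.e ^ 2 * delta3 m * (slope a p.s ^ 2 * polyG X.G₁ p.l + bend a p.s * polyG X.G₂ p.l))
      * (deriv (fun z => Q m z + cor m X a p z) z
        + p.e * slope a p.s * (1 / ((m : ℝ) - 1)) * Q m z
        - p.e ^ 2 * dSlope m a p.s * polyU X.UA p.l z)
    + delta3 m * p.e ^ 3 * p.r
      * (dCoef₁ m a p.s * polyU X.U₁ p.l z + dCoef₂ m a p.s * polyU X.U₂ p.l z)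
    + deriv (flux m X a p) z

section
variable {m : ℕ} {X : Profiles} {a : ℝ → ℝ}

theorem tail_polyU {U : Fin 3 → ℝ → ℝ} (hU : ∀ k, ∃ α b, Tail m α b (U k)) (l : ℝ) :
    ∃ α b, Tail m α b (polyU U l) := by
  choose α b h using hU
  exact ⟨_, _, Tail.polyU h l⟩

theorem Profiles.Solves.tailUA (hX : X.Solves m) (k : Fin 3) : ∃ b, Tail m 0 b (X.UA k) := by
  fin_cases k
  · exact ⟨_, hX.tailX⟩
  · exact ⟨_, hX.tailY⟩
  · exact ⟨0, Loc.zero.tail⟩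

theorem Profiles.Solves.tail_polyUA (hX : X.Solves m) (l : ℝ) : ∃ b, Tail m 0 b (polyU X.UA l) := by
  choose b h using hX.tailUA
  exact ⟨_, (Tail.polyU h l).cast (by simp) rfl⟩

theorem Profiles.Solves.tail_secCor (hX : X.Solves m) (p : Par) :
    ∃ α b, Tail m α b (secCor X a p) := by
  obtain ⟨_, _, h1⟩ := tail_polyU hX.tail₁ p.l
  obtain ⟨_, _, h2⟩ := tail_polyU hX.tail₂ p.l
  exact ⟨_, _, (h1.const_mul _).add (h2.const_mul _)⟩

theorem Profiles.Solves.tail_cor (hX : X.Solves m) (p : Par) : ∃ α b, Tail m α b (cor m X a p) := by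
  obtain ⟨_, h1⟩ := hX.tail_polyUA p.l
  obtain ⟨_, _, h2⟩ := hX.tail_secCor (a := a) p
  exact ⟨_, _, (h1.const_mul _).add (h2.const_mul _)⟩

theorem deriv_Q_add {v : ℝ → ℝ} (hm : 2 ≤ m) (hv : ContDiff ℝ ∞ v) :
    deriv (fun z => Q m z + v z) = fun z => dQ m z + deriv v z := funext fun z =>
  ((hasDerivAt_Q z hm).fun_add (hv.differentiable (by simp) z).hasDerivAt).deriv

/-- The equation of `Q` and the definition of `linOp` turn the flux into a nonlinear remainder. -/
theorem flux_eq (hm : 2 ≤ m) (hX : X.Solves m) (p : Par) (z : ℝ) :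
    flux m X a p z = (1 - p.l) * (Q m z + cor m X a p z)
      + (relPot a p z * (Q m z + cor m X a p z) ^ m - potQ m z * Q m z
          - m * potQ m z * cor m X a p z) - linOp m (cor m X a p) z := by
  obtain ⟨_, _, hc⟩ := hX.tail_cor (a := a) p
  have h2 : deriv (deriv (fun z => Q m z + cor m X a p z)) z
      = (Q m z - potQ m z * Q m z) + deriv (deriv (cor m X a p)) z := by
    rw [deriv_Q_add hm hc.contDiff]
    exact ((hasDerivAt_dQ hm z).fun_add ((hc.deriv hm).hasDerivAt z)).deriv
  rw [flux, h2, linOp]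
  ring

theorem hasDerivAt_relPot (ha : Differentiable ℝ a) (p : Par) (z : ℝ) :
    HasDerivAt (relPot a p) (p.e * deriv a (p.s + p.e * z) / a p.s) z := by
  have h1 : HasDerivAt (fun z => p.s + p.e * z) p.e z := by
    simpa using ((hasDerivAt_id z).const_mul p.e).const_add p.s
  exact (((ha _).hasDerivAt.comp z h1).div_const _).congr_deriv (by ring)

/-- The nonlinear part of the error when `m ≠ 3`. -/
noncomputable def nonlin₂ (m : ℕ) (X : Profiles) (a : ℝ → ℝ) (p : Par) (z : ℝ) : ℝ :=
  relPot a p z * (Q m z + cor m X a p z) ^ m - potQ m z * Q m z - m * potQ m z * cor m X a p z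
    - p.e * slope a p.s * (z * (potQ m z * Q m z))

/-- The nonlinear part of the error when `m = 3`. -/
noncomputable def nonlin₃ (X : Profiles) (a : ℝ → ℝ) (p : Par) (z : ℝ) : ℝ :=
  nonlin₂ 3 X a p z - 3 * p.e ^ 2 * slope a p.s ^ 2 * (z * Q 3 z ^ 2 * polyU X.UA p.l z)
    - 3 * p.e ^ 2 * slope a p.s ^ 2 * (Q 3 z * polyU X.UA p.l z ^ 2)
    - 1 / 2 * p.e ^ 2 * bend a p.s * (z ^ 2 * Q 3 z ^ 3)

theorem differentiable_nonlin₂ (hm : 2 ≤ m) (hX : X.Solves m) (ha : Differentiable ℝ a) (p : Par) :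
    Differentiable ℝ (nonlin₂ m X a p) := by
  obtain ⟨_, _, hc⟩ := hX.tail_cor (a := a) p
  have h1 : Differentiable ℝ (relPot a p) := fun z => (hasDerivAt_relPot ha p z).differentiableAt
  have h2 := hc.contDiff.differentiable (by simp)
  have h3 := (loc_Q hm).differentiable
  have h4 := (loc_potQ hm).differentiable
  unfold nonlin₂
  fun_prop

theorem err_eq_of_ne_three (hm : 2 ≤ m) (h3 : m ≠ 3) (hX : X.Solves m) (ha : Differentiable ℝ a)
    (p : Par) (z : ℝ) :
    err m X a p z = p.e ^ 2 * slope a p.s ^ 2 * coef₁ m p.l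
          * polyU (scaleU (1 / ((m : ℝ) - 1) - 1 / 2) X.UA) p.l z
        - p.e ^ 2 * slope a p.s ^ 2 * coef₂ m p.l * deriv (polyU X.UA p.l) z
        - p.e ^ 2 * slope a p.s ^ 2 * coef₂ m p.l * (1 / ((m : ℝ) - 1) * Q m z)
        + (p.e ^ 3 * slope a p.s * coef₂ m p.l * dSlope m a p.s + p.e ^ 2 * (1 - p.l) * dSlope m a p.s)
          * polyU X.UA p.l z
        + deriv (nonlin₂ m X a p) z := by
  have hδ : delta3 m = 0 := if_neg h3
  obtain ⟨_, hA⟩ := hX.tail_polyUA p.l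
  have hcor : cor m X a p = fun z => p.e * slope a p.s * polyU X.UA p.l z := by
    funext z; simp [cor, hδ]
  obtain ⟨_, _, hc⟩ := hX.tail_cor (a := a) p
  have hdc : deriv (cor m X a p) z = p.e * slope a p.s * deriv (polyU X.UA p.l) z := by
    rw [hcor]; exact ((hA.hasDerivAt z).const_mul _).deriv
  have hL : ∀ z, linOp m (cor m X a p) z = p.e * slope a p.s * linOp m (polyU X.UA p.l) z := fun z => by
    rw [hcor, linOp_const_mul _ hA.contDiff]
  have hf : flux m X a p = fun z => (1 - p.l) * (Q m z + cor m X a p z)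
      + (nonlin₂ m X a p z + p.e * slope a p.s * (z * (potQ m z * Q m z)))
      - p.e * slope a p.s * linOp m (polyU X.UA p.l) z := funext fun z => by
    rw [flux_eq hm hX, hL, nonlin₂]; ring
  have hdf := (((((hasDerivAt_Q z hm).fun_add (hc.hasDerivAt z)).const_mul (1 - p.l)).fun_add
    ((differentiable_nonlin₂ hm hX ha p z).hasDerivAt.fun_add
      ((hasDerivAt_id_mul_Q_pow hm z).const_mul (p.e * slope a p.s)))).fun_sub
    ((hX.eqA p.l z).const_mul (p.e * slope a p.s))).deriv
  rw [err, hf, hdf, deriv_Q_add hm hc.contDiff, scaleSol, hδ]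
  simp only [hdc]
  unfold dQ
  ring

theorem err_eq_of_three (hX : X.Solves 3) (ha : Differentiable ℝ a) (p : Par) (z : ℝ) :
    err 3 X a p z = p.e ^ 3 * slope a p.s * coef₁ 3 p.l * scaleSecCor 3 X a p z
        + p.e ^ 3 * slope a p.s ^ 3 * coef₃ p.l * polyU (scaleU (1 / 2 - 1 / 2) X.UA) p.l z
        + p.e ^ 4 * slope a p.s ^ 2 * coef₃ p.l * scaleSecCor 3 X a p z
        - p.e ^ 3 * (slope a p.s ^ 2 * polyG X.G₁ p.l + bend a p.s * polyG X.G₂ p.l)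
          * (slope a p.s * deriv (polyU X.UA p.l) z + p.e * deriv (secCor X a p) z)
        - p.e ^ 3 * (slope a p.s ^ 2 * polyG X.G₁ p.l + bend a p.s * polyG X.G₂ p.l)
          * (slope a p.s * (1 / 2 * Q 3 z) - p.e * dSlope 3 a p.s * polyU X.UA p.l z)
        + p.e ^ 3 * p.r * (dCoef₁ 3 a p.s * polyU X.U₁ p.l z + dCoef₂ 3 a p.s * polyU X.U₂ p.l z)
        + deriv (nonlin₃ X a p) z := by
  have hm := two_le_three
  have hδ : delta3 3 = 1 := if_pos rfl
  obtain ⟨_, hA⟩ := hX.tail_polyUA p.l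
  obtain ⟨_, _, hS⟩ := hX.tail_secCor (a := a) p
  obtain ⟨_, _, h1⟩ := tail_polyU hX.tail₁ p.l
  obtain ⟨_, _, h2⟩ := tail_polyU hX.tail₂ p.l
  obtain ⟨_, _, hc⟩ := hX.tail_cor (a := a) p
  have hQ := loc_Q hm
  have hcor : cor 3 X a p = fun z => p.e * slope a p.s * polyU X.UA p.l z + p.e ^ 2 * secCor X a p z := by
    funext z; simp [cor, hδ]
  have hdc : deriv (cor 3 X a p) z
      = p.e * slope a p.s * deriv (polyU X.UA p.l) z + p.e ^ 2 * deriv (secCor X a p) z := by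
    rw [hcor]; exact (((hA.hasDerivAt z).const_mul _).fun_add ((hS.hasDerivAt z).const_mul _)).deriv
  have hL : ∀ z, linOp 3 (cor 3 X a p) z = p.e * slope a p.s * linOp 3 (polyU X.UA p.l) z
      + p.e ^ 2 * (slope a p.s ^ 2 * linOp 3 (polyU X.U₁ p.l) z
        + bend a p.s * linOp 3 (polyU X.U₂ p.l) z) := fun z => by
    rw [hcor, linOp_add (hA.const_mul _).contDiff (hS.const_mul _).contDiff,
      linOp_const_mul _ hA.contDiff, linOp_const_mul _ hS.contDiff]
    unfold secCor
    rw [linOp_add (h1.const_mul _).contDiff (h2.const_mul _).contDiff,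
      linOp_const_mul _ h1.contDiff, linOp_const_mul _ h2.contDiff]
  have dA := hA.contDiff.differentiable (by simp)
  have dQ' := hQ.differentiable
  have e1 : Differentiable ℝ fun z => z * Q 3 z ^ 2 * polyU X.UA p.l z := by fun_prop
  have e2 : Differentiable ℝ fun z => Q 3 z * polyU X.UA p.l z ^ 2 := by fun_prop
  have e3 : Differentiable ℝ fun z => z ^ 2 * Q 3 z ^ 3 := by fun_prop
  have hN2 := differentiable_nonlin₂ hm hX ha p
  have hdN : deriv (nonlin₃ X a p) z = deriv (nonlin₂ 3 X a p) z
      - 3 * p.e ^ 2 * slope a p.s ^ 2 * deriv (fun z => z * Q 3 z ^ 2 * polyU X.UA p.l z) z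
      - 3 * p.e ^ 2 * slope a p.s ^ 2 * deriv (fun z => Q 3 z * polyU X.UA p.l z ^ 2) z
      - 1 / 2 * p.e ^ 2 * bend a p.s * deriv (fun z => z ^ 2 * Q 3 z ^ 3) z :=
    ((((hN2 z).hasDerivAt.fun_sub ((e1 z).hasDerivAt.const_mul _)).fun_sub
      ((e2 z).hasDerivAt.const_mul _)).fun_sub ((e3 z).hasDerivAt.const_mul _)).deriv
  have hf : flux 3 X a p = fun z => (1 - p.l) * (Q 3 z + cor 3 X a p z)
      + (nonlin₂ 3 X a p z + p.e * slope a p.s * (z * (potQ 3 z * Q 3 z)))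
      - (p.e * slope a p.s * linOp 3 (polyU X.UA p.l) z
      + p.e ^ 2 * (slope a p.s ^ 2 * linOp 3 (polyU X.U₁ p.l) z
        + bend a p.s * linOp 3 (polyU X.U₂ p.l) z)) := funext fun z => by
    rw [flux_eq hm hX, hL, nonlin₂]; ring
  have hdf := (((((hasDerivAt_Q z hm).fun_add (hc.hasDerivAt z)).const_mul (1 - p.l)).fun_add
    ((hN2 z).hasDerivAt.fun_add
      ((hasDerivAt_id_mul_Q_pow hm z).const_mul (p.e * slope a p.s)))).fun_sub
    (((hX.eqA p.l z).const_mul (p.e * slope a p.s)).fun_add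
      ((((hX.eq₁ rfl p.l z).const_mul (slope a p.s ^ 2)).fun_add
        ((hX.eq₂ rfl p.l z).const_mul (bend a p.s))).const_mul (p.e ^ 2)))).deriv
  have hsU : polyU (scaleU (1 / 2 - 1 / 2) X.UA) p.l z
      = z / 2 * deriv (polyU X.UA p.l) z - p.l * X.AY z := by
    have : deriv (polyU X.UA p.l) z = deriv X.AX z + p.l * deriv X.AY z := by
      rw [show polyU X.UA p.l = fun x => X.AX x + p.l * X.AY x from funext (polyU_UA X p.l)]
      exact ((hX.tailX.hasDerivAt z).fun_add ((hX.tailY.hasDerivAt z).const_mul _)).deriv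
    rw [this, polyU_eq]
    simp [scaleU, Profiles.UA]
    ring
  have h12 : 1 / (((3 : ℕ) : ℝ) - 1) = 1 / 2 := by norm_num
  rw [err, hf, hdf, deriv_Q_add hm hc.contDiff, scaleSol, hδ, hdN, h12, hsU]
  simp only [hdc]
  unfold srcB₁ srcB₂ coef₃ dQ dSlope
  rw [show coef₂ 3 p.l = 0 by unfold coef₂; rw [xi_three]; ring]
  unfold coef₁ pExp lambda0
  push_cast
  ring

end

/-! ### Bounds of the error at scaling one -/

/-- The parameters with `e ∈ (0, 1]` and bounded `l`, `r`. -/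
def parSet (L M : ℝ) : Set Par := {p | 0 < p.e ∧ p.e ≤ 1 ∧ |p.l| ≤ L ∧ |p.r| ≤ M}

/-- The weight `e ^ i η ^ j` with `η = exp (-γ |s|)`. -/
noncomputable def scaWt (γ : ℝ) (i j : ℕ) (p : Par) : ℝ := p.e ^ i * Real.exp (-γ * |p.s|) ^ j

/-- The weight `e ^ i η ^ j (1 + z⁻) ^ k (1 + e z⁻) ^ n exp (-z⁺ / 2)`: polynomial growth on the left,
where powers of the slow variable `e z` are kept apart, and exponential decay on the right. -/
noncomputable def famWt (γ : ℝ) (i j k n : ℕ) (p : Par) (z : ℝ) : ℝ :=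
  scaWt γ i j p * ((1 + max (-z) 0) ^ k * (1 + p.e * max (-z) 0) ^ n * Real.exp (-(1 / 2) * max z 0))

/-- Families that may be treated as coefficients: they are `O(e ^ i η ^ j)`. -/
def Sca (γ L M : ℝ) (d i j : ℕ) (F : Par → ℝ → ℝ) : Prop :=
  UBound (parSet L M) d (fun p _ => scaWt γ i j p) F

/-- Families bounded by `famWt`. -/
def Fam (γ L M : ℝ) (d i j k n : ℕ) (F : Par → ℝ → ℝ) : Prop :=
  UBound (parSet L M) d (famWt γ i j k n) F

section
variable {γ L M : ℝ} {d i j k n i' j' k' n' : ℕ} {F G : Par → ℝ → ℝ}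

theorem scaWt_nonneg {p : Par} (hp : p ∈ parSet L M) : 0 ≤ scaWt γ i j p := by
  have := hp.1
  unfold scaWt; positivity

theorem scaWt_mul (p : Par) : scaWt γ i j p * scaWt γ i' j' p = scaWt γ (i + i') (j + j') p := by
  unfold scaWt; ring

theorem scaWt_le (hγ : 0 ≤ γ) {p : Par} (hp : p ∈ parSet L M) (hi : i' ≤ i) (hj : j' ≤ j) :
    scaWt γ i j p ≤ scaWt γ i' j' p := by
  unfold scaWt
  have h1 : p.e ^ i ≤ p.e ^ i' := pow_le_pow_of_le_one hp.1.le hp.2.1 hi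
  have h2 : Real.exp (-γ * |p.s|) ≤ 1 := Real.exp_le_one_iff.2 (by
    have := mul_nonneg hγ (abs_nonneg p.s); linarith)
  have h3 : Real.exp (-γ * |p.s|) ^ j ≤ Real.exp (-γ * |p.s|) ^ j' :=
    pow_le_pow_of_le_one (Real.exp_pos _).le h2 hj
  have := hp.1
  gcongr

theorem famWt_nonneg {p : Par} (hp : p ∈ parSet L M) (z : ℝ) : 0 ≤ famWt γ i j k n p z := by
  have h1 := scaWt_nonneg (γ := γ) (i := i) (j := j) hp
  have h2 := hp.1
  have h3 : 0 ≤ max (-z) 0 := le_max_right _ _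
  unfold famWt; positivity

theorem Sca.mul (hF : Sca γ L M d i j F) (hG : Sca γ L M d i' j' G) :
    Sca γ L M d (i + i') (j + j') fun p z => F p z * G p z :=
  (UBound.mul hF hG).mono (K' := 1) fun p hp _ => by
    rw [scaWt_mul, abs_of_nonneg (scaWt_nonneg hp), one_mul]

theorem Sca.mono (hF : Sca γ L M d i j F) (hγ : 0 ≤ γ) (hi : i' ≤ i) (hj : j' ≤ j) :
    Sca γ L M d i' j' F :=
  UBound.mono hF (K' := 1) fun p hp _ => by
    rw [abs_of_nonneg (scaWt_nonneg hp), one_mul]; exact scaWt_le hγ hp hi hj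

theorem Sca.add (hF : Sca γ L M d i j F) (hG : Sca γ L M d i j G) :
    Sca γ L M d i j fun p z => F p z + G p z := UBound.add hF hG

theorem Sca.sub (hF : Sca γ L M d i j F) (hG : Sca γ L M d i j G) :
    Sca γ L M d i j fun p z => F p z - G p z := UBound.sub hF hG

theorem Sca.const (r : ℝ) : Sca γ L M d 0 0 fun _ _ => r :=
  UBound.scalar (g := fun _ => r) (w := fun p => scaWt γ 0 0 p) (K := |r|) fun p _ => by simp [scaWt]

theorem Sca.e_pow (i : ℕ) : Sca γ L M d i 0 fun p _ => p.e ^ i :=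
  UBound.scalar (g := fun p : Par => p.e ^ i) (w := fun p => scaWt γ i 0 p) (K := 1) fun p hp => by
    rw [scaWt, pow_zero, mul_one, one_mul, abs_of_nonneg (pow_nonneg hp.1.le _)]

theorem Sca.e : Sca γ L M d 1 0 fun p _ => p.e := by simpa only [pow_one] using Sca.e_pow (d := d) 1

theorem Sca.l : Sca γ L M d 0 0 fun p _ => p.l :=
  UBound.scalar (g := fun p : Par => p.l) (w := fun p => scaWt γ 0 0 p) (K := L) fun p hp => by
    simpa [scaWt] using hp.2.2.1

theorem Sca.r : Sca γ L M d 0 0 fun p _ => p.r :=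
  UBound.scalar (g := fun p : Par => p.r) (w := fun p => scaWt γ 0 0 p) (K := M) fun p hp => by
    simpa [scaWt] using hp.2.2.2

theorem Sca.of_slow {g : ℝ → ℝ} {K : ℝ} (h : ∀ s, |g s| ≤ K * Real.exp (-γ * |s|)) :
    Sca γ L M d 0 1 fun p _ => g p.s :=
  UBound.scalar (g := fun p : Par => g p.s) (w := fun p => scaWt γ 0 1 p) (K := K) fun p _ => by
    simpa [scaWt] using h p.s

theorem Fam.mul (hF : Fam γ L M d i j k n F) (hG : Fam γ L M d i' j' k' n' G) :
    Fam γ L M d (i + i') (j + j') (k + k') (n + n') fun p z => F p z * G p z :=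
  (UBound.mul hF hG).mono (K' := 1) fun p hp z => by
    have h2 := hp.1
    have h3 : 0 ≤ max (-z) 0 := le_max_right _ _
    have hs := scaWt_nonneg (γ := γ) (i := i + i') (j := j + j') hp
    rw [abs_of_nonneg (mul_nonneg (famWt_nonneg hp z) (famWt_nonneg hp z)), one_mul]
    unfold famWt
    rw [← scaWt_mul] at hs ⊢
    have he : Real.exp (-(1 / 2) * max z 0) ≤ 1 := Real.exp_le_one_iff.2 (by
      have : 0 ≤ max z 0 := le_max_right _ _
      linarith)
    have he0 := Real.exp_pos (-(1 / 2) * max z 0)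
    calc _ = scaWt γ i j p * scaWt γ i' j' p * ((1 + max (-z) 0) ^ (k + k') *
          (1 + p.e * max (-z) 0) ^ (n + n') *
            (Real.exp (-(1 / 2) * max z 0) * Real.exp (-(1 / 2) * max z 0))) := by ring
      _ ≤ _ := by
        gcongr
        exact mul_le_of_le_one_left he0.le he

theorem Sca.mul_fam (hF : Sca γ L M d i j F) (hG : Fam γ L M d i' j' k' n' G) :
    Fam γ L M d (i + i') (j + j') k' n' fun p z => F p z * G p z :=
  (UBound.mul hF hG).mono (K' := 1) fun p hp z => by
    rw [abs_of_nonneg (mul_nonneg (scaWt_nonneg hp) (famWt_nonneg hp z)), one_mul]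
    unfold famWt
    rw [← mul_assoc, scaWt_mul]

theorem Fam.mono (hF : Fam γ L M d i j k n F) (hγ : 0 ≤ γ) (hi : i' ≤ i) (hj : j' ≤ j) (hk : k ≤ k')
    (hn : n ≤ n') : Fam γ L M d i' j' k' n' F :=
  UBound.mono hF (K' := 1) fun p hp z => by
    have h2 := hp.1
    have h3 : 0 ≤ max (-z) 0 := le_max_right _ _
    have h4 := scaWt_nonneg (γ := γ) (i := i') (j := j') hp
    have h5 := scaWt_le hγ hp hi hj
    rw [abs_of_nonneg (famWt_nonneg hp z), one_mul]
    unfold famWt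
    have h6 : 1 ≤ 1 + max (-z) 0 := by linarith
    have h7 : 1 ≤ 1 + p.e * max (-z) 0 := by
      have := mul_nonneg h2.le h3
      linarith
    gcongr

theorem Fam.add (hF : Fam γ L M d i j k n F) (hG : Fam γ L M d i j k n G) :
    Fam γ L M d i j k n fun p z => F p z + G p z := UBound.add hF hG

theorem Fam.sub (hF : Fam γ L M d i j k n F) (hG : Fam γ L M d i j k n G) :
    Fam γ L M d i j k n fun p z => F p z - G p z := UBound.sub hF hG

theorem Fam.const_mul (r : ℝ) (hF : Fam γ L M d i j k n F) :
    Fam γ L M d i j k n fun p z => r * F p z := UBound.const_mul r hF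

theorem Fam.deriv (hF : Fam γ L M (d + 1) i j k n F) : Fam γ L M d i j k n fun p => deriv (F p) :=
  UBound.deriv hF

/-- A factor `e z⁻` may be traded for a power of the slow variable. -/
theorem Fam.slow (hF : Fam γ L M d (i + 1) j (k + 1) n F) : Fam γ L M d i j k (n + 1) F :=
  UBound.mono hF (K' := 1) fun p hp z => by
    have h2 := hp.1
    have h3 : 0 ≤ max (-z) 0 := le_max_right _ _
    have h4 := scaWt_nonneg (γ := γ) (i := i) (j := j) hp
    rw [abs_of_nonneg (famWt_nonneg hp z), one_mul]
    unfold famWt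
    have h5 : scaWt γ (i + 1) j p = scaWt γ i j p * p.e := by unfold scaWt; ring
    rw [h5]
    have h6 : p.e * (1 + max (-z) 0) ≤ 1 + p.e * max (-z) 0 := by nlinarith [hp.2.1]
    calc _ = scaWt γ i j p * ((1 + max (-z) 0) ^ k * ((p.e * (1 + max (-z) 0)) *
          (1 + p.e * max (-z) 0) ^ n) * Real.exp (-(1 / 2) * max z 0)) := by ring
      _ ≤ scaWt γ i j p * ((1 + max (-z) 0) ^ k * ((1 + p.e * max (-z) 0) *
          (1 + p.e * max (-z) 0) ^ n) * Real.exp (-(1 / 2) * max z 0)) := by gcongr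
      _ = _ := by ring

theorem DBound.family {W f : ℝ → ℝ} (h : DBound d W f) {ι : Type*} (S : Set ι) :
    UBound S d (fun _ => W) (fun _ => f) :=
  ⟨fun _ _ => h.1 () trivial, fun j hj => (h.2 j hj).imp fun _ hK _ _ => hK () trivial⟩

theorem fam_of_dBound {f : ℝ → ℝ} (k : ℕ)
    (h : DBound d (fun z => (1 + max (-z) 0) ^ k * Real.exp (-(1 / 2) * max z 0)) f) :
    Fam γ L M d 0 0 k 0 fun _ => f :=
  (h.family (parSet L M)).mono (K' := 1) fun p hp z => by
    have h3 : 0 ≤ max (-z) 0 := le_max_right _ _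
    rw [abs_of_nonneg (by positivity), one_mul]
    simp [famWt, scaWt]

theorem exp_abs_le_exp_max {κ κ' : ℝ} (h0 : 0 ≤ κ) (h : κ ≤ κ') (z : ℝ) :
    Real.exp (-κ' * |z|) ≤ Real.exp (-κ * max z 0) := by
  have : κ * max z 0 ≤ κ' * |z| := by
    have h1 : max z 0 ≤ |z| := max_le (le_abs_self z) (abs_nonneg z)
    have h2 : (0 : ℝ) ≤ max z 0 := le_max_right _ _
    nlinarith [abs_nonneg z]
  exact Real.exp_le_exp.2 (by linarith)

theorem Loc.fam {f : ℝ → ℝ} (h : Loc f) : Fam γ L M d 0 0 0 0 fun _ => f :=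
  fam_of_dBound 0 (UBound.mono (h d (1 / 2) (by norm_num)) (K' := 1) fun _ _ z => by
    rw [abs_of_pos (Real.exp_pos _)]
    simpa using exp_abs_le_exp_max (κ := 1 / 2) (by norm_num) le_rfl z)

variable {m : ℕ}

theorem dBound_step (hm : 2 ≤ m) (d : ℕ) :
    DBound d (fun z => Real.exp (-(3 / 4) * max z 0)) (step m) := by
  have hm2 : (2 : ℝ) ≤ m := by exact_mod_cast hm
  have h0 : ∀ z, |step m z| ≤ 1 * Real.exp (-(3 / 4) * max z 0) := fun z => by
    rw [step_eq, one_mul, abs_of_nonneg (by positivity), div_le_iff₀ (by positivity)]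
    rcases le_total 0 z with hz | hz
    · rw [max_eq_left hz]
      have h1 : Real.exp z ≤ Real.exp (((m : ℝ) - 1) * z) := Real.exp_le_exp.2 (by nlinarith)
      have h2 : 1 = Real.exp (-(3 / 4) * z) * Real.exp (3 / 4 * z) := by
        rw [← Real.exp_add]; simp
      have h3 : Real.exp (3 / 4 * z) ≤ Real.exp z := Real.exp_le_exp.2 (by linarith)
      calc (1 : ℝ) = Real.exp (-(3 / 4) * z) * Real.exp (3 / 4 * z) := h2
        _ ≤ _ := by
          gcongr
          linarith
    · rw [max_eq_right hz]
      simpa using (Real.exp_pos _).le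
  rcases d with _ | d
  · exact UBound.of_bound
      (fun _ _ => continuous_iff_continuousAt.2 fun z => (hasDerivAt_step z).continuousAt)
      fun _ _ => h0
  · refine UBound.of_deriv (fun _ _ z => hasDerivAt_step z) (fun _ _ => h0) ?_
    exact UBound.mono (((loc_potQ hm).const_mul _) d (3 / 4) (by norm_num)) (K' := 1) fun _ _ z => by
      rw [abs_of_pos (Real.exp_pos _), one_mul]
      exact exp_abs_le_exp_max (by norm_num) le_rfl z

theorem dBound_id (d : ℕ) : DBound d (fun x => 1 + |x|) fun x => x := by
  rcases d with _ | n
  · exact UBound.of_bound (K := 1) (fun _ _ => continuous_id) (fun _ _ x => by simp)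
  · exact UBound.of_deriv (F' := fun _ _ => 1) (K := 1) (fun _ _ x => hasDerivAt_id x)
      (fun _ _ x => by simp) (UBound.one.mono (K' := 1) fun _ _ x => by simp)

theorem Tail.fam (hm : 2 ≤ m) {α β : ℝ} {f : ℝ → ℝ} (hf : Tail m α β f) (hγ : 0 ≤ γ) :
    Fam γ L M d 0 0 1 0 fun _ => f := by
  obtain ⟨g, hg, h⟩ := hf.decomp
  have h1 : Fam γ L M d 0 0 0 0 fun _ => step m := fam_of_dBound 0
    (UBound.mono (dBound_step hm d) (K' := 1) fun _ _ z => by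
      have : (0 : ℝ) ≤ max z 0 := le_max_right _ _
      rw [abs_of_pos (Real.exp_pos _), one_mul, pow_zero, one_mul]
      exact Real.exp_le_exp.2 (by linarith))
  have h2 : Fam γ L M d 0 0 1 0 fun _ z => z * step m z := by
    obtain ⟨K, hK0, hK⟩ := exists_one_add_pow_le_exp 1 (δ := 1 / 4) (by norm_num)
    refine fam_of_dBound 1 (UBound.mono (UBound.mul (dBound_id d) (dBound_step hm d)) (K' := K)
      fun _ _ z => ?_)
    have h3 : (0 : ℝ) ≤ max z 0 := le_max_right _ _
    have h4 : (0 : ℝ) ≤ max (-z) 0 := le_max_right _ _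
    have h5 : 1 + |z| ≤ (1 + max (-z) 0) * (1 + max z 0) := by
      rcases le_total 0 z with hz | hz
      · rw [abs_of_nonneg hz, max_eq_left hz, max_eq_right (by linarith)]; linarith
      · rw [abs_of_nonpos hz, max_eq_right hz, max_eq_left (by linarith)]; linarith
    have h6 := hK _ h3
    rw [pow_one] at h6 ⊢
    rw [abs_of_nonneg (by positivity)]
    calc _ ≤ (1 + max (-z) 0) * (K * Real.exp (1 / 4 * max z 0)) * Real.exp (-(3 / 4) * max z 0) := by
          gcongr
          exact h5.trans (by gcongr)
      _ = K * ((1 + max (-z) 0) * (Real.exp (1 / 4 * max z 0) * Real.exp (-(3 / 4) * max z 0))) := by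
        ring
      _ = _ := by rw [← Real.exp_add]; ring_nf
  have h3 := ((hg.fam (γ := γ) (L := L) (M := M) (d := d)).mono hγ le_rfl le_rfl zero_le_one le_rfl).add
    (h2.const_mul α) |>.add ((h1.mono hγ le_rfl le_rfl zero_le_one le_rfl).const_mul β)
  exact UBound.congr h3 fun _ _ z => (h z).symm

theorem Tail.fam_zero (hm : 2 ≤ m) {β : ℝ} {f : ℝ → ℝ} (hf : Tail m 0 β f) :
    Fam γ L M d 0 0 0 0 fun _ => f := by
  obtain ⟨g, hg, h⟩ := hf.decomp
  have h1 : Fam γ L M d 0 0 0 0 fun _ => step m := fam_of_dBound 0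
    (UBound.mono (dBound_step hm d) (K' := 1) fun _ _ z => by
      have : (0 : ℝ) ≤ max z 0 := le_max_right _ _
      rw [abs_of_pos (Real.exp_pos _), one_mul, pow_zero, one_mul]
      exact Real.exp_le_exp.2 (by linarith))
  exact UBound.congr ((hg.fam (γ := γ) (L := L) (M := M) (d := d)).add (h1.const_mul β))
    fun _ _ z => by rw [h z]; ring

theorem fam_polyU {U : Fin 3 → ℝ → ℝ} (hU : ∀ q, Fam γ L M d 0 0 k 0 fun _ => U q) :
    Fam γ L M d 0 0 k 0 fun p z => polyU U p.l z := by
  have hl : Sca γ L M d 0 0 fun p _ => p.l := Sca.l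
  have := ((hU 0).add (hl.mul_fam (hU 1))).add ((hl.mul hl).mul_fam (hU 2))
  exact UBound.congr this fun p _ z => by rw [polyU_eq]; ring

/-! ### The potential near the soliton -/

/-- Bounds for the potential, with a small exponential rate. -/
structure PotBound (a : ℝ → ℝ) (K γ : ℝ) : Prop where
  contDiff : ContDiff ℝ 3 a
  one_lt : ∀ r, 1 < a r
  lt_two : ∀ r, a r < 2
  pos : 0 < γ
  small : γ ≤ 1 / 8
  decay : ∀ k : ℕ, 1 ≤ k → k ≤ 3 → ∀ r, |iteratedDeriv k a r| ≤ K * Real.exp (-γ * |r|)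

theorem IsPotential.exists_potBound {a : ℝ → ℝ} (ha : IsPotential m a) : ∃ K γ, PotBound a K γ := by
  obtain ⟨K, hK, γ, hγ, h, -, -⟩ := ha.decay
  refine ⟨K, min γ (1 / 8), ha.contDiff, ha.one_lt, ha.lt_two, by positivity, min_le_right _ _,
    fun k h1 h3 r => (h k h1 h3 r).trans ?_⟩
  gcongr
  exact min_le_left _ _

variable {a : ℝ → ℝ} {K : ℝ}

theorem PotBound.K_nonneg (h : PotBound a K γ) : 0 ≤ K := by
  have := (abs_nonneg _).trans (h.decay 1 le_rfl (by norm_num) 0)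
  simpa using this

theorem PotBound.abs_div_le (h : PotBound a K γ) {k : ℕ} (h1 : 1 ≤ k) (h3 : k ≤ 3) (s : ℝ) :
    |iteratedDeriv k a s / a s| ≤ K * Real.exp (-γ * |s|) := by
  have ha := h.one_lt s
  rw [abs_div, abs_of_pos (show 0 < a s by linarith)]
  exact (div_le_self (abs_nonneg _) ha.le).trans (h.decay k h1 h3 s)

theorem PotBound.slope_le (h : PotBound a K γ) (s : ℝ) : |slope a s| ≤ K * Real.exp (-γ * |s|) := by
  simpa [slope, iteratedDeriv_one] using h.abs_div_le le_rfl (by norm_num) s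

theorem PotBound.bend_le (h : PotBound a K γ) (s : ℝ) : |bend a s| ≤ K * Real.exp (-γ * |s|) :=
  h.abs_div_le (by norm_num) (by norm_num) s

theorem PotBound.sca_slope (h : PotBound a K γ) : Sca γ L M d 0 1 fun p _ => slope a p.s :=
  Sca.of_slow h.slope_le

theorem PotBound.sca_bend (h : PotBound a K γ) : Sca γ L M d 0 1 fun p _ => bend a p.s :=
  Sca.of_slow h.bend_le

theorem PotBound.sca_dSlope (h : PotBound a K γ) : Sca γ L M d 0 1 fun p _ => dSlope m a p.s := by
  have hs := h.sca_slope (d := d) (L := L) (M := M)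
  have := h.sca_bend.sub ((((Sca.const (m / ((m : ℝ) - 1))).mul (hs.mul hs)).mono
    h.pos.le (i' := 0) (j' := 1) (by norm_num) (by norm_num)))
  exact UBound.congr (S := parSet L M) (n := d) this fun p _ _ => by unfold dSlope; ring

theorem PotBound.sca_dCoef₁ (h : PotBound a K γ) : Sca γ L M d 0 1 fun p _ => dCoef₁ m a p.s := by
  have hs := h.sca_slope (d := d) (L := L) (M := M)
  have h1 := (((Sca.const 2).mul hs).mul (h.sca_bend.sub
    ((hs.mul hs).mono (i' := 0) (j' := 1) h.pos.le (by norm_num) (by norm_num)))).mono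
      (i' := 0) (j' := 1) h.pos.le (by norm_num) (by norm_num)
  have h2 := ((Sca.const (1 / ((m : ℝ) - 1))).mul ((hs.mul hs).mul hs)).mono
      (i' := 0) (j' := 1) h.pos.le (by norm_num) (by norm_num)
  exact UBound.congr (h1.sub h2) fun p _ _ => by unfold dCoef₁; ring

theorem PotBound.sca_dCoef₂ (h : PotBound a K γ) : Sca γ L M d 0 1 fun p _ => dCoef₂ m a p.s := by
  have hs := h.sca_slope (d := d) (L := L) (M := M)
  have hb := h.sca_bend (d := d) (L := L) (M := M)
  have h3 : Sca γ L M d 0 1 fun p _ => iteratedDeriv 3 a p.s / a p.s :=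
    Sca.of_slow (g := fun s => iteratedDeriv 3 a s / a s) (h.abs_div_le (by norm_num) le_rfl)
  have h1 := (hb.mul hs).mono (i' := 0) (j' := 1) h.pos.le (by norm_num) (by norm_num)
  have h2 := ((Sca.const (1 / ((m : ℝ) - 1))).mul (hs.mul hb)).mono
      (i' := 0) (j' := 1) h.pos.le (by norm_num) (by norm_num)
  exact (h3.sub h1).sub h2

/-- The weight of Taylor remainders of the potential. -/
noncomputable def taylorWt (γ : ℝ) (i k : ℕ) (p : Par) (z : ℝ) : ℝ :=
  scaWt γ i 1 p * ((1 + |z|) ^ k * Real.exp (γ * |z|))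

theorem abs_le_of_hasDerivAt_of_zero {f f' : ℝ → ℝ} {C : ℝ} {z : ℝ}
    (hd : ∀ x, HasDerivAt f (f' x) x) (h0 : f 0 = 0) (hC : ∀ x, |x| ≤ |z| → |f' x| ≤ C) :
    |f z| ≤ C * |z| := by
  have := (convex_uIcc (0 : ℝ) z).norm_image_sub_le_of_norm_hasDerivWithin_le (f := f) (f' := f')
    (C := C) (fun x _ => (hd x).hasDerivWithinAt) (fun x hx => hC x ?_) left_mem_uIcc right_mem_uIcc
  · simpa [h0] using this
  · rcases le_total 0 z with hz | hz
    · rw [uIcc_of_le hz] at hx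
      rw [abs_of_nonneg hx.1, abs_of_nonneg hz]; exact hx.2
    · rw [uIcc_of_ge hz] at hx
      rw [abs_of_nonpos hx.2, abs_of_nonpos hz]; linarith [hx.1]

theorem UBound.taylor {F' : Par → ℝ → ℝ} (hγ : 0 ≤ γ) (hd : ∀ p ∈ parSet L M, ∀ z, HasDerivAt (F p) (F' p z) z)
    (h0 : ∀ p ∈ parSet L M, F p 0 = 0) (h : UBound (parSet L M) d (taylorWt γ i k) F') :
    UBound (parSet L M) (d + 1) (taylorWt γ i (k + 1)) F := by
  obtain ⟨K, hK⟩ := h.bound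
  refine UBound.of_deriv hd (K := |K|) (fun p hp z => ?_) (h.mono (K' := 1) fun p hp z => ?_)
  · have hs := scaWt_nonneg (γ := γ) (i := i) (j := 1) hp
    have h1 := abs_le_of_hasDerivAt_of_zero (C := |K| * taylorWt γ i k p z) (hd p hp) (h0 p hp)
      fun x hx => (hK p hp x).trans (by
        have : taylorWt γ i k p x ≤ taylorWt γ i k p z := by unfold taylorWt; gcongr
        have h2 : 0 ≤ taylorWt γ i k p x := by unfold taylorWt; positivity
        exact (mul_le_mul_of_nonneg_right (le_abs_self K) h2).trans (by gcongr))
    refine h1.trans ?_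
    rw [mul_assoc]
    gcongr
    unfold taylorWt
    calc _ ≤ scaWt γ i 1 p * ((1 + |z|) ^ k * Real.exp (γ * |z|)) * (1 + |z|) := by
          gcongr; linarith
      _ = _ := by ring
  · have hs := scaWt_nonneg (γ := γ) (i := i) (j := 1) hp
    unfold taylorWt
    rw [abs_of_nonneg (by positivity), one_mul]
    gcongr
    · linarith [abs_nonneg z]
    · omega

/-- The derivatives of the relative potential, up to powers of `e`. -/
noncomputable def relPotD (a : ℝ → ℝ) (k : ℕ) (p : Par) (z : ℝ) : ℝ :=
  iteratedDeriv k a (p.s + p.e * z) / a p.s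

theorem PotBound.hasDerivAt_relPotD (h : PotBound a K γ) {k : ℕ} (hk : k < 3) (p : Par) (z : ℝ) :
    HasDerivAt (relPotD a k p) (p.e * relPotD a (k + 1) p z) z := by
  have hdiff : Differentiable ℝ (iteratedDeriv k a) :=
    h.contDiff.differentiable_iteratedDeriv k (by exact_mod_cast hk)
  have h1 : HasDerivAt (fun z => p.s + p.e * z) p.e z := by
    simpa using ((hasDerivAt_id z).const_mul p.e).const_add p.s
  refine (((hdiff _).hasDerivAt.comp z h1).div_const _).congr_deriv ?_
  rw [relPotD, iteratedDeriv_succ]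
  ring

theorem PotBound.continuous_relPotD (h : PotBound a K γ) {k : ℕ} (hk : k ≤ 3) (p : Par) :
    Continuous (relPotD a k p) := by
  have : Continuous (iteratedDeriv k a) := h.contDiff.continuous_iteratedDeriv k (by exact_mod_cast hk)
  unfold relPotD
  fun_prop

theorem PotBound.relPotD_zero_arg (k : ℕ) (p : Par) : relPotD a k p 0 = iteratedDeriv k a p.s / a p.s := by
  simp [relPotD]

theorem PotBound.abs_relPotD_le (h : PotBound a K γ) {k : ℕ} (h1 : 1 ≤ k) (h3 : k ≤ 3) {p : Par}
    (hp : p ∈ parSet L M) (z : ℝ) : |relPotD a k p z| ≤ K * taylorWt γ 0 0 p z := by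
  have ha := h.one_lt p.s
  have hK := h.K_nonneg
  have hγ := h.pos
  rw [relPotD, abs_div, abs_of_pos (by linarith : 0 < a p.s)]
  refine (div_le_self (abs_nonneg _) ha.le).trans ((h.decay k h1 h3 _).trans ?_)
  unfold taylorWt scaWt
  rw [pow_zero, pow_zero, pow_one, one_mul, one_mul, ← Real.exp_add]
  gcongr
  have h4 : |p.s| ≤ |p.s + p.e * z| + |z| := by
    have h5 : |p.e * z| ≤ |z| := by
      rw [abs_mul, abs_of_pos hp.1]
      exact mul_le_of_le_one_left (abs_nonneg z) hp.2.1
    have h6 : |p.s| ≤ |p.s + p.e * z| + |p.e * z| := by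
      have := abs_sub (p.s + p.e * z) (p.e * z)
      simpa using this
    linarith
  nlinarith

theorem taylorWt_mul_scaWt (i k : ℕ) (p : Par) (z : ℝ) :
    p.e ^ i * taylorWt γ 0 k p z = taylorWt γ i k p z := by
  unfold taylorWt scaWt; ring

theorem PotBound.uBound_relPotD (h : PotBound a K γ) {k : ℕ} (h1 : 1 ≤ k) (h3 : k ≤ 3) (i : ℕ) :
    UBound (parSet L M) 0 (taylorWt γ i 0) fun p z => p.e ^ i * relPotD a k p z := by
  refine UBound.of_bound (K := K) (fun p _ => continuous_const.mul (h.continuous_relPotD h3 p))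
    fun p hp z => ?_
  rw [abs_mul, abs_of_nonneg (pow_nonneg hp.1.le i), ← taylorWt_mul_scaWt]
  have := h.abs_relPotD_le h1 h3 hp z
  have h4 := pow_nonneg hp.1.le i
  calc _ ≤ p.e ^ i * (K * taylorWt γ 0 0 p z) := by gcongr
    _ = _ := by ring

/-- The first order Taylor remainder of the relative potential. -/
noncomputable def rem₁ (a : ℝ → ℝ) (p : Par) (z : ℝ) : ℝ := relPot a p z - 1 - p.e * slope a p.s * z

/-- The second order Taylor remainder of the relative potential. -/
noncomputable def rem₂ (a : ℝ → ℝ) (p : Par) (z : ℝ) : ℝ :=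
  rem₁ a p z - 1 / 2 * p.e ^ 2 * bend a p.s * z ^ 2

theorem relPot_eq (p : Par) : relPot a p = relPotD a 0 p := by
  funext z; simp [relPot, relPotD]

theorem PotBound.hasDerivAt_rem₁ (h : PotBound a K γ) (p : Par) (z : ℝ) :
    HasDerivAt (rem₁ a p) (p.e * (relPotD a 1 p z - relPotD a 1 p 0)) z := by
  have h1 := h.hasDerivAt_relPotD (k := 0) (by norm_num) p z
  rw [← relPot_eq] at h1
  refine ((h1.sub_const 1).fun_sub ((hasDerivAt_id' z).const_mul (p.e * slope a p.s))).congr_deriv ?_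
  rw [relPotD_zero_arg, iteratedDeriv_one, slope]
  ring

theorem PotBound.rem₁_zero (h : PotBound a K γ) (p : Par) : rem₁ a p 0 = 0 := by
  have := h.one_lt p.s
  simp [rem₁, relPot, div_self (by linarith : a p.s ≠ 0)]

theorem PotBound.uBound_rem₁ (h : PotBound a K γ) :
    UBound (parSet L M) 2 (taylorWt γ 2 2) (rem₁ a) := by
  refine UBound.taylor h.pos.le (fun p _ => h.hasDerivAt_rem₁ p) (fun p _ => h.rem₁_zero p) ?_
  refine UBound.taylor (F' := fun p z => p.e ^ 2 * relPotD a 2 p z) h.pos.le (fun p _ z => ?_)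
    (fun p _ => by simp) (h.uBound_relPotD (by norm_num) (by norm_num) 2)
  refine (((h.hasDerivAt_relPotD (k := 1) (by norm_num) p z).sub_const _).const_mul p.e).congr_deriv ?_
  ring

theorem PotBound.uBound_rem₂ (h : PotBound a K γ) :
    UBound (parSet L M) 2 (taylorWt γ 3 3) (rem₂ a) := by
  have h3 := UBound.taylor (F := fun p z => p.e ^ 2 * (relPotD a 2 p z - relPotD a 2 p 0))
    (F' := fun p z => p.e ^ 3 * relPotD a 3 p z) h.pos.le (fun p _ z => by
      refine (((h.hasDerivAt_relPotD (k := 2) (by norm_num) p z).sub_const _).const_mul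
        (p.e ^ 2)).congr_deriv ?_
      ring) (fun p _ => by simp) (h.uBound_relPotD (L := L) (M := M) (by norm_num) le_rfl 3)
  have h2 := UBound.taylor
    (F := fun p z => p.e * (relPotD a 1 p z - relPotD a 1 p 0 - p.e * relPotD a 2 p 0 * z))
    h.pos.le (fun p _ z => by
      refine ((((h.hasDerivAt_relPotD (k := 1) (by norm_num) p z).sub_const _).fun_sub
        ((hasDerivAt_id' z).const_mul (p.e * relPotD a 2 p 0))).const_mul p.e).congr_deriv ?_
      ring) (fun p _ => by simp) h3
  have := UBound.taylor (F := rem₂ a) h.pos.le (fun p _ z => by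
      refine ((h.hasDerivAt_rem₁ p z).fun_sub
        (((hasDerivAt_id' z).fun_pow 2).const_mul (1 / 2 * p.e ^ 2 * bend a p.s))).congr_deriv ?_
      rw [relPotD_zero_arg 2, bend]
      simp only [Nat.cast_ofNat]
      ring) (fun p _ => by simp [rem₂, h.rem₁_zero]) h2
  exact this.of_le (by norm_num)

theorem fam_taylor_mul_Q (hm : 2 ≤ m) {R : Par → ℝ → ℝ} (hγ : γ ≤ 1 / 8)
    (hR : UBound (parSet L M) d (taylorWt γ i k) R) :
    Fam γ L M d i 1 0 0 fun p z => R p z * Q m z := by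
  obtain ⟨K, hK0, hK⟩ := exists_one_add_pow_le_exp k (δ := 1 / 8) (by norm_num)
  refine (hR.mul ((loc_Q hm d (3 / 4) (by norm_num)).family (parSet L M))).mono (K' := K)
    fun p hp z => ?_
  have hs := scaWt_nonneg (γ := γ) (i := i) (j := 1) hp
  have h1 := hK |z| (abs_nonneg z)
  unfold taylorWt famWt
  rw [abs_of_nonneg (by positivity)]
  have h2 : Real.exp (γ * |z|) ≤ Real.exp (1 / 8 * |z|) := by gcongr
  have h3 := exp_abs_le_exp_max (κ := 1 / 2) (by norm_num) le_rfl z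
  calc _ ≤ scaWt γ i 1 p * (K * Real.exp (1 / 8 * |z|) * Real.exp (1 / 8 * |z|))
        * Real.exp (-(3 / 4) * |z|) := by gcongr
    _ = K * (scaWt γ i 1 p * Real.exp (1 / 8 * |z| + 1 / 8 * |z| + -(3 / 4) * |z|)) := by
      rw [Real.exp_add, Real.exp_add]; ring
    _ = K * (scaWt γ i 1 p * Real.exp (-(1 / 2) * |z|)) := by ring_nf
    _ ≤ K * (scaWt γ i 1 p * Real.exp (-(1 / 2) * max z 0)) := by gcongr
    _ = _ := by simp

theorem PotBound.sca_relPot (h : PotBound a K γ) : Sca γ L M 2 0 0 (relPot a) := by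
  have hK := h.K_nonneg
  have hb : ∀ k, 1 ≤ k → k ≤ 3 → ∀ (i : ℕ), ∀ p ∈ parSet L M, ∀ z,
      |p.e ^ i * relPotD a k p z| ≤ K * scaWt γ 0 0 p := fun k h1 h3 i p hp z => by
    have ha := h.one_lt p.s
    rw [abs_mul, abs_of_nonneg (pow_nonneg hp.1.le i), relPotD, abs_div, abs_of_pos (by linarith : 0 < a p.s)]
    have h5 : |iteratedDeriv k a (p.s + p.e * z)| / a p.s ≤ K := by
      refine (div_le_self (abs_nonneg _) ha.le).trans ((h.decay k h1 h3 _).trans ?_)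
      refine mul_le_of_le_one_right hK (Real.exp_le_one_iff.2 ?_)
      have := mul_nonneg h.pos.le (abs_nonneg (p.s + p.e * z))
      linarith
    have h6 : p.e ^ i ≤ 1 := pow_le_one₀ hp.1.le hp.2.1
    have h7 := pow_nonneg hp.1.le i
    simp only [scaWt, pow_zero, mul_one]
    calc _ ≤ 1 * K := by gcongr
      _ = K := one_mul K
  have h0 : UBound (parSet L M) 0 (fun p _ => scaWt γ 0 0 p) fun p z => p.e ^ 2 * relPotD a 2 p z :=
    UBound.of_bound (fun p _ => continuous_const.mul (h.continuous_relPotD (by norm_num) p))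
      (hb 2 (by norm_num) (by norm_num) 2)
  have h1 : UBound (parSet L M) 1 (fun p _ => scaWt γ 0 0 p) fun p z => p.e ^ 1 * relPotD a 1 p z :=
    UBound.of_deriv (fun p _ z => ((h.hasDerivAt_relPotD (k := 1) (by norm_num) p z).const_mul
      (p.e ^ 1)).congr_deriv (by ring)) (hb 1 le_rfl (by norm_num) 1) h0
  refine UBound.of_deriv (K := 2) (fun p _ z => ?_) (fun p _ z => ?_) h1
  · have := h.hasDerivAt_relPotD (k := 0) (by norm_num) p z
    rw [← relPot_eq] at this
    exact this.congr_deriv (by ring)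
  · have h2 := h.one_lt p.s
    have h3 := h.one_lt (p.s + p.e * z)
    have h4 := h.lt_two (p.s + p.e * z)
    simp only [scaWt, pow_zero, mul_one]
    rw [relPot, abs_of_nonneg (by positivity), div_le_iff₀ (by linarith)]
    linarith

end

/-! ### The size of the error at scaling one -/

section
variable {γ L M : ℝ} {d m : ℕ} {X : Profiles} {a : ℝ → ℝ} {K : ℝ}

theorem Sca.polynomial_l (r₀ r₁ r₂ : ℝ) :
    Sca γ L M d 0 0 fun p _ => r₀ + r₁ * p.l + r₂ * p.l ^ 2 := by
  have hl : Sca γ L M d 0 0 fun p _ => p.l := Sca.l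
  have := ((Sca.const (γ := γ) (L := L) (M := M) (d := d) r₀).add ((Sca.const r₁).mul hl)).add
    ((Sca.const r₂).mul (hl.mul hl))
  exact UBound.congr this fun p _ _ => by ring

theorem sca_coef₁ : Sca γ L M d 0 0 fun p _ => coef₁ m p.l :=
  UBound.congr (Sca.polynomial_l (pExp m) (-(pExp m / lambda0 m)) 0) fun p _ _ => by
    unfold coef₁; ring

theorem sca_coef₂ : Sca γ L M d 0 0 fun p _ => coef₂ m p.l :=
  UBound.congr (Sca.polynomial_l (xi m * (3 * lambda0 m)) (-xi m) 0) fun p _ _ => by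
    unfold coef₂; ring

theorem sca_coef₃ : Sca γ L M d 0 0 fun p _ => coef₃ p.l :=
  UBound.congr (Sca.polynomial_l 0 (ratioQ / 2) (-(ratioQ / 2))) fun p _ _ => by
    unfold coef₃; ring

theorem sca_polyG (G : Fin 3 → ℝ) : Sca γ L M d 0 0 fun p _ => polyG G p.l :=
  UBound.congr (Sca.polynomial_l (G 0) (G 1) (G 2)) fun p _ _ => by unfold polyG; ring

theorem Tail.scaleU (hm : 2 ≤ m) {U : Fin 3 → ℝ → ℝ} {α b : ℝ} (r : ℝ) {q : Fin 3}
    (h : Tail m α b (U q)) : Tail m ((r - q) * α + 1 / 2 * α) ((r - q) * b) (scaleU r U q) :=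
  ((h.const_mul (r - q)).add ((h.id_mul_deriv hm).const_mul (1 / 2))).cast rfl (by ring) |>.congr
    fun x => by unfold GKdV.scaleU; ring

theorem Profiles.Solves.fam_UA (hm : 2 ≤ m) (hX : X.Solves m) :
    Fam γ L M d 0 0 0 0 fun p z => polyU X.UA p.l z :=
  fam_polyU fun q => by
    obtain ⟨_, h⟩ := hX.tailUA q
    exact h.fam_zero hm

theorem Profiles.Solves.fam_scaleUA (hm : 2 ≤ m) (hX : X.Solves m) (r : ℝ) :
    Fam γ L M d 0 0 0 0 fun p z => polyU (scaleU r X.UA) p.l z :=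
  fam_polyU fun q => by
    obtain ⟨_, h⟩ := hX.tailUA q
    exact ((h.scaleU hm r).cast (by ring) rfl).fam_zero hm

theorem fam_polyU_of_tail (hm : 2 ≤ m) (hγ : 0 ≤ γ) {U : Fin 3 → ℝ → ℝ}
    (hU : ∀ q, ∃ α b, Tail m α b (U q)) : Fam γ L M d 0 0 1 0 fun p z => polyU U p.l z :=
  fam_polyU fun q => by
    obtain ⟨_, _, h⟩ := hU q
    exact h.fam hm hγ

theorem fam_secCor (hm : 2 ≤ m) (hX : X.Solves m) (h : PotBound a K γ) :
    Fam γ L M d 0 1 1 0 (secCor X a) := by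
  have hb : Sca γ L M d 0 1 fun p _ => slope a p.s := h.sca_slope
  have h1 := ((hb.mul hb).mul_fam (fam_polyU_of_tail hm h.pos.le hX.tail₁)).mono (i' := 0) (j' := 1)
    (k' := 1) (n' := 0) h.pos.le (by norm_num) (by norm_num) (by norm_num) (by norm_num)
  have h2 := h.sca_bend.mul_fam (fam_polyU_of_tail (d := d) (L := L) (M := M) hm h.pos.le hX.tail₂)
  exact UBound.congr (h1.add h2) fun p _ z => by unfold secCor; ring

theorem fam_scaleSecCor (hm : 2 ≤ m) (hX : X.Solves m) (h : PotBound a K γ) :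
    Fam γ L M d 0 1 1 0 (scaleSecCor m X a) := by
  have hb : Sca γ L M d 0 1 fun p _ => slope a p.s := h.sca_slope
  have hU : ∀ {U : Fin 3 → ℝ → ℝ}, (∀ q, ∃ α b, Tail m α b (U q)) → ∀ r, ∀ q, ∃ α b,
      Tail m α b (scaleU r U q) := fun hU r q => by
    obtain ⟨_, _, h⟩ := hU q
    exact ⟨_, _, h.scaleU hm r⟩
  have h1 := ((hb.mul hb).mul_fam (fam_polyU_of_tail hm h.pos.le
    (hU hX.tail₁ (1 / ((m : ℝ) - 1) - 1)))).mono (i' := 0) (j' := 1)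
    (k' := 1) (n' := 0) h.pos.le (by norm_num) (by norm_num) (by norm_num) (by norm_num)
  have h2 := h.sca_bend.mul_fam (fam_polyU_of_tail (d := d) (L := L) (M := M) hm h.pos.le
    (hU hX.tail₂ (1 / ((m : ℝ) - 1) - 1)))
  exact UBound.congr (h1.add h2) fun p _ z => by unfold scaleSecCor; ring

/-- The correction is `O(e η)` as long as the slow variable is bounded. -/
theorem fam_cor (hm : 2 ≤ m) (hX : X.Solves m) (h : PotBound a K γ) :
    Fam γ L M d 1 1 0 1 (cor m X a) := by
  have hb : Sca γ L M d 0 1 fun p _ => slope a p.s := h.sca_slope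
  have h1 := ((Sca.e.mul hb).mul_fam (hX.fam_UA hm)).mono (i' := 1) (j' := 1)
    (k' := 0) (n' := 1) h.pos.le (by norm_num) (by norm_num) (by norm_num) (by norm_num)
  have h2 : Fam γ L M d 2 1 1 0 fun p z => p.e ^ 2 * secCor X a p z :=
    ((Sca.e_pow 2).mul_fam (fam_secCor hm hX h)).mono h.pos.le (by norm_num) (by norm_num)
      (by norm_num) (by norm_num)
  exact UBound.congr (h1.add (h2.slow.const_mul (delta3 m))) fun p _ z => by unfold cor; ring

theorem Loc.fam_one {f : ℝ → ℝ} (h : Loc f) (hγ : 0 ≤ γ) : Fam γ L M d 0 0 0 1 fun _ => f :=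
  h.fam.mono hγ le_rfl le_rfl le_rfl (by norm_num)

theorem fam_nonlin_two (hX : X.Solves 2) (h : PotBound a K γ) :
    Fam γ L M 2 2 1 0 4 (nonlin₂ 2 X a) := by
  have hγ := h.pos.le
  have hQ := loc_Q (m := 2) le_rfl
  have hv : Fam γ L M 2 1 1 0 1 (cor 2 X a) := fam_cor le_rfl hX h
  have hv0 : Fam γ L M 2 0 0 0 1 (cor 2 X a) := hv.mono hγ (by norm_num) (by norm_num) le_rfl le_rfl
  have hb : Sca γ L M 2 0 1 fun p _ => slope a p.s := h.sca_slope
  have t1 := (h.sca_relPot.mul_fam (hv.mul hv)).mono (i' := 2) (j' := 1) (k' := 0) (n' := 4) hγ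
    (by norm_num) (by norm_num) (by norm_num) (by norm_num)
  have t2 := ((fam_taylor_mul_Q (m := 2) le_rfl h.small h.uBound_rem₁).mul
    ((hQ.fam_one hγ).add (hv0.const_mul 2))).mono (i' := 2) (j' := 1) (k' := 0) (n' := 4) hγ
    (by norm_num) (by norm_num) (by norm_num) (by norm_num)
  have t3 := ((Sca.e.mul hb).mul_fam ((hQ.id_mul.fam (γ := γ)).mul hv)).mono (i' := 2) (j' := 1)
    (k' := 0) (n' := 4) hγ (by norm_num) (by norm_num) (by norm_num) (by norm_num)
  refine UBound.congr ((t1.add t2).add (t3.const_mul 2)) fun p _ z => ?_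
  have hp := Q_pow (m := 2) z le_rfl
  have hp' : potQ 2 z = Q 2 z := mul_right_cancel₀ (Q_pos z).ne' (by rw [← hp]; ring)
  simp only [nonlin₂, rem₁, hp']
  push_cast
  ring

theorem fam_nonlin_four (hX : X.Solves 4) (h : PotBound a K γ) :
    Fam γ L M 2 2 1 0 4 (nonlin₂ 4 X a) := by
  have hγ := h.pos.le
  have hm : 2 ≤ 4 := by norm_num
  have hQ := loc_Q hm
  have hv : Fam γ L M 2 1 1 0 1 (cor 4 X a) := fam_cor hm hX h
  have hv0 : Fam γ L M 2 0 0 0 1 (cor 4 X a) := hv.mono hγ (by norm_num) (by norm_num) le_rfl le_rfl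
  have hb : Sca γ L M 2 0 1 fun p _ => slope a p.s := h.sca_slope
  have hQ1 : Fam γ L M 2 0 0 0 1 fun _ => Q 4 := hQ.fam_one hγ
  have hQ0 : Fam γ L M 2 0 0 0 0 fun _ => Q 4 := hQ.fam
  have hzQ : Fam γ L M 2 0 0 0 0 fun _ z => z * Q 4 z := hQ.id_mul.fam
  have hvv := hv.mul hv
  have t1 := (h.sca_relPot.mul_fam (hvv.mul hvv)).mono (i' := 2) (j' := 1) (k' := 0) (n' := 4) hγ
    (by norm_num) (by norm_num) (by norm_num) (by norm_num)
  have c1 : Fam γ L M 2 0 0 0 3 fun p z => Q 4 z ^ 3 + 4 * (Q 4 z ^ 2 * cor 4 X a p z)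
      + 6 * (Q 4 z * cor 4 X a p z ^ 2) + 4 * cor 4 X a p z ^ 3 :=
    UBound.congr (((((hQ1.mul hQ1).mul hQ1).add (((hQ1.mul hQ1).mul hv0).const_mul 4)).add
      (((hQ1.mul hv0).mul hv0).const_mul 6)).add (((hv0.mul hv0).mul hv0).const_mul 4))
      fun p _ z => by ring
  have t2 := ((fam_taylor_mul_Q (m := 4) hm h.small h.uBound_rem₁).mul c1).mono (i' := 2) (j' := 1)
    (k' := 0) (n' := 4) hγ (by norm_num) (by norm_num) (by norm_num) (by norm_num)
  have c2 : Fam γ L M 2 0 0 0 2 fun p z => 4 * Q 4 z ^ 2 + 6 * (Q 4 z * cor 4 X a p z)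
      + 4 * cor 4 X a p z ^ 2 :=
    UBound.congr ((((hQ1.mul hQ1).const_mul 4).add ((hQ1.mul hv0).const_mul 6)).add
      ((hv0.mul hv0).const_mul 4)) fun p _ z => by ring
  have t3 := ((Sca.e.mul hb).mul_fam (hzQ.mul (hv.mul c2))).mono (i' := 2) (j' := 1)
    (k' := 0) (n' := 4) hγ (by norm_num) (by norm_num) (by norm_num) (by norm_num)
  have t4 := (hQ0.mul (hvv.mul ((hQ1.const_mul 6).add (hv0.const_mul 4)))).mono (i' := 2) (j' := 1)
    (k' := 0) (n' := 4) hγ (by norm_num) (by norm_num) (by norm_num) (by norm_num)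
  refine UBound.congr (((t1.add t2).add t3).add t4) fun p _ z => ?_
  have hp := Q_pow z hm
  have hp' : potQ 4 z = Q 4 z ^ 3 := mul_right_cancel₀ (Q_pos z).ne' (by rw [← hp]; ring)
  simp only [nonlin₂, rem₁, hp']
  push_cast
  ring

theorem fam_nonlin₃ (hX : X.Solves 3) (h : PotBound a K γ) :
    Fam γ L M 2 3 1 1 4 (nonlin₃ X a) := by
  have hγ := h.pos.le
  have hm := two_le_three
  have hQ := loc_Q hm
  have hv : Fam γ L M 2 1 1 0 1 (cor 3 X a) := fam_cor hm hX h
  have hv0 : Fam γ L M 2 0 0 0 1 (cor 3 X a) := hv.mono hγ (by norm_num) (by norm_num) le_rfl le_rfl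
  have hD : Fam γ L M 2 0 1 1 0 (secCor X a) := fam_secCor hm hX h
  have hA : Fam γ L M 2 0 0 0 0 fun p z => polyU X.UA p.l z := hX.fam_UA hm
  have hb : Sca γ L M 2 0 1 fun p _ => slope a p.s := h.sca_slope
  have hβ : Sca γ L M 2 0 1 fun p _ => bend a p.s := h.sca_bend
  have he2 : Sca γ L M 2 2 0 fun p _ => p.e ^ 2 := Sca.e_pow 2
  have he3 : Sca γ L M 2 3 0 fun p _ => p.e ^ 3 := Sca.e_pow 3
  have hQ1 : Fam γ L M 2 0 0 0 1 fun _ => Q 3 := hQ.fam_one hγ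
  have hQ0 : Fam γ L M 2 0 0 0 0 fun _ => Q 3 := hQ.fam
  have hzQ : Fam γ L M 2 0 0 0 0 fun _ z => z * Q 3 z := hQ.id_mul.fam
  have hzzQ : Fam γ L M 2 0 0 0 0 fun _ z => z * (z * Q 3 z) := hQ.id_mul.id_mul.fam
  have hvv := hv.mul hv
  have t1 := (h.sca_relPot.mul_fam (hvv.mul hv)).mono (i' := 3) (j' := 1) (k' := 1) (n' := 4) hγ
    (by norm_num) (by norm_num) (by norm_num) (by norm_num)
  have c1 := ((hQ1.mul hQ1).add ((hQ1.mul hv0).const_mul 3)).add ((hv0.mul hv0).const_mul 3)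
  have t2 := ((fam_taylor_mul_Q (m := 3) hm h.small h.uBound_rem₂).mul c1).mono (i' := 3) (j' := 1)
    (k' := 1) (n' := 4) hγ (by norm_num) (by norm_num) (by norm_num) (by norm_num)
  have t3 := ((he3.mul hb).mul_fam ((hzQ.mul hQ0).mul hD)).mono (i' := 3) (j' := 1)
    (k' := 1) (n' := 4) hγ (by norm_num) (by norm_num) (by norm_num) (by norm_num)
  have t4 := ((Sca.e.mul hb).mul_fam (hzQ.mul hvv)).mono (i' := 3) (j' := 1)
    (k' := 1) (n' := 4) hγ (by norm_num) (by norm_num) (by norm_num) (by norm_num)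
  have t5 := ((he2.mul hβ).mul_fam (hzzQ.mul (hv.mul (hQ1.add hv0)))).mono (i' := 3) (j' := 1)
    (k' := 1) (n' := 4) hγ (by norm_num) (by norm_num) (by norm_num) (by norm_num)
  have t6 := ((he3.mul hb).mul_fam (hQ0.mul (hA.mul hD))).mono (i' := 3) (j' := 1)
    (k' := 1) (n' := 4) hγ (by norm_num) (by norm_num) (by norm_num) (by norm_num)
  have t7 := ((he2.mul he2).mul_fam (hQ0.mul (hD.mul hD))) |>.slow.mono (i' := 3) (j' := 1)
    (k' := 1) (n' := 4) hγ (by norm_num) (by norm_num) (by norm_num) (by norm_num)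
  refine UBound.congr ((((((t1.add t2).add (t3.const_mul 3)).add (t4.const_mul 3)).add
    (t5.const_mul (3 / 2))).add (t6.const_mul 6)).add (t7.const_mul 3)) fun p _ z => ?_
  have hcor : cor 3 X a p z = p.e * slope a p.s * polyU X.UA p.l z + p.e ^ 2 * secCor X a p z := by
    simp [cor, delta3]
  simp only [nonlin₃, nonlin₂, rem₂, rem₁, potQ_three, hcor]
  push_cast
  ring

theorem fam_err_of_ne_three (hm : m = 2 ∨ m = 4) (hX : X.Solves m) (h : PotBound a K γ) :
    Fam γ L M 1 2 1 0 4 (err m X a) := by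
  have hγ := h.pos.le
  have hm2 : 2 ≤ m := by omega
  have hN : Fam γ L M 2 2 1 0 4 (nonlin₂ m X a) := by
    rcases hm with rfl | rfl
    · exact fam_nonlin_two hX h
    · exact fam_nonlin_four hX h
  have hA : Fam γ L M 2 0 0 0 0 fun p z => polyU X.UA p.l z := hX.fam_UA hm2
  have hA1 : Fam γ L M 1 0 0 0 0 fun p z => polyU X.UA p.l z := hX.fam_UA hm2
  have hb : Sca γ L M 1 0 1 fun p _ => slope a p.s := h.sca_slope
  have hd : Sca γ L M 1 0 1 fun p _ => dSlope m a p.s := h.sca_dSlope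
  have he2 : Sca γ L M 1 2 0 fun p _ => p.e ^ 2 := Sca.e_pow 2
  have he3 : Sca γ L M 1 3 0 fun p _ => p.e ^ 3 := Sca.e_pow 3
  have h1l : Sca γ L M 1 0 0 fun p _ => 1 - p.l := (Sca.const 1).sub Sca.l
  have h2 := (he2.mul (hb.mul hb)).mul (sca_coef₂ (m := m))
  have t1 := (((he2.mul (hb.mul hb)).mul (sca_coef₁ (m := m))).mul_fam
    (hX.fam_scaleUA hm2 (1 / ((m : ℝ) - 1) - 1 / 2))).mono (i' := 2) (j' := 1)
    (k' := 0) (n' := 4) hγ (by norm_num) (by norm_num) (by norm_num) (by norm_num)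
  have t2 := (h2.mul_fam hA.deriv).mono (i' := 2) (j' := 1)
    (k' := 0) (n' := 4) hγ (by norm_num) (by norm_num) (by norm_num) (by norm_num)
  have t3 := (h2.mul_fam ((loc_Q hm2).fam.const_mul (1 / ((m : ℝ) - 1)))).mono (i' := 2) (j' := 1)
    (k' := 0) (n' := 4) hγ (by norm_num) (by norm_num) (by norm_num) (by norm_num)
  have t4 := ((((he3.mul hb).mul (sca_coef₂ (m := m))).mul hd).mul_fam hA1).mono (i' := 2) (j' := 1)
    (k' := 0) (n' := 4) hγ (by norm_num) (by norm_num) (by norm_num) (by norm_num)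
  have t5 := (((he2.mul h1l).mul hd).mul_fam hA1).mono (i' := 2) (j' := 1)
    (k' := 0) (n' := 4) hγ (by norm_num) (by norm_num) (by norm_num) (by norm_num)
  refine UBound.congr (((((t1.sub t2).sub t3).add t4).add t5).add hN.deriv) fun p _ z => ?_
  rw [err_eq_of_ne_three hm2 (by omega) hX (h.contDiff.differentiable (by simp))]
  ring

theorem fam_err_of_three (hX : X.Solves 3) (h : PotBound a K γ) :
    Fam γ L M 1 3 1 1 4 (err 3 X a) := by
  have hγ := h.pos.le
  have hm2 := two_le_three
  have hN : Fam γ L M 2 3 1 1 4 (nonlin₃ X a) := fam_nonlin₃ hX h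
  have hA : Fam γ L M 2 0 0 0 0 fun p z => polyU X.UA p.l z := hX.fam_UA hm2
  have hA1 : Fam γ L M 1 0 0 0 0 fun p z => polyU X.UA p.l z := hX.fam_UA hm2
  have hD : Fam γ L M 2 0 1 1 0 (secCor X a) := fam_secCor hm2 hX h
  have hsD : Fam γ L M 1 0 1 1 0 (scaleSecCor 3 X a) := fam_scaleSecCor hm2 hX h
  have hb : Sca γ L M 1 0 1 fun p _ => slope a p.s := h.sca_slope
  have hβ : Sca γ L M 1 0 1 fun p _ => bend a p.s := h.sca_bend
  have hd : Sca γ L M 1 0 1 fun p _ => dSlope 3 a p.s := h.sca_dSlope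
  have he : Sca γ L M 1 1 0 fun p _ => p.e := Sca.e
  have he3 : Sca γ L M 1 3 0 fun p _ => p.e ^ 3 := Sca.e_pow 3
  have he4 : Sca γ L M 1 4 0 fun p _ => p.e ^ 4 := Sca.e_pow 4
  have hG : Sca γ L M 1 0 1 fun p _ => slope a p.s * slope a p.s * polyG X.G₁ p.l
      + bend a p.s * polyG X.G₂ p.l :=
    (((hb.mul hb).mul (sca_polyG X.G₁)).mono hγ (by norm_num) (by norm_num)).add
      (hβ.mul (sca_polyG X.G₂))
  have t1 := (((he3.mul hb).mul (sca_coef₁ (m := 3))).mul_fam hsD).mono (i' := 3) (j' := 1)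
    (k' := 1) (n' := 4) hγ (by norm_num) (by norm_num) (by norm_num) (by norm_num)
  have t2 := (((he3.mul (hb.mul (hb.mul hb))).mul sca_coef₃).mul_fam
    (hX.fam_scaleUA hm2 (1 / 2 - 1 / 2))).mono (i' := 3) (j' := 1)
    (k' := 1) (n' := 4) hγ (by norm_num) (by norm_num) (by norm_num) (by norm_num)
  have t3 := (((he4.mul (hb.mul hb)).mul sca_coef₃).mul_fam hsD).mono (i' := 3) (j' := 1)
    (k' := 1) (n' := 4) hγ (by norm_num) (by norm_num) (by norm_num) (by norm_num)
  have c4 := ((hb.mul_fam hA.deriv).mono (i' := 0) (j' := 1)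
    (k' := 1) (n' := 0) hγ (by norm_num) (by norm_num) (by norm_num) (by norm_num)).add
    ((he.mul_fam hD.deriv).mono (i' := 0) (j' := 1)
    (k' := 1) (n' := 0) hγ (by norm_num) (by norm_num) (by norm_num) (by norm_num))
  have t4 := ((he3.mul hG).mul_fam c4).mono (i' := 3) (j' := 1)
    (k' := 1) (n' := 4) hγ (by norm_num) (by norm_num) (by norm_num) (by norm_num)
  have c5 := ((hb.mul_fam ((loc_Q hm2).fam.const_mul (1 / 2))).mono (i' := 0) (j' := 1)
    (k' := 0) (n' := 0) hγ (by norm_num) (by norm_num) (by norm_num) (by norm_num)).sub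
    (((he.mul hd).mul_fam hA1).mono (i' := 0) (j' := 1)
    (k' := 0) (n' := 0) hγ (by norm_num) (by norm_num) (by norm_num) (by norm_num))
  have t5 := ((he3.mul hG).mul_fam c5).mono (i' := 3) (j' := 1)
    (k' := 1) (n' := 4) hγ (by norm_num) (by norm_num) (by norm_num) (by norm_num)
  have c6 := ((h.sca_dCoef₁ (m := 3)).mul_fam (fam_polyU_of_tail (d := 1) (L := L) (M := M) hm2 hγ hX.tail₁)).add
    ((h.sca_dCoef₂ (m := 3)).mul_fam (fam_polyU_of_tail hm2 hγ hX.tail₂))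
  have t6 := ((he3.mul Sca.r).mul_fam c6).mono (i' := 3) (j' := 1)
    (k' := 1) (n' := 4) hγ (by norm_num) (by norm_num) (by norm_num) (by norm_num)
  refine UBound.congr ((((((t1.add t2).add t3).sub t4).sub t5).add t6).add hN.deriv) fun p _ z => ?_
  rw [err_eq_of_three hX (h.contDiff.differentiable (by simp))]
  ring

end

/-! ### The reduced dynamics -/

theorem eq_of_hasDerivWithinAt_zero {f : ℝ → ℝ} {t₀ : ℝ}
    (h : ∀ t ∈ Ici t₀, HasDerivWithinAt f 0 (Ici t₀) t) {t : ℝ} (ht : t₀ ≤ t) : f t = f t₀ :=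
  constant_of_has_deriv_right_zero (a := t₀) (b := t)
    (fun s hs => ((h s hs.1).mono Icc_subset_Ici_self).continuousWithinAt)
    (fun s hs => (h s hs.1).mono (Ici_subset_Ici.2 hs.1)) t ⟨ht, le_rfl⟩

/-- A solution of a linear equation `y' = g y` never changes sign. -/
theorem exists_pos_mul_of_linear_ode {y g : ℝ → ℝ} {t₀ : ℝ} (hg : ContinuousOn g (Ici t₀))
    (hy : ∀ t ∈ Ici t₀, HasDerivWithinAt y (g t * y t) (Ici t₀) t) {t : ℝ} (ht : t₀ ≤ t) :
    ∃ k > 0, y t = k * y t₀ := by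
  set g' : ℝ → ℝ := fun s => g (max s t₀) with hg'
  have hc : Continuous g' := hg.comp_continuous (by fun_prop) fun s => le_max_right s t₀
  have hG : ∀ s, HasDerivAt (fun s => ∫ u in t₀..s, g' u) (g' s) s := fun s =>
    (hc.integral_hasStrictDerivAt t₀ s).hasDerivAt
  have h0 : ∀ s ∈ Ici t₀,
      HasDerivWithinAt (fun s => y s * Real.exp (-∫ u in t₀..s, g' u)) 0 (Ici t₀) s := fun s hs => by
    refine ((hy s hs).mul (hG s).neg.exp.hasDerivWithinAt).congr_deriv ?_
    have : g' s = g s := by simp only [hg']; rw [max_eq_left hs]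
    rw [this]
    ring
  have h1 := eq_of_hasDerivWithinAt_zero h0 ht
  simp only [intervalIntegral.integral_same, neg_zero, Real.exp_zero, mul_one] at h1
  refine ⟨Real.exp (∫ u in t₀..t, g' u), Real.exp_pos _, ?_⟩
  rw [← h1, mul_comm, mul_assoc, ← Real.exp_add]
  simp

section
variable {m : ℕ} {lam ε : ℝ} {a C P : ℝ → ℝ}

theorem lambda0_pos (hm : m = 2 ∨ m = 3 ∨ m = 4) : 0 < lambda0 m := by
  rcases hm with rfl | rfl | rfl <;> norm_num [lambda0]

theorem lambda0_lt_one (hm : m = 2 ∨ m = 3 ∨ m = 4) : lambda0 m < 1 := by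
  rcases hm with rfl | rfl | rfl <;> norm_num [lambda0]

theorem pExp_pos : 0 < pExp m := by unfold pExp; positivity

theorem pExp_le_one (hm : 2 ≤ m) : pExp m ≤ 1 := by
  have : (2 : ℝ) ≤ m := by exact_mod_cast hm
  unfold pExp
  rw [div_le_one (by positivity)]
  linarith

theorem muDecay_pos (hm : m = 2 ∨ m = 3 ∨ m = 4) : 0 < muDecay m lam := by
  have h0 := lambda0_pos hm
  unfold muDecay
  split_ifs with h
  · have h1 : lambda0 m / lam < 1 := (div_lt_one (h0.trans h)).2 h
    have := Real.rpow_pos_of_pos (sub_pos.2 h1) ((1 - lambda0 m) / lambda0 m)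
    positivity
  · norm_num

theorem muDecay_le_one (hm : m = 2 ∨ m = 3 ∨ m = 4) : muDecay m lam ≤ 1 := by
  have h0 := lambda0_pos hm
  have h2 := lambda0_lt_one hm
  unfold muDecay
  split_ifs with h
  · have h1 : lambda0 m / lam < 1 := (div_lt_one (h0.trans h)).2 h
    have h3 : 0 < lambda0 m / lam := div_pos h0 (h0.trans h)
    have := Real.rpow_le_one (sub_pos.2 h1).le (by linarith)
      (div_nonneg (sub_pos.2 h2).le h0.le : 0 ≤ (1 - lambda0 m) / lambda0 m)
    linarith
  · norm_num

theorem IsDynSol.hasDerivWithinAt_log_pot (h : IsDynSol m lam a ε C P) (ha : IsPotential m a)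
    {t : ℝ} (ht : t ∈ Ici (-Teps lam ε)) :
    HasDerivWithinAt (fun t => Real.log (a (ε * P t)))
      (ε * (C t - lam) * (deriv a (ε * P t) / a (ε * P t))) (Ici (-Teps lam ε)) t := by
  have h1 := (ha.contDiff.differentiable (by simp) (ε * P t)).hasDerivAt
  refine ((h1.comp_hasDerivWithinAt t ((h.derivP t ht).const_mul ε)).log
    (by have := ha.one_lt (ε * P t); simp only [Function.comp_apply]; linarith)).congr_deriv ?_
  simp only [Function.comp_apply]
  ring

theorem IsDynSol.continuousOn_slope (h : IsDynSol m lam a ε C P) (ha : IsPotential m a) :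
    ContinuousOn (fun t => deriv a (ε * P t) / a (ε * P t)) (Ici (-Teps lam ε)) := by
  have hP : ContinuousOn P (Ici (-Teps lam ε)) := fun t ht => (h.derivP t ht).continuousWithinAt
  have h1 : Continuous (deriv a) := ha.contDiff.continuous_deriv (by norm_num)
  have h2 : Continuous a := ha.contDiff.continuous
  refine (h1.comp_continuousOn (continuousOn_const.mul hP)).div
    (h2.comp_continuousOn (continuousOn_const.mul hP)) fun t _ => ?_
  have := ha.one_lt (ε * P t)
  linarith

theorem IsPotential.slope_nonneg (ha : IsPotential m a) (s : ℝ) : 0 ≤ deriv a s / a s :=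
  div_nonneg (ha.deriv_pos s).le (by have := ha.one_lt s; linarith)

theorem IsDynSol.C_pos (h : IsDynSol m lam a ε C P) (ha : IsPotential m a) {t : ℝ}
    (ht : -Teps lam ε ≤ t) : 0 < C t := by
  have hC : ContinuousOn C (Ici (-Teps lam ε)) := fun t ht => (h.derivC t ht).continuousWithinAt
  obtain ⟨k, hk, hkt⟩ := exists_pos_mul_of_linear_ode (y := C)
    (g := fun t => ε * (pExp m * (C t - lam / lambda0 m) * (deriv a (ε * P t) / a (ε * P t))))
    (continuousOn_const.mul ((continuousOn_const.mul (hC.sub continuousOn_const)).mul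
      (h.continuousOn_slope ha)))
    (fun t ht => (h.derivC t ht).congr_deriv (by unfold f1; ring)) ht
  rw [hkt, h.initC]
  linarith

theorem IsDynSol.exists_sub_eq (h : IsDynSol m lam a ε C P) (ha : IsPotential m a) {t : ℝ}
    (ht : -Teps lam ε ≤ t) : ∃ k > 0, C t - lam / lambda0 m = k * (1 - lam / lambda0 m) := by
  have hC : ContinuousOn C (Ici (-Teps lam ε)) := fun t ht => (h.derivC t ht).continuousWithinAt
  obtain ⟨k, hk, hkt⟩ := exists_pos_mul_of_linear_ode (y := fun t => C t - lam / lambda0 m)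
    (g := fun t => ε * (pExp m * C t * (deriv a (ε * P t) / a (ε * P t))))
    (continuousOn_const.mul ((continuousOn_const.mul hC).mul
      (h.continuousOn_slope ha)))
    (fun t ht => ((h.derivC t ht).sub_const _).congr_deriv (by unfold f1; ring)) ht
  exact ⟨k, hk, by rw [hkt, h.initC]⟩

theorem monotoneOn_of_hasDerivWithinAt {f f' : ℝ → ℝ} {t₀ : ℝ}
    (h : ∀ t ∈ Ici t₀, HasDerivWithinAt f (f' t) (Ici t₀) t) (h0 : ∀ t ∈ Ici t₀, 0 ≤ f' t) :
    MonotoneOn f (Ici t₀) :=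
  monotoneOn_of_deriv_nonneg (convex_Ici t₀) (fun t ht => (h t ht).continuousWithinAt)
    (fun t ht => ((h t (interior_subset ht)).differentiableWithinAt).mono interior_subset)
    fun t ht => by
      rw [interior_Ici] at ht
      rw [((h t (mem_Ici.2 (le_of_lt ht))).hasDerivAt (Ici_mem_nhds ht)).deriv]
      exact h0 t (mem_Ici.2 (le_of_lt ht))

theorem IsDynSol.one_le_C (h : IsDynSol m lam a ε C P) (ha : IsPotential m a) (hε : 0 < ε)
    (hm : m = 2 ∨ m = 3 ∨ m = 4) (hlam : lam ≤ lambda0 m) {t : ℝ} (ht : -Teps lam ε ≤ t) :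
    1 ≤ C t := by
  have hmon : MonotoneOn C (Ici (-Teps lam ε)) := monotoneOn_of_hasDerivWithinAt h.derivC fun s hs => by
    obtain ⟨k, hk, hks⟩ := h.exists_sub_eq ha hs
    have h1 : lam / lambda0 m ≤ 1 := (div_le_one (lambda0_pos hm)).2 hlam
    have h2 : 0 ≤ C s - lam / lambda0 m := by
      rw [hks]; exact mul_nonneg hk.le (by linarith)
    have h3 := h.C_pos ha hs
    have h4 := IsPotential.slope_nonneg ha (ε * P s)
    have h5 := pExp_pos (m := m)
    unfold f1
    positivity
  have := hmon (mem_Ici.2 le_rfl) (mem_Ici.2 ht) ht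
  rwa [h.initC] at this

theorem IsDynSol.C_le_two (h : IsDynSol m lam a ε C P) (ha : IsPotential m a) (hε : 0 < ε)
    (hm : m = 2 ∨ m = 3 ∨ m = 4) (hlam0 : 0 ≤ lam) {t : ℝ}
    (ht : -Teps lam ε ≤ t) : C t ≤ 2 := by
  have hmon : MonotoneOn (fun t => pExp m * Real.log (a (ε * P t)) - Real.log (C t))
      (Ici (-Teps lam ε)) := by
    refine monotoneOn_of_hasDerivWithinAt (fun s hs => ((h.hasDerivWithinAt_log_pot ha hs).const_mul
      (pExp m)).fun_sub ((h.derivC s hs).log (h.C_pos ha hs).ne')) fun s hs => ?_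
    have h3 := h.C_pos ha hs
    have h4 := IsPotential.slope_nonneg ha (ε * P s)
    have h5 := pExp_pos (m := m)
    have h6 : lam ≤ lam / lambda0 m := by
      rw [le_div_iff₀ (lambda0_pos hm)]
      nlinarith [lambda0_lt_one hm]
    have h7 : pExp m * (ε * (C s - lam) * (deriv a (ε * P s) / a (ε * P s)))
        - ε * f1 m lam a ε (C s) (P s) / C s
        = pExp m * ε * (deriv a (ε * P s) / a (ε * P s)) * (lam / lambda0 m - lam) := by
      unfold f1
      field_simp
      ring
    rw [h7]
    have := sub_nonneg.2 h6
    positivity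
  have h1 := hmon (mem_Ici.2 le_rfl) (mem_Ici.2 ht) ht
  simp only [h.initC, Real.log_one, sub_zero] at h1
  have hp := pExp_pos (m := m)
  have hp1 := pExp_le_one (m := m) (by omega)
  have h2 := Real.log_pos (ha.one_lt (ε * P (-Teps lam ε)))
  have h3 : Real.log (a (ε * P t)) ≤ Real.log 2 :=
    Real.log_le_log (by linarith [ha.one_lt (ε * P t)]) (ha.lt_two _).le
  have h4 : 0 ≤ Real.log (a (ε * P t)) := (Real.log_pos (ha.one_lt _)).le
  have h5 : Real.log (C t) ≤ Real.log 2 := by nlinarith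
  exact (Real.log_le_log_iff (h.C_pos ha ht) two_pos).1 h5

/-- For `λ > λ₀` the quantity `C ^ λ₀ (λ / λ₀ - C) ^ (1 - λ₀) a(εP) ^ (-p)` is conserved. -/
theorem IsDynSol.conserved (h : IsDynSol m lam a ε C P) (ha : IsPotential m a)
    (hm : m = 2 ∨ m = 3 ∨ m = 4) (hlam : lambda0 m < lam) {t : ℝ} (ht : -Teps lam ε ≤ t) :
    0 < lam / lambda0 m - C t ∧
    lambda0 m * Real.log (C t) + (1 - lambda0 m) * Real.log (lam / lambda0 m - C t)
        - pExp m * Real.log (a (ε * P t))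
      = (1 - lambda0 m) * Real.log (lam / lambda0 m - 1)
        - pExp m * Real.log (a (ε * P (-Teps lam ε))) := by
  have hl := lambda0_pos hm
  have hpos : ∀ s ∈ Ici (-Teps lam ε), 0 < lam / lambda0 m - C s := fun s hs => by
    obtain ⟨k, hk, hks⟩ := h.exists_sub_eq ha hs
    have h1 : 1 < lam / lambda0 m := (one_lt_div hl).2 hlam
    nlinarith
  refine ⟨hpos t ht, ?_⟩
  have h0 := eq_of_hasDerivWithinAt_zero (t₀ := -Teps lam ε)
    (f := fun t => lambda0 m * Real.log (C t) + (1 - lambda0 m) * Real.log (lam / lambda0 m - C t)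
      - pExp m * Real.log (a (ε * P t))) (fun s hs => by
      refine ((((h.derivC s hs).log (h.C_pos ha hs).ne').const_mul (lambda0 m)).fun_add
        ((((h.derivC s hs).const_sub (lam / lambda0 m)).log (hpos s hs).ne').const_mul
          (1 - lambda0 m))).fun_sub ((h.hasDerivWithinAt_log_pot ha hs).const_mul
            (pExp m)) |>.congr_deriv ?_
      have h1 := (h.C_pos ha hs).ne'
      have h2 := (hpos s hs).ne'
      have h3 : C s - lam / lambda0 m = -(lam / lambda0 m - C s) := by ring
      have h4 : C s - lam = (1 - lambda0 m) * C s - lambda0 m * (lam / lambda0 m - C s) := by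
        field_simp
        ring
      unfold f1
      rw [h3, h4]
      generalize deriv a (ε * P s) / a (ε * P s) = b
      generalize lam / lambda0 m - C s = D at h2
      field_simp
      ring) ht
  rw [h0, h.initC]
  simp

theorem IsDynSol.le_C (h : IsDynSol m lam a ε C P) (ha : IsPotential m a)
    (hm : m = 2 ∨ m = 3 ∨ m = 4) (hlam : lambda0 m < lam)
    (ha0 : a (ε * P (-Teps lam ε)) ≤ 17 / 16) {t : ℝ} (ht : -Teps lam ε ≤ t) :
    3 / 4 * (1 - lambda0 m / lam) ^ ((1 - lambda0 m) / lambda0 m) ≤ C t := by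
  obtain ⟨hpos, hcons⟩ := h.conserved ha hm hlam ht
  have hl := lambda0_pos hm
  have hl1 := lambda0_lt_one hm
  have hlp := hl.trans hlam
  have hC := h.C_pos ha ht
  have h1 : 0 < 1 - lambda0 m / lam := sub_pos.2 ((div_lt_one hlp).2 hlam)
  have h2 : Real.log (lam / lambda0 m - C t) ≤ Real.log (lam / lambda0 m) :=
    Real.log_le_log hpos (by linarith)
  have h3 : Real.log (lam / lambda0 m - 1) = Real.log (lam / lambda0 m) + Real.log (1 - lambda0 m / lam) := by
    rw [← Real.log_mul (div_pos hlp hl).ne' h1.ne']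
    congr 1
    field_simp
  have h4 : 0 ≤ Real.log (a (ε * P t)) := (Real.log_pos (ha.one_lt _)).le
  have h5 : Real.log (a (ε * P (-Teps lam ε))) ≤ Real.log (17 / 16) :=
    Real.log_le_log (by linarith [ha.one_lt (ε * P (-Teps lam ε))]) ha0
  have h6 := pExp_pos (m := m)
  have h7 : pExp m ≤ 4 * lambda0 m := by
    rcases hm with rfl | rfl | rfl <;> norm_num [lambda0, pExp]
  have h8 : 0 ≤ Real.log (17 / 16) := Real.log_nonneg (by norm_num)
  have h9 : (1 - lambda0 m) * Real.log (1 - lambda0 m / lam) - 4 * lambda0 m * Real.log (17 / 16)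
      ≤ lambda0 m * Real.log (C t) := by
    have e1 := mul_le_mul_of_nonneg_left h2 (sub_pos.2 hl1).le
    have e2 := mul_le_mul_of_nonneg_left h5 h6.le
    have e3 := mul_le_mul_of_nonneg_right h7 h8
    have e4 := mul_nonneg h6.le h4
    rw [h3] at hcons
    linarith
  have h10 : (1 - lambda0 m) / lambda0 m * Real.log (1 - lambda0 m / lam) + Real.log (3 / 4)
      ≤ Real.log (C t) := by
    have e1 : Real.log (3 / 4) ≤ -(4 * Real.log (17 / 16)) := by
      rw [← Real.log_rpow (by norm_num), ← Real.log_inv]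
      exact Real.log_le_log (by norm_num) (by norm_num)
    have e2 : (1 - lambda0 m) / lambda0 m * Real.log (1 - lambda0 m / lam) - 4 * Real.log (17 / 16)
        ≤ Real.log (C t) := by
      rw [← sub_nonneg] at h9 ⊢
      have := div_nonneg h9 hl.le
      refine this.trans_eq ?_
      field_simp
    linarith
  rw [← Real.log_rpow h1, ← Real.log_mul (Real.rpow_pos_of_pos h1 _).ne' (by norm_num)] at h10
  have := (Real.log_le_log_iff (mul_pos (Real.rpow_pos_of_pos h1 _) (by norm_num)) hC).1 h10
  linarith

theorem rpow_le_of_le_pow {ε δ : ℝ} (hε : 0 < ε) (hδ : 0 < δ) (h : ε ≤ δ ^ 100) :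
    ε ^ (1 / 100 : ℝ) ≤ δ := by
  refine (Real.rpow_le_rpow hε.le h (by norm_num)).trans_eq ?_
  rw [← Real.rpow_natCast, ← Real.rpow_mul hδ.le]
  norm_num

theorem IsPotential.exists_le (ha : IsPotential m a) : ∃ r₀ > 0, ∀ r ≤ -r₀, a r ≤ 17 / 16 := by
  obtain ⟨K, -, γ, hγ, -, h, -⟩ := ha.decay
  have h1 : Tendsto (fun r => 1 + K * Real.exp (γ * r)) atBot (𝓝 (1 + K * 0)) :=
    ((Real.tendsto_exp_atBot.comp (tendsto_id.const_mul_atBot hγ)).const_mul K).const_add 1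
  obtain ⟨r₁, hr₁⟩ := eventually_atBot.1 (h1.eventually_lt_const (u := 17 / 16) (by norm_num))
  refine ⟨|r₁| + 1, by positivity, fun r hr => ?_⟩
  have h2 := hr₁ r (by linarith [neg_abs_le r₁])
  have h3 := h r (by linarith [abs_nonneg r₁])
  linarith

theorem eps_mul_initP {lam ε : ℝ} (hlam : lam < 1) (hε : 0 < ε) :
    ε * -((1 - lam) * Teps lam ε) = -(ε ^ (1 / 100 : ℝ))⁻¹ := by
  have : (1 - lam) ≠ 0 := by linarith
  rw [Teps, mul_div_cancel₀ _ this, ← Real.rpow_neg hε.le, show (-1 - 1 / 100 : ℝ) = -1 + -(1 / 100) by ring,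
    Real.rpow_add hε, Real.rpow_neg_one]
  field_simp

/-- For small `ε` every scaling close to the trajectory is bounded and bounded below by `μ / 2`,
and the velocity is bounded. -/
theorem exists_scaling_bounds (hm : m = 2 ∨ m = 3 ∨ m = 4) (hlam0 : 0 ≤ lam) (hlam1 : lam < 1)
    (ha : IsPotential m a) : ∃ ε₀ > 0, ∃ M > 0, ∀ ε, 0 < ε → ε < ε₀ → ∀ C P,
      IsDynSol m lam a ε C P → ∀ t ∈ Ici (-Teps lam ε), ∀ c r,
      |c - C t| + |r - derivWithin P (Ici (-Teps lam ε)) t| ≤ ε ^ (1 / 100 : ℝ) →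
      muDecay m lam / 2 ≤ c ∧ c ≤ M ∧ |r| ≤ M := by
  obtain ⟨r₀, hr₀, hr⟩ := ha.exists_le
  have hl := lambda0_pos hm
  have hμ := muDecay_pos (lam := lam) hm
  have hμ1 := muDecay_le_one (lam := lam) hm
  set δ := min (muDecay m lam / 4) r₀⁻¹ with hδ
  have hδ0 : 0 < δ := by positivity
  refine ⟨δ ^ 100, by positivity, max 2 (lam / lambda0 m) + 3, by positivity, ?_⟩
  intro ε hε hε1 C P h t ht c r hcr
  have h1 := rpow_le_of_le_pow hε hδ0 hε1.le
  have hd1 : δ ≤ muDecay m lam / 4 := min_le_left _ _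
  have hd2 : δ ≤ r₀⁻¹ := min_le_right _ _
  have hP : derivWithin P (Ici (-Teps lam ε)) t = C t - lam :=
    (h.derivP t ht).derivWithin (uniqueDiffOn_Ici _ t ht)
  have hC : 3 / 4 * muDecay m lam ≤ C t ∧ C t ≤ max 2 (lam / lambda0 m) := by
    by_cases hlam : lambda0 m < lam
    · have ha0 : a (ε * P (-Teps lam ε)) ≤ 17 / 16 := by
        rw [h.initP, eps_mul_initP hlam1 hε]
        refine hr _ (neg_le_neg ?_)
        rw [le_inv_comm₀ hr₀ (Real.rpow_pos_of_pos hε _)]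
        exact h1.trans hd2
      refine ⟨?_, le_max_of_le_right (by linarith [(h.conserved ha hm hlam ht).1])⟩
      refine le_trans ?_ (h.le_C ha hm hlam ha0 ht)
      rw [muDecay, if_pos hlam]
      have := Real.rpow_nonneg (sub_nonneg.2 ((div_le_one (hl.trans hlam)).2 hlam.le))
        ((1 - lambda0 m) / lambda0 m)
      linarith
    · push Not at hlam
      have := h.one_le_C ha hε hm hlam ht
      exact ⟨by linarith, le_max_of_le_left (h.C_le_two ha hε hm hlam0 ht)⟩
  have hCp := h.C_pos ha ht
  rw [hP] at hcr
  have h2 := abs_nonneg (c - C t)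
  have h3 := abs_nonneg (r - (C t - lam))
  have h4 := abs_le.1 (show |c - C t| ≤ muDecay m lam / 4 by linarith)
  have h5 := abs_le.1 (show |r - (C t - lam)| ≤ 1 by linarith)
  exact ⟨by linarith, by linarith, abs_le.2 ⟨by linarith, by linarith⟩⟩

end

/-! ### Scaling -/

/-- The scaled profile `c ^ r ∑ (λ / c) ^ k U_k(√c y)`. -/
noncomputable def prof (U : Fin 3 → ℝ → ℝ) (r lam c y : ℝ) : ℝ :=
  c ^ r * polyU U (lam / c) (Real.sqrt c * y)

/-- The first corrector `A_c`. -/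
noncomputable def corA (m : ℕ) (X : Profiles) (lam c y : ℝ) : ℝ :=
  prof X.UA (1 / ((m : ℝ) - 1) - 1 / 2) lam c y

/-- The second corrector `B_{c,s}`. -/
noncomputable def corB (m : ℕ) (X : Profiles) (a : ℝ → ℝ) (lam c s y : ℝ) : ℝ :=
  (slope a s ^ 2 * prof X.U₁ (1 / ((m : ℝ) - 1) - 1) lam c y
    + bend a s * prof X.U₂ (1 / ((m : ℝ) - 1) - 1) lam c y) / aTilde m a s

/-- The parameters at `c = 1` that correspond to scaling `c`, position `ρ` and velocity `v`. -/
noncomputable def par (lam ε c ρ v : ℝ) : Par := ⟨ε / Real.sqrt c, lam / c, ε * ρ, v / c⟩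

section
variable {m : ℕ} {X : Profiles} {a : ℝ → ℝ} {lam ε : ℝ}

theorem deriv_polyU {U : Fin 3 → ℝ → ℝ} (hU : ∀ k, Differentiable ℝ (U k)) (l z : ℝ) :
    deriv (polyU U l) z = deriv (U 0) z + l * deriv (U 1) z + l ^ 2 * deriv (U 2) z := by
  rw [funext (polyU_eq U l)]
  exact (((hU 0 z).hasDerivAt.fun_add ((hU 1 z).hasDerivAt.const_mul l)).fun_add
    ((hU 2 z).hasDerivAt.const_mul (l ^ 2))).deriv

theorem hasDerivAt_prof {U : Fin 3 → ℝ → ℝ} (hU : ∀ k, Differentiable ℝ (U k)) (r lam : ℝ)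
    {c y : ℝ → ℝ} {c' y' t : ℝ} (hc : HasDerivAt c c' t) (hy : HasDerivAt y y' t) (h0 : 0 < c t) :
    HasDerivAt (fun τ => prof U r lam (c τ) (y τ))
      (c' * prof (scaleU r U) (r - 1) lam (c t) (y t)
        + y' * (c t ^ (r + 1 / 2) * deriv (polyU U (lam / c t)) (Real.sqrt (c t) * y t))) t := by
  have hz := (hc.sqrt h0.ne').mul hy
  have hl : HasDerivAt (fun τ => lam / c τ) (-(lam * c') / c t ^ 2) t :=
    ((hasDerivAt_const t lam).div hc h0.ne').congr_deriv (by ring)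
  have hV : ∀ k, HasDerivAt (fun τ => U k (Real.sqrt (c τ) * y τ))
      (deriv (U k) (Real.sqrt (c t) * y t)
        * (c' / (2 * Real.sqrt (c t)) * y t + Real.sqrt (c t) * y')) t := fun k =>
    (hU k _).hasDerivAt.comp t hz
  unfold prof
  simp only [polyU_eq, deriv_polyU hU]
  refine ((hc.rpow_const (p := r) (Or.inl h0.ne')).fun_mul (((hV 0).fun_add (hl.fun_mul (hV 1))).fun_add
    ((hl.fun_pow 2).fun_mul (hV 2)))).congr_deriv ?_
  have hs := Real.sqrt_pos.2 h0
  have hs2 := Real.sq_sqrt h0.le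
  rw [Real.rpow_sub_one h0.ne', Real.rpow_add h0, ← Real.sqrt_eq_rpow]
  generalize c t ^ r = k
  generalize Real.sqrt (c t) = σ at hs hs2 ⊢
  rw [← hs2]
  simp only [scaleU, Fin.val_zero, Fin.val_one, Fin.val_two]
  push_cast
  field_simp
  ring

/-- The profile of the soliton in the form used for the correctors. -/
noncomputable def solU (m : ℕ) : Fin 3 → ℝ → ℝ := ![Q m, fun _ => 0, fun _ => 0]

theorem polyU_solU (l : ℝ) : polyU (solU m) l = Q m := by
  funext z; rw [polyU_eq]; simp [solU]

theorem differentiable_solU (hm : 2 ≤ m) (k : Fin 3) : Differentiable ℝ (solU m k) := by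
  fin_cases k
  · exact (loc_Q hm).differentiable
  · exact differentiable_const (0 : ℝ)
  · exact differentiable_const (0 : ℝ)

theorem polyU_scaleU_solU (hm : 2 ≤ m) (l z : ℝ) :
    polyU (scaleU (1 / ((m : ℝ) - 1)) (solU m)) l z = scaleQ m z := by
  rw [polyU_eq]
  simp [solU, scaleU, scaleQ, deriv_Q hm]

theorem Qc_eq (c y lam : ℝ) : Qc m c y = prof (solU m) (1 / ((m : ℝ) - 1)) lam c y := by
  rw [prof, polyU_solU, Qc]

theorem Profiles.Solves.differentiable_UA (hX : X.Solves m) (k : Fin 3) : Differentiable ℝ (X.UA k) := by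
  obtain ⟨_, h⟩ := hX.tailUA k
  exact h.contDiff.differentiable (by simp)

theorem Profiles.Solves.differentiable_U₁ (hX : X.Solves m) (k : Fin 3) : Differentiable ℝ (X.U₁ k) := by
  obtain ⟨_, _, h⟩ := hX.tail₁ k
  exact h.contDiff.differentiable (by simp)

theorem Profiles.Solves.differentiable_U₂ (hX : X.Solves m) (k : Fin 3) : Differentiable ℝ (X.U₂ k) := by
  obtain ⟨_, _, h⟩ := hX.tail₂ k
  exact h.contDiff.differentiable (by simp)

theorem aTilde_pos (ha : IsPotential m a) (s : ℝ) : 0 < aTilde m a s :=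
  Real.rpow_pos_of_pos (by linarith [ha.one_lt s]) _

theorem one_le_aTilde (hm : 2 ≤ m) (ha : IsPotential m a) (s : ℝ) : 1 ≤ aTilde m a s := by
  have : (2 : ℝ) ≤ m := by exact_mod_cast hm
  exact Real.one_le_rpow (ha.one_lt s).le (one_div_nonneg.2 (by linarith))

theorem aTilde_pow (hm : 2 ≤ m) (ha : IsPotential m a) (s : ℝ) :
    aTilde m a s ^ m = a s * aTilde m a s := by
  have h0 : 0 < a s := by linarith [ha.one_lt s]
  have hm' : (m : ℝ) - 1 ≠ 0 := by
    have : (2 : ℝ) ≤ m := by exact_mod_cast hm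
    linarith
  have : aTilde m a s ^ m = aTilde m a s ^ (m - 1) * aTilde m a s := by
    rw [← pow_succ]; congr 1; omega
  rw [this]
  congr 1
  rw [aTilde, ← Real.rpow_natCast, ← Real.rpow_mul h0.le, Nat.cast_sub (by omega), Nat.cast_one,
    one_div_mul_cancel hm', Real.rpow_one]

theorem dCoef_eq (hm : 2 ≤ m) (ha : IsPotential m a) (r : ℝ) :
    dCoef m a ε r = slope a (ε * r) / aTilde m a (ε * r) := by
  rw [dCoef, aTilde_pow hm ha, slope, div_div]

theorem hasDerivAt_aTilde (ha : IsPotential m a) (s : ℝ) :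
    HasDerivAt (aTilde m a) (1 / ((m : ℝ) - 1) * slope a s * aTilde m a s) s := by
  have h0 : 0 < a s := by linarith [ha.one_lt s]
  refine ((ha.contDiff.differentiable (by simp) s).hasDerivAt.rpow_const (Or.inl h0.ne')).congr_deriv ?_
  rw [Real.rpow_sub_one h0.ne', aTilde, slope]
  field_simp

theorem hasDerivAt_slope (ha : IsPotential m a) (s : ℝ) :
    HasDerivAt (slope a) (bend a s - slope a s ^ 2) s := by
  have h0 : 0 < a s := by linarith [ha.one_lt s]
  have h1 : Differentiable ℝ (deriv a) := by
    simpa using ha.contDiff.differentiable_iteratedDeriv 1 (by norm_num)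
  refine ((h1 s).hasDerivAt.div (ha.contDiff.differentiable (by simp) s).hasDerivAt h0.ne').congr_deriv ?_
  rw [bend, slope, iteratedDeriv_succ, iteratedDeriv_one]
  field_simp

theorem hasDerivAt_bend (ha : IsPotential m a) (s : ℝ) :
    HasDerivAt (bend a) (iteratedDeriv 3 a s / a s - bend a s * slope a s) s := by
  have h0 : 0 < a s := by linarith [ha.one_lt s]
  have h1 : Differentiable ℝ (iteratedDeriv 2 a) :=
    ha.contDiff.differentiable_iteratedDeriv 2 (by norm_num)
  refine ((h1 s).hasDerivAt.div (ha.contDiff.differentiable (by simp) s).hasDerivAt h0.ne').congr_deriv ?_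
  rw [bend, slope, iteratedDeriv_succ (n := 2)]
  field_simp

theorem uTilde_eq (hm : 2 ≤ m) (ha : IsPotential m a) (c r x : ℝ) :
    uTilde m a (corA m X lam) (corB m X a lam) ε c r x
      = (prof (solU m) (1 / ((m : ℝ) - 1)) lam c (x - r)
        + (ε * (slope a (ε * r) * prof X.UA (1 / ((m : ℝ) - 1) - 1 / 2) lam c (x - r))
        + delta3 m * ε ^ 2 * (slope a (ε * r) ^ 2 * prof X.U₁ (1 / ((m : ℝ) - 1) - 1) lam c (x - r)
          + bend a (ε * r) * prof X.U₂ (1 / ((m : ℝ) - 1) - 1) lam c (x - r))))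
        / aTilde m a (ε * r) := by
  have := (aTilde_pos ha (ε * r)).ne'
  rw [uTilde, R, w, dCoef_eq hm ha, Qc_eq c _ lam, corA, corB]
  field_simp

theorem w_eq (hm : 2 ≤ m) (ha : IsPotential m a) {c : ℝ} (hc : 0 < c) (r v y : ℝ) :
    w m a (corA m X lam) (corB m X a lam) ε c r y
      = c ^ (1 / ((m : ℝ) - 1)) / aTilde m a (ε * r)
        * cor m X a (par lam ε c r v) (Real.sqrt c * y) := by
  have h := (aTilde_pos ha (ε * r)).ne'
  have hs := Real.sqrt_pos.2 hc
  have hs2 := Real.sq_sqrt hc.le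
  rw [w, dCoef_eq hm ha, corA, corB, cor, secCor]
  simp only [par, prof]
  rw [Real.rpow_sub_one hc.ne', Real.rpow_sub hc, ← Real.sqrt_eq_rpow]
  have : c ^ (1 / ((m : ℝ) - 1)) / c = c ^ (1 / ((m : ℝ) - 1)) / Real.sqrt c ^ 2 := by rw [hs2]
  rw [this]
  field_simp

theorem uTilde_eq_scaled (hm : 2 ≤ m) (ha : IsPotential m a) {c : ℝ} (hc : 0 < c) (r v x : ℝ) :
    uTilde m a (corA m X lam) (corB m X a lam) ε c r x
      = c ^ (1 / ((m : ℝ) - 1)) / aTilde m a (ε * r)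
        * (Q m (Real.sqrt c * (x - r)) + cor m X a (par lam ε c r v) (Real.sqrt c * (x - r))) := by
  rw [uTilde, w_eq hm ha hc r v, R, Qc]
  ring

/-- The derivative of the approximate solution along a curve of parameters `(c, ρ)` and points. -/
theorem hasDerivAt_uTilde (hm : 2 ≤ m) (hX : X.Solves m) (ha : IsPotential m a) {c ρ x : ℝ → ℝ}
    {c' ρ' x' t : ℝ} (hc : HasDerivAt c c' t) (hρ : HasDerivAt ρ ρ' t) (hx : HasDerivAt x x' t)
    (h0 : 0 < c t) (v : ℝ) {p : Par} (hp : p = par lam ε (c t) (ρ t) v) {z : ℝ}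
    (hz : z = Real.sqrt (c t) * (x t - ρ t)) :
    HasDerivAt (fun τ => uTilde m a (corA m X lam) (corB m X a lam) ε (c τ) (ρ τ) (x τ))
      (c t ^ (1 / ((m : ℝ) - 1)) / aTilde m a (ε * ρ t) *
        (c' / c t * scaleSol m X a p z
          + (x' - ρ') * Real.sqrt (c t) * deriv (fun z => Q m z + cor m X a p z) z
          + ρ' * Real.sqrt (c t) * (-(p.e * slope a p.s * (1 / ((m : ℝ) - 1)) * Q m z)
            + p.e ^ 2 * dSlope m a p.s * polyU X.UA p.l z
            + delta3 m * p.e ^ 3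
              * (dCoef₁ m a p.s * polyU X.U₁ p.l z + dCoef₂ m a p.s * polyU X.U₂ p.l z)))) t := by
  have hy : HasDerivAt (fun τ => x τ - ρ τ) (x' - ρ') t := hx.fun_sub hρ
  have hs := hρ.const_mul ε
  have h1 := hasDerivAt_prof (differentiable_solU hm) (1 / ((m : ℝ) - 1)) lam hc hy h0
  have h2 := hasDerivAt_prof hX.differentiable_UA (1 / ((m : ℝ) - 1) - 1 / 2) lam hc hy h0
  have h3 := hasDerivAt_prof hX.differentiable_U₁ (1 / ((m : ℝ) - 1) - 1) lam hc hy h0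
  have h4 := hasDerivAt_prof hX.differentiable_U₂ (1 / ((m : ℝ) - 1) - 1) lam hc hy h0
  have ht := (hasDerivAt_aTilde ha (ε * ρ t)).comp t hs
  have hb := (hasDerivAt_slope ha (ε * ρ t)).comp t hs
  have hβ := (hasDerivAt_bend ha (ε * ρ t)).comp t hs
  have ht0 := (aTilde_pos ha (ε * ρ t)).ne'
  have key := (h1.fun_add (((hb.fun_mul h2).const_mul ε).fun_add
    ((((hb.fun_pow 2).fun_mul h3).fun_add (hβ.fun_mul h4)).const_mul (delta3 m * ε ^ 2)))).div ht ht0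
  simp only [Function.comp_apply] at key
  have hdG : deriv (fun z => Q m z + cor m X a p z) z = dQ m z + (p.e * slope a p.s * deriv (polyU X.UA p.l) z
      + delta3 m * p.e ^ 2 * (slope a p.s ^ 2 * deriv (polyU X.U₁ p.l) z
        + bend a p.s * deriv (polyU X.U₂ p.l) z)) := by
    obtain ⟨_, hA⟩ := hX.tail_polyUA p.l
    obtain ⟨_, _, hU₁⟩ := tail_polyU hX.tail₁ p.l
    obtain ⟨_, _, hU₂⟩ := tail_polyU hX.tail₂ p.l
    exact ((hasDerivAt_Q z hm).fun_add (((hA.hasDerivAt z).const_mul _).fun_add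
      ((((hU₁.hasDerivAt z).const_mul _).fun_add ((hU₂.hasDerivAt z).const_mul _)).const_mul _))).deriv
  rw [hdG]
  refine (key.congr_deriv ?_).congr_of_eventuallyEq
    (Eventually.of_forall fun τ => uTilde_eq hm ha (c τ) (ρ τ) (x τ))
  have hσ := Real.sqrt_pos.2 h0
  have hσ2 := Real.sq_sqrt h0.le
  simp only [prof, ← hz, polyU_solU, deriv_Q hm, polyU_scaleU_solU hm, scaleSol, scaleSecCor]
  subst hp
  simp only [par, dSlope, dCoef₁, dCoef₂]
  have e1 : c t ^ (1 / ((m : ℝ) - 1) - 1) = c t ^ (1 / ((m : ℝ) - 1)) / c t := Real.rpow_sub_one h0.ne' _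
  have e2 : ∀ r : ℝ, c t ^ (r + 1 / 2) = c t ^ r * Real.sqrt (c t) := fun r => by
    rw [Real.rpow_add h0, ← Real.sqrt_eq_rpow]
  have e3 : c t ^ (1 / ((m : ℝ) - 1) - 1 / 2) = c t ^ (1 / ((m : ℝ) - 1)) / Real.sqrt (c t) := by
    rw [Real.rpow_sub h0, ← Real.sqrt_eq_rpow]
  have e4 : c t ^ (1 / ((m : ℝ) - 1) - 1 / 2 - 1)
      = c t ^ (1 / ((m : ℝ) - 1)) / Real.sqrt (c t) / c t := by rw [Real.rpow_sub_one h0.ne', e3]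
  have e5 : c t ^ (1 / ((m : ℝ) - 1) - 1 - 1) = c t ^ (1 / ((m : ℝ) - 1)) / c t / c t := by
    rw [Real.rpow_sub_one h0.ne', e1]
  have e6 : (m : ℝ) / ((m : ℝ) - 1) = 1 + 1 / ((m : ℝ) - 1) := by
    have : (m : ℝ) - 1 ≠ 0 := by
      have : (2 : ℝ) ≤ m := by exact_mod_cast hm
      linarith
    field_simp
    ring
  rw [e2, e2, e2, e4, e5, e3, e1, e6]
  generalize c t ^ (1 / ((m : ℝ) - 1)) = k
  generalize 1 / ((m : ℝ) - 1) = κ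
  generalize Real.sqrt (c t) = σ at hσ hσ2 ⊢
  rw [← hσ2]
  generalize aTilde m a (ε * ρ t) = T at ht0 ⊢
  generalize iteratedDeriv 3 a (ε * ρ t) / a (ε * ρ t) = b₃
  generalize slope a (ε * ρ t) = b
  generalize bend a (ε * ρ t) = b₂
  field_simp
  ring

end

/-! ### The decomposition of the error -/

/-- The coefficient `q` in the modified derivative in `ρ`: it is `ε ∂_ρ` of the coefficient of `A_c`. -/
noncomputable def qCoef (m : ℕ) (a : ℝ → ℝ) (ε r : ℝ) : ℝ :=
  ε ^ 2 * dSlope m a (ε * r) / aTilde m a (ε * r)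

/-- The remainder `S̃`, at scaling `c`, position `r` and velocity `v`. -/
noncomputable def remS (m : ℕ) (X : Profiles) (a : ℝ → ℝ) (lam ε c r v x : ℝ) : ℝ :=
  c ^ (1 / ((m : ℝ) - 1)) * Real.sqrt c ^ 3 / aTilde m a (ε * r)
    * err m X a (par lam ε c r v) (Real.sqrt c * (x - r))

section
variable {m : ℕ} {X : Profiles} {a : ℝ → ℝ} {lam ε : ℝ}

theorem deriv_scaled (f : ℝ → ℝ) (k σ r x : ℝ) :
    deriv (fun x => k * f (σ * (x - r))) x = k * σ * deriv f (σ * (x - r)) := by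
  rw [deriv_const_mul_field, deriv_comp_sub_const (f := fun y => f (σ * y)), deriv_comp_mul_left,
    smul_eq_mul, mul_assoc]

theorem rpow_mul_nat (hm : 2 ≤ m) {c : ℝ} (hc : 0 < c) :
    (c ^ (1 / ((m : ℝ) - 1))) ^ m = c ^ (1 / ((m : ℝ) - 1)) * c := by
  have hm' : (m : ℝ) - 1 ≠ 0 := by
    have : (2 : ℝ) ≤ m := by exact_mod_cast hm
    linarith
  rw [← Real.rpow_natCast, ← Real.rpow_mul hc.le,
    show 1 / ((m : ℝ) - 1) * m = 1 / ((m : ℝ) - 1) + 1 by field_simp; ring, Real.rpow_add_one hc.ne']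

theorem flux_scaled (hm : 2 ≤ m) (ha : IsPotential m a) {c : ℝ} (hc : 0 < c) (r v x : ℝ) :
    iteratedDeriv 2 (uTilde m a (corA m X lam) (corB m X a lam) ε c r) x
        - lam * uTilde m a (corA m X lam) (corB m X a lam) ε c r x
        + a (ε * x) * uTilde m a (corA m X lam) (corB m X a lam) ε c r x ^ m
      = c ^ (1 / ((m : ℝ) - 1)) * c / aTilde m a (ε * r)
        * flux m X a (par lam ε c r v) (Real.sqrt c * (x - r)) := by
  have hT := (aTilde_pos ha (ε * r)).ne'
  have ha0 : a (ε * r) ≠ 0 := by linarith [ha.one_lt (ε * r)]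
  have hσ := Real.sqrt_pos.2 hc
  have hσ2 := Real.sq_sqrt hc.le
  set p := par lam ε c r v with hp
  have hu : uTilde m a (corA m X lam) (corB m X a lam) ε c r
      = fun x => c ^ (1 / ((m : ℝ) - 1)) / aTilde m a (ε * r)
        * (fun z => Q m z + cor m X a p z) (Real.sqrt c * (x - r)) :=
    funext fun x => uTilde_eq_scaled hm ha hc r v x
  have h2' : ∀ (g : ℝ → ℝ) (k : ℝ), iteratedDeriv 2 (fun x => k * g (Real.sqrt c * (x - r))) x
      = k * c * deriv (deriv g) (Real.sqrt c * (x - r)) := fun g k => by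
    have hd : deriv (fun x => k * g (Real.sqrt c * (x - r)))
        = fun x => k * Real.sqrt c * deriv g (Real.sqrt c * (x - r)) :=
      funext (deriv_scaled _ _ _ _)
    rw [iteratedDeriv_succ, iteratedDeriv_one, hd, deriv_scaled, mul_assoc k, ← sq, hσ2]
  have h2 := h2' (fun z => Q m z + cor m X a p z) (c ^ (1 / ((m : ℝ) - 1)) / aTilde m a (ε * r))
  rw [← hu] at h2
  have hθ : relPot a p (Real.sqrt c * (x - r)) = a (ε * x) / a (ε * r) := by
    have : ε * r + ε / Real.sqrt c * (Real.sqrt c * (x - r)) = ε * x := by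
      field_simp
      ring
    simp only [relPot, hp, par, this]
  rw [h2, uTilde_eq_scaled hm ha hc r v x, mul_pow, div_pow, rpow_mul_nat hm hc, aTilde_pow hm ha,
    flux, hθ, ← hp]
  have hl : p.l * c = lam := by
    rw [hp]; simp only [par]; field_simp
  rw [← hl]
  field_simp

theorem deriv_scaling (hm : 2 ≤ m) (hX : X.Solves m) (ha : IsPotential m a) {c : ℝ} (hc : 0 < c)
    (r v x : ℝ) :
    deriv (fun c' => uTilde m a (corA m X lam) (corB m X a lam) ε c' r x) c
      = c ^ (1 / ((m : ℝ) - 1)) / aTilde m a (ε * r)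
        * (1 / c * scaleSol m X a (par lam ε c r v) (Real.sqrt c * (x - r))) := by
  rw [(hasDerivAt_uTilde (c := fun c => c) (ρ := fun _ => r) (x := fun _ => x) hm hX ha
    (hasDerivAt_id c) (hasDerivAt_const c r) (hasDerivAt_const c x) hc v rfl rfl).deriv]
  simp

theorem deriv_R (hm : 2 ≤ m) (ha : IsPotential m a) (c r x : ℝ) :
    deriv (fun r => R m a ε c r x) r
      = -(c ^ (1 / ((m : ℝ) - 1)) / aTilde m a (ε * r)
        * (Real.sqrt c * dQ m (Real.sqrt c * (x - r))
          + ε * slope a (ε * r) * (1 / ((m : ℝ) - 1)) * Q m (Real.sqrt c * (x - r)))) := by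
  have hT := (aTilde_pos ha (ε * r)).ne'
  have h1 : HasDerivAt (fun r => Real.sqrt c * (x - r)) (-Real.sqrt c) r := by
    simpa using ((hasDerivAt_id r).const_sub x).const_mul (Real.sqrt c)
  have h2 : HasDerivAt (fun r => ε * r) ε r := by simpa using (hasDerivAt_id r).const_mul ε
  have h3 := (((hasDerivAt_Q _ hm).comp r h1).const_mul (c ^ (1 / ((m : ℝ) - 1)))).div
    ((hasDerivAt_aTilde ha (ε * r)).comp r h2) hT
  refine (h3.congr_of_eventuallyEq (Eventually.of_forall fun r => rfl)).deriv.trans ?_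
  simp only [Function.comp_apply, dQ]
  field_simp
  ring

theorem modified_deriv_position (hm : 2 ≤ m) (hX : X.Solves m) (ha : IsPotential m a) {c : ℝ}
    (hc : 0 < c) (r v x : ℝ) {p : Par} (hp : p = par lam ε c r v) {z : ℝ}
    (hz : z = Real.sqrt c * (x - r)) :
    deriv (fun r => R m a ε c r x) r
        - deriv (fun y => w m a (corA m X lam) (corB m X a lam) ε c r y) (x - r)
        + qCoef m a ε r * corA m X lam c (x - r)
      = -(c ^ (1 / ((m : ℝ) - 1)) / aTilde m a (ε * r) * Real.sqrt c
        * (deriv (fun z => Q m z + cor m X a p z) z + p.e * slope a p.s * (1 / ((m : ℝ) - 1)) * Q m z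
          - p.e ^ 2 * dSlope m a p.s * polyU X.UA p.l z)) := by
  have hT := (aTilde_pos ha (ε * r)).ne'
  have hσ := Real.sqrt_pos.2 hc
  obtain ⟨_, _, hcor⟩ := hX.tail_cor (a := a) p
  have hw : deriv (fun y => w m a (corA m X lam) (corB m X a lam) ε c r y) (x - r)
      = c ^ (1 / ((m : ℝ) - 1)) / aTilde m a (ε * r) * Real.sqrt c * deriv (cor m X a p) z := by
    have h1 := deriv_scaled (cor m X a p) (c ^ (1 / ((m : ℝ) - 1)) / aTilde m a (ε * r)) (Real.sqrt c) 0
      (x - r)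
    rw [sub_zero, ← hz] at h1
    rw [← h1]
    congr 1
    funext y
    rw [w_eq hm ha hc r v, sub_zero, hp]
  rw [deriv_R hm ha, hw, deriv_Q_add hm hcor.contDiff, corA, prof, ← hz, qCoef, Real.rpow_sub hc,
    ← Real.sqrt_eq_rpow]
  subst hp
  simp only [par]
  field_simp
  ring

/-- The decomposition of `S[ũ]`. -/
theorem S_eq (hm : 2 ≤ m) (hX : X.Solves m) (ha : IsPotential m a) {c ρ : ℝ → ℝ} {t : ℝ}
    (hc : DifferentiableAt ℝ c t) (hρ : DifferentiableAt ℝ ρ t) (h0 : 0 < c t) (x : ℝ) :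
    S m lam a ε (fun τ z => uTilde m a (corA m X lam) (corB m X a lam) ε (c τ) (ρ τ) z) t x =
      (deriv c t - ε * f1 m lam a ε (c t) (ρ t) - ε ^ 2 * delta3 m * f3 lam a ε (c t) (ρ t))
        * deriv (fun c' => uTilde m a (corA m X lam) (corB m X a lam) ε c' (ρ t) x) (c t)
      + (deriv ρ t - c t + lam - ε * f2 m lam a ε (c t) (ρ t)
          - ε ^ 2 * delta3 m * f4 (fun c => polyG X.G₁ (lam / c)) (fun c => polyG X.G₂ (lam / c))
            a ε (c t) (ρ t))
        * (deriv (fun r => R m a ε (c t) r x) (ρ t)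
            - deriv (fun y => w m a (corA m X lam) (corB m X a lam) ε (c t) (ρ t) y) (x - ρ t)
            + qCoef m a ε (ρ t) * corA m X lam (c t) (x - ρ t))
      + remS m X a lam ε (c t) (ρ t) (deriv ρ t) x := by
  have hT := (aTilde_pos ha (ε * ρ t)).ne'
  have hσ := Real.sqrt_pos.2 h0
  have hσ2 := Real.sq_sqrt h0.le
  have ht := (hasDerivAt_uTilde (lam := lam) (ε := ε) hm hX ha hc.hasDerivAt hρ.hasDerivAt
    (hasDerivAt_const t x) h0 (deriv ρ t) rfl rfl).deriv
  rw [S, ht, funext (flux_scaled (X := X) (lam := lam) (ε := ε) hm ha h0 (ρ t) (deriv ρ t)), deriv_scaled,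
    deriv_scaling hm hX ha h0 (ρ t) (deriv ρ t) x, modified_deriv_position hm hX ha h0 _ (deriv ρ t) x rfl rfl,
    remS, err]
  set z := Real.sqrt (c t) * (x - ρ t)
  have hs : (par lam ε (c t) (ρ t) (deriv ρ t)).s = ε * ρ t := rfl
  have he : (par lam ε (c t) (ρ t) (deriv ρ t)).e = ε / Real.sqrt (c t) := rfl
  have hl : (par lam ε (c t) (ρ t) (deriv ρ t)).l = lam / c t := rfl
  have hr : (par lam ε (c t) (ρ t) (deriv ρ t)).r = deriv ρ t / c t := rfl
  rw [hs, he, hl, hr]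
  have hf1 : f1 m lam a ε (c t) (ρ t) = c t ^ 2 * slope a (ε * ρ t) * coef₁ m (lam / c t) := by
    unfold f1 slope coef₁
    field_simp
  have hf2 : f2 m lam a ε (c t) (ρ t)
      = c t / Real.sqrt (c t) * slope a (ε * ρ t) * coef₂ m (lam / c t) := by
    unfold f2 slope coef₂
    field_simp
  have hf3 : f3 lam a ε (c t) (ρ t)
      = c t ^ 2 / Real.sqrt (c t) * slope a (ε * ρ t) ^ 2 * coef₃ (lam / c t) := by
    unfold f3 slope coef₃ xiTilde3 ratioQ
    field_simp
  have hf4 : f4 (fun c => polyG X.G₁ (lam / c)) (fun c => polyG X.G₂ (lam / c)) a ε (c t) (ρ t)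
      = slope a (ε * ρ t) ^ 2 * polyG X.G₁ (lam / c t) + bend a (ε * ρ t) * polyG X.G₂ (lam / c t) := by
    unfold f4 slope bend
    ring
  rw [hf1, hf2, hf3, hf4]
  generalize scaleSol m X a (par lam ε (c t) (ρ t) (deriv ρ t)) z = w₁
  generalize deriv (fun z => Q m z + cor m X a (par lam ε (c t) (ρ t) (deriv ρ t)) z) z = w₂
  generalize deriv (flux m X a (par lam ε (c t) (ρ t) (deriv ρ t))) z = w₃
  generalize c t ^ (1 / ((m : ℝ) - 1)) = k
  generalize polyU X.UA (lam / c t) z = w₄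
  generalize polyU X.U₁ (lam / c t) z = w₅
  generalize polyU X.U₂ (lam / c t) z = w₆
  generalize coef₁ m (lam / c t) = k₁
  generalize coef₂ m (lam / c t) = k₂
  generalize coef₃ (lam / c t) = k₃
  generalize polyG X.G₁ (lam / c t) = k₄
  generalize polyG X.G₂ (lam / c t) = k₅
  have hl : lam = lam / c t * c t := by field_simp
  generalize lam / c t = l at hl
  rw [hl]
  generalize Real.sqrt (c t) = σ at hσ hσ2 ⊢
  rw [← hσ2]
  field_simp
  ring

theorem contDiff_uTilde (hm : 2 ≤ m) (hX : X.Solves m) (ha : IsPotential m a) {c : ℝ} (hc : 0 < c)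
    (r : ℝ) : ContDiff ℝ ∞ fun x => uTilde m a (corA m X lam) (corB m X a lam) ε c r x := by
  obtain ⟨_, _, hcor⟩ := hX.tail_cor (a := a) (par lam ε c r 0)
  have h1 := hcor.contDiff
  have h2 := (loc_Q hm).contDiff
  rw [funext (uTilde_eq_scaled (X := X) (lam := lam) (ε := ε) hm ha hc r 0)]
  have h3 : ContDiff ℝ ∞ fun x : ℝ => Real.sqrt c * (x - r) :=
    contDiff_const.mul (contDiff_id.sub contDiff_const)
  exact contDiff_const.mul ((h2.comp h3).add (h1.comp h3))

end

/-! ### Properties of the correctors -/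

section
variable {m : ℕ} {X : Profiles} {a : ℝ → ℝ} {lam : ℝ} {U : Fin 3 → ℝ → ℝ}

theorem exists_rpow_le {c₀ : ℝ} (h0 : 0 < c₀) (M r : ℝ) :
    ∃ K, 0 ≤ K ∧ ∀ c, c₀ ≤ c → c ≤ M → c ^ r ≤ K := by
  have hcont : ContinuousOn (fun c : ℝ => c ^ r) (Icc c₀ M) := fun c hc =>
    (Real.continuousAt_rpow_const c r (Or.inl (h0.trans_le hc.1).ne')).continuousWithinAt
  obtain ⟨K, hK⟩ := isCompact_Icc.exists_bound_of_continuousOn hcont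
  refine ⟨max K 0, le_max_right _ _, fun c h1 h2 => le_max_of_le_left ?_⟩
  exact (le_abs_self _).trans (hK c ⟨h1, h2⟩)

theorem hasDerivAt_prof_scale (hU : ∀ k, Differentiable ℝ (U k)) (r lam : ℝ) {c : ℝ} (hc : 0 < c)
    (y : ℝ) : HasDerivAt (fun c => prof U r lam c y) (prof (scaleU r U) (r - 1) lam c y) c :=
  (hasDerivAt_prof hU r lam (hasDerivAt_id c) (hasDerivAt_const c y) hc).congr_deriv (by simp)

theorem hasDerivAt_prof_pos (hU : ∀ k, Differentiable ℝ (U k)) (r lam : ℝ) {c : ℝ} (hc : 0 < c)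
    (y : ℝ) : HasDerivAt (prof U r lam c) (prof (fun k => deriv (U k)) (r + 1 / 2) lam c y) y :=
  (hasDerivAt_prof hU r lam (hasDerivAt_const y c) (hasDerivAt_id' y) hc).congr_deriv (by
    simp [prof, deriv_polyU hU, polyU_eq])

theorem max_sqrt_mul {c : ℝ} (y : ℝ) : max (Real.sqrt c * y) 0 = Real.sqrt c * max y 0 := by
  rw [mul_max_of_nonneg _ _ (Real.sqrt_nonneg c), mul_zero]

theorem exists_prof_bound {c₀ M : ℝ} (h0 : 0 < c₀) (hlam : |lam| ≤ 1) {k : ℕ}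
    (hU : Fam 0 (1 / c₀) 0 0 0 0 k 0 fun p z => polyU U p.l z) (r : ℝ) :
    ∃ K, 0 ≤ K ∧ ∀ c, c₀ ≤ c → c ≤ M → ∀ y,
      |prof U r lam c y| ≤ K * ((1 + max (-y) 0) ^ k * Real.exp (-(Real.sqrt c₀ / 2) * max y 0)) := by
  obtain ⟨K, hK⟩ := hU.bound
  obtain ⟨K', hK'0, hK'⟩ := exists_rpow_le h0 M r
  refine ⟨K' * (|K| * (1 + Real.sqrt M) ^ k), by positivity, fun c h1 h2 y => ?_⟩
  have hc : 0 < c := h0.trans_le h1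
  have hl : |lam / c| ≤ 1 / c₀ := by
    rw [abs_div, abs_of_pos hc]
    exact div_le_div₀ zero_le_one hlam h0 h1
  have h3 := hK ⟨1, lam / c, 0, 0⟩ ⟨one_pos, le_rfl, hl, by simp⟩ (Real.sqrt c * y)
  simp only [famWt, scaWt, pow_zero, one_mul, mul_one] at h3
  rw [← mul_neg, max_sqrt_mul, max_sqrt_mul] at h3
  have e1 : (0 : ℝ) ≤ max (-y) 0 := le_max_right _ _
  have e2 : (0 : ℝ) ≤ max y 0 := le_max_right _ _
  have e3 : Real.sqrt c ≤ Real.sqrt M := Real.sqrt_le_sqrt h2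
  have e4 : Real.sqrt c₀ ≤ Real.sqrt c := Real.sqrt_le_sqrt h1
  have e5 := Real.sqrt_nonneg c
  have e6 : 1 + Real.sqrt c * max (-y) 0 ≤ (1 + Real.sqrt M) * (1 + max (-y) 0) := by nlinarith
  have e7 : Real.exp (-(1 / 2) * (Real.sqrt c * max y 0)) ≤ Real.exp (-(Real.sqrt c₀ / 2) * max y 0) :=
    Real.exp_le_exp.2 (by nlinarith)
  rw [prof, abs_mul, abs_of_pos (Real.rpow_pos_of_pos hc r)]
  calc _ ≤ K' * (|K| * ((1 + Real.sqrt c * max (-y) 0) ^ k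
          * Real.exp (-(1 / 2) * (Real.sqrt c * max y 0)))) := by
        gcongr
        · exact hK' c h1 h2
        · refine h3.trans ?_
          gcongr
          exact le_abs_self K
    _ ≤ K' * (|K| * (((1 + Real.sqrt M) * (1 + max (-y) 0)) ^ k
          * Real.exp (-(Real.sqrt c₀ / 2) * max y 0))) := by gcongr
    _ = _ := by rw [mul_pow]; ring

theorem corA_bounds {c₀ M : ℝ} (hm : 2 ≤ m) (hX : X.Solves m) (h0 : 0 < c₀) (hlam : |lam| ≤ 1) :
    ∃ K, 0 ≤ K ∧ ∀ c, c₀ ≤ c → c ≤ M → ∀ y,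
      |corA m X lam c y| ≤ K * Real.exp (-(Real.sqrt c₀ / 2) * max y 0) ∧
      DifferentiableAt ℝ (fun c => corA m X lam c y) c ∧
      |deriv (fun c => corA m X lam c y) c| ≤ K := by
  obtain ⟨K₁, hK₁0, hK₁⟩ := exists_prof_bound (lam := lam) (M := M) h0 hlam (hX.fam_UA hm)
    (1 / ((m : ℝ) - 1) - 1 / 2)
  obtain ⟨K₂, hK₂0, hK₂⟩ := exists_prof_bound (lam := lam) (M := M) h0 hlam
    (hX.fam_scaleUA hm (1 / ((m : ℝ) - 1) - 1 / 2)) (1 / ((m : ℝ) - 1) - 1 / 2 - 1)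
  refine ⟨K₁ + K₂, by positivity, fun c h1 h2 y => ⟨?_, ?_⟩⟩
  · have := hK₁ c h1 h2 y
    rw [pow_zero, one_mul] at this
    exact this.trans (by gcongr; linarith)
  · have hd := hasDerivAt_prof_scale hX.differentiable_UA (1 / ((m : ℝ) - 1) - 1 / 2) lam
      (h0.trans_le h1) y
    refine ⟨hd.differentiableAt, ?_⟩
    have h3 := hK₂ c h1 h2 y
    rw [pow_zero, one_mul] at h3
    have h4 : Real.exp (-(Real.sqrt c₀ / 2) * max y 0) ≤ 1 := Real.exp_le_one_iff.2 (by
      have e1 := Real.sqrt_nonneg c₀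
      have e2 : (0 : ℝ) ≤ max y 0 := le_max_right _ _
      nlinarith [mul_nonneg e1 e2])
    unfold corA
    rw [hd.deriv]
    nlinarith

theorem differentiable_corA (hX : X.Solves m) {c : ℝ} (hc : 0 < c) : Differentiable ℝ (corA m X lam c) :=
  fun y => (hasDerivAt_prof_pos hX.differentiable_UA _ lam hc y).differentiableAt

theorem deriv_corA (c : ℝ) :
    deriv (corA m X lam c) = fun y => c ^ (1 / ((m : ℝ) - 1) - 1 / 2) * Real.sqrt c
      * deriv (polyU X.UA (lam / c)) (Real.sqrt c * y) := funext fun y => by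
  have := deriv_scaled (polyU X.UA (lam / c)) (c ^ (1 / ((m : ℝ) - 1) - 1 / 2)) (Real.sqrt c) 0 y
  simp only [sub_zero] at this
  exact this

theorem memY_deriv_corA (hm : m = 2 ∨ m = 3 ∨ m = 4) (hX : X.Solves m) {c : ℝ}
    (hc : muDecay m lam / 2 ≤ c) : MemY m lam (deriv (corA m X lam c)) := by
  have hm2 : 2 ≤ m := by omega
  have hμ := muDecay_pos (lam := lam) hm
  have hμ1 := muDecay_le_one (lam := lam) hm
  have hσ : 2 / 3 * muDecay m lam ≤ Real.sqrt c := Real.le_sqrt_of_sq_le (by nlinarith)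
  have hσ0 := Real.sqrt_nonneg c
  obtain ⟨_, hA⟩ := hX.tail_polyUA (lam / c)
  have hL := (hA.deriv hm2).loc
  rw [deriv_corA]
  set k := c ^ (1 / ((m : ℝ) - 1) - 1 / 2) * Real.sqrt c
  have h1 : ContDiff ℝ ∞ fun y => deriv (polyU X.UA (lam / c)) (Real.sqrt c * y) :=
    hL.contDiff.comp (contDiff_const.mul contDiff_id)
  refine ⟨contDiff_const.mul h1, fun j => ?_⟩
  obtain ⟨K, hK⟩ := (hL j (3 / 4) (by norm_num)).2 j le_rfl
  refine ⟨|k| * Real.sqrt c ^ j * |K| + 1, by positivity, 1, one_pos, fun x => ?_⟩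
  have hj : (j : WithTop ℕ∞) ≤ (∞ : WithTop ℕ∞) := by exact_mod_cast le_top
  rw [iteratedDeriv_const_mul k (h1.of_le hj).contDiffAt,
    iteratedDeriv_comp_const_mul (hL.contDiff.of_le hj), abs_mul, Real.rpow_one]
  have h2 := hK () trivial (Real.sqrt c * x)
  have h3 : Real.exp (-(3 / 4) * (Real.sqrt c * |x|)) ≤ Real.exp (-(1 / 2) * muDecay m lam * |x|) :=
    Real.exp_le_exp.2 (by nlinarith [abs_nonneg x])
  have h4 : 1 ≤ 1 + |x| := by linarith [abs_nonneg x]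
  simp only [abs_mul, abs_pow, abs_of_nonneg hσ0] at h2 ⊢
  calc _ ≤ |k| * (Real.sqrt c ^ j * (|K| * Real.exp (-(1 / 2) * muDecay m lam * |x|))) := by
        gcongr
        refine h2.trans ?_
        exact (mul_le_mul_of_nonneg_right (le_abs_self K) (Real.exp_pos _).le).trans (by gcongr)
    _ = (|k| * Real.sqrt c ^ j * |K| + 0) * 1 * Real.exp (-(1 / 2) * muDecay m lam * |x|) := by ring
    _ ≤ _ := by
      gcongr
      exact zero_le_one

theorem corA_tendsto_atBot (hm : m = 2 ∨ m = 3 ∨ m = 4) (hX : X.Solves m) {c : ℝ} (hc : 0 < c) :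
    ∃ l : ℝ, Tendsto (corA m X lam c) atBot (𝓝 l) ∧ (3 * lambda0 m * c ≠ lam → l ≠ 0) := by
  have hm2 : 2 ≤ m := by omega
  have h5 : (5 : ℝ) - m ≠ 0 := by
    rcases hm with rfl | rfl | rfl <;> norm_num
  have hQ := integral_Q_pos hm2
  have ht := (hX.tailX.add (hX.tailY.const_mul (lam / c))).cast (α' := 0)
    (β' := (∫ x, Q m x) / (5 - m) * (3 * lambda0 m - lam / c)) (by ring) (by ring)
  have h1 : Tendsto (polyU X.UA (lam / c)) atBot
      (𝓝 ((∫ x, Q m x) / (5 - m) * (3 * lambda0 m - lam / c))) :=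
    (ht.tendsto_atBot hm2).congr fun x => (polyU_UA X _ x).symm
  refine ⟨_, (h1.comp (tendsto_id.const_mul_atBot (Real.sqrt_pos.2 hc))).const_mul _, fun hne h => ?_⟩
  have hk := (Real.rpow_pos_of_pos hc (1 / ((m : ℝ) - 1) - 1 / 2)).ne'
  rcases mul_eq_zero.1 ((mul_eq_zero.1 h).resolve_left hk) with h2 | h2
  · exact div_ne_zero hQ.ne' h5 h2
  · apply hne
    field_simp at h2
    linarith

theorem integral_mul_polyU {f : ℝ → ℝ} (hf : Loc f) (hU : ∀ k, ∃ α b, Tail m α b (U k))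
    (h : ∀ k, ∫ x, f x * U k x = 0) (l : ℝ) : ∫ x, f x * polyU U l x = 0 := by
  have hi : ∀ k, Integrable fun x => f x * U k x := fun k => by
    obtain ⟨_, _, hk⟩ := hU k
    exact (hf.mul_tail hk).integrable
  have : (fun x => f x * polyU U l x)
      = fun x => (f x * U 0 x + l * (f x * U 1 x)) + l ^ 2 * (f x * U 2 x) := funext fun x => by
    rw [polyU_eq]; ring
  have h01 : Integrable fun x => f x * U 0 x + l * (f x * U 1 x) := (hi 0).add ((hi 1).const_mul l)
  rw [this, integral_add h01 ((hi 2).const_mul _),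
    integral_add (hi 0) ((hi 1).const_mul l), integral_const_mul, integral_const_mul, h, h, h]
  ring

/-- Orthogonality to `Q` and `x Q` is preserved by scaling. -/
theorem integral_Qc_mul_prof (hm : 2 ≤ m) (hU : ∀ k, ∃ α b, Tail m α b (U k))
    (h : ∀ k, ∫ x, Q m x * U k x = 0) (h' : ∀ k, ∫ x, x * Q m x * U k x = 0) (r : ℝ) {c : ℝ} (hc : 0 < c) :
    ∫ y, Qc m c y * prof U r lam c y = 0 ∧ ∫ y, y * Qc m c y * prof U r lam c y = 0 := by
  have hσ := Real.sqrt_pos.2 hc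
  have h1 := integral_mul_polyU (loc_Q hm) hU h (lam / c)
  have h2 := integral_mul_polyU (loc_Q hm).id_mul hU h' (lam / c)
  have e1 := Measure.integral_comp_mul_left (fun x => Q m x * polyU U (lam / c) x) (Real.sqrt c)
  have e2 := Measure.integral_comp_mul_left (fun x => x * Q m x * polyU U (lam / c) x) (Real.sqrt c)
  rw [h1, smul_zero] at e1
  rw [h2, smul_zero] at e2
  constructor
  · rw [show (fun y => Qc m c y * prof U r lam c y) = fun y => c ^ (1 / ((m : ℝ) - 1)) * c ^ r
      * (Q m (Real.sqrt c * y) * polyU U (lam / c) (Real.sqrt c * y)) from funext fun y => by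
        unfold Qc prof; ring, integral_const_mul, e1, mul_zero]
  · rw [show (fun y => y * Qc m c y * prof U r lam c y)
      = fun y => c ^ (1 / ((m : ℝ) - 1)) * c ^ r / Real.sqrt c
      * (Real.sqrt c * y * Q m (Real.sqrt c * y) * polyU U (lam / c) (Real.sqrt c * y)) from
        funext fun y => by
          unfold Qc prof; field_simp, integral_const_mul, e2, mul_zero]

theorem integral_Qc_mul_corA (hm : 2 ≤ m) (hX : X.Solves m) {c : ℝ} (hc : 0 < c) :
    ∫ y, Qc m c y * corA m X lam c y = 0 ∧ ∫ y, y * Qc m c y * corA m X lam c y = 0 := by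
  refine integral_Qc_mul_prof hm (fun k => ⟨0, hX.tailUA k⟩) (fun k => ?_)
    (fun k => ?_) _ hc
  · fin_cases k
    · exact hX.orthX
    · exact hX.orthY
    · simp [Profiles.UA]
  · fin_cases k
    · exact hX.orthX'
    · exact hX.orthY'
    · simp [Profiles.UA]

theorem integral_Qc_mul_corB (hX : X.Solves 3) {c : ℝ} (hc : 0 < c) (s : ℝ) :
    ∫ y, Qc 3 c y * corB 3 X a lam c s y = 0 ∧ ∫ y, y * Qc 3 c y * corB 3 X a lam c s y = 0 := by
  -- both profiles are put into one family with coefficients that depend on `s`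
  set V : Fin 3 → ℝ → ℝ := fun k x => (slope a s ^ 2 * X.U₁ k x + bend a s * X.U₂ k x) / aTilde 3 a s
  have hV : ∀ k, ∃ α b, Tail 3 α b (V k) := fun k => by
    obtain ⟨_, _, h1⟩ := hX.tail₁ k
    obtain ⟨_, _, h2⟩ := hX.tail₂ k
    exact ⟨_, _, (((h1.const_mul (slope a s ^ 2)).add (h2.const_mul (bend a s))).const_mul
      (aTilde 3 a s)⁻¹).congr fun x => by simp only [V]; ring⟩
  have hi : ∀ {f : ℝ → ℝ}, Loc f → (∀ k, ∫ x, f x * X.U₁ k x = 0) → (∀ k, ∫ x, f x * X.U₂ k x = 0) →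
      ∀ k, ∫ x, f x * V k x = 0 := fun {f} hf h1 h2 k => by
    obtain ⟨_, _, t1⟩ := hX.tail₁ k
    obtain ⟨_, _, t2⟩ := hX.tail₂ k
    rw [show (fun x => f x * V k x) = fun x => slope a s ^ 2 / aTilde 3 a s * (f x * X.U₁ k x)
      + bend a s / aTilde 3 a s * (f x * X.U₂ k x) from funext fun x => by simp only [V]; ring,
      integral_add ((hf.mul_tail t1).integrable.const_mul _) ((hf.mul_tail t2).integrable.const_mul _),
      integral_const_mul, integral_const_mul, h1, h2]
    ring
  have hB : corB 3 X a lam c s = prof V (1 / (((3 : ℕ) : ℝ) - 1) - 1) lam c := funext fun y => by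
    simp only [corB, prof, polyU_eq, V]
    ring
  rw [hB]
  have hQ := loc_Q two_le_three
  exact integral_Qc_mul_prof two_le_three hV (hi hQ (hX.orth₁ rfl) (hX.orth₂ rfl))
    (hi hQ.id_mul (hX.orth₁' rfl) (hX.orth₂' rfl)) _ hc

end

section
variable {m : ℕ} {X : Profiles} {a : ℝ → ℝ} {lam : ℝ} {U : Fin 3 → ℝ → ℝ} {K γ : ℝ}

theorem PotBound.abs_combination_le (hm : 2 ≤ m) (h : PotBound a K γ) (ha : IsPotential m a) (s u v : ℝ) :
    |(slope a s ^ 2 * u + bend a s * v) / aTilde m a s|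
      ≤ (K ^ 2 * |u| + K * |v|) * Real.exp (-γ * |s|) := by
  have hT := one_le_aTilde hm ha s
  have h1 := h.slope_le s
  have h2 := h.bend_le s
  have hη : Real.exp (-γ * |s|) ≤ 1 := Real.exp_le_one_iff.2 (by
    have := mul_nonneg h.pos.le (abs_nonneg s)
    linarith)
  have hη0 := Real.exp_pos (-γ * |s|)
  have h3 : |slope a s| ^ 2 ≤ K ^ 2 * Real.exp (-γ * |s|) :=
    calc |slope a s| ^ 2 ≤ (K * Real.exp (-γ * |s|)) ^ 2 := by gcongr
      _ = K ^ 2 * (Real.exp (-γ * |s|) * Real.exp (-γ * |s|)) := by ring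
      _ ≤ K ^ 2 * Real.exp (-γ * |s|) := by
        gcongr
        exact mul_le_of_le_one_left hη0.le hη
  rw [abs_div, abs_of_pos (by linarith : 0 < aTilde m a s)]
  refine (div_le_self (abs_nonneg _) hT).trans ((abs_add_le _ _).trans ?_)
  rw [abs_mul, abs_mul, abs_pow]
  calc _ ≤ K ^ 2 * Real.exp (-γ * |s|) * |u| + K * Real.exp (-γ * |s|) * |v| := by gcongr
    _ = _ := by ring

theorem fam_deriv_of_tail (hm : 2 ≤ m) (hU : ∀ q, ∃ α b, Tail m α b (U q)) (c₀ : ℝ) :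
    Fam 0 (1 / c₀) 0 0 0 0 0 0 fun p z => polyU (fun k => deriv (U k)) p.l z :=
  fam_polyU fun q => by
    obtain ⟨_, _, h⟩ := hU q
    exact (h.deriv hm).fam_zero hm

theorem corB_bounds {c₀ M : ℝ} (hm : 2 ≤ m) (hX : X.Solves m) (h : PotBound a K γ)
    (ha : IsPotential m a) (h0 : 0 < c₀) (hlam : |lam| ≤ 1) :
    ∃ K', 0 ≤ K' ∧ ∀ c, c₀ ≤ c → c ≤ M → ∀ s, ∀ y,
      DifferentiableAt ℝ (corB m X a lam c s) y ∧
      |deriv (corB m X a lam c s) y| ≤ K' ∧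
      (0 ≤ y → |corB m X a lam c s y|
        ≤ K' * Real.exp (-(Real.sqrt c₀ / 2) * y) * Real.exp (-γ * |s|)) ∧
      DifferentiableAt ℝ (fun c => corB m X a lam c s y) c ∧
      (y ≤ -1 → |corB m X a lam c s y| + |deriv (fun c => corB m X a lam c s y) c|
        ≤ K' * |y| * Real.exp (-γ * |s|)) := by
  have hs : ∀ {U : Fin 3 → ℝ → ℝ}, (∀ q, ∃ α b, Tail m α b (U q)) → ∀ r q, ∃ α b,
      Tail m α b (scaleU r U q) := fun hU r q => by
    obtain ⟨_, _, h⟩ := hU q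
    exact ⟨_, _, h.scaleU hm r⟩
  set r : ℝ := 1 / ((m : ℝ) - 1) - 1
  obtain ⟨K₁, hK₁0, hK₁⟩ := exists_prof_bound (lam := lam) (M := M) h0 hlam
    (fam_polyU_of_tail hm le_rfl hX.tail₁) r
  obtain ⟨K₂, hK₂0, hK₂⟩ := exists_prof_bound (lam := lam) (M := M) h0 hlam
    (fam_polyU_of_tail hm le_rfl hX.tail₂) r
  obtain ⟨K₃, hK₃0, hK₃⟩ := exists_prof_bound (lam := lam) (M := M) h0 hlam
    (fam_polyU_of_tail hm le_rfl (hs hX.tail₁ r)) (r - 1)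
  obtain ⟨K₄, hK₄0, hK₄⟩ := exists_prof_bound (lam := lam) (M := M) h0 hlam
    (fam_polyU_of_tail hm le_rfl (hs hX.tail₂ r)) (r - 1)
  obtain ⟨K₅, hK₅0, hK₅⟩ := exists_prof_bound (lam := lam) (M := M) h0 hlam
    (fam_deriv_of_tail hm hX.tail₁ c₀) (r + 1 / 2)
  obtain ⟨K₆, hK₆0, hK₆⟩ := exists_prof_bound (lam := lam) (M := M) h0 hlam
    (fam_deriv_of_tail hm hX.tail₂ c₀) (r + 1 / 2)
  have hK := h.K_nonneg
  have hγ := h.pos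
  refine ⟨K ^ 2 * K₁ + K * K₂ + 2 * (K ^ 2 * K₁ + K * K₂ + (K ^ 2 * K₃ + K * K₄))
    + (K ^ 2 * K₅ + K * K₆), by positivity, fun c h1 h2 s y => ?_⟩
  have hc := h0.trans_le h1
  have hη : Real.exp (-γ * |s|) ≤ 1 := Real.exp_le_one_iff.2 (by
    have := mul_nonneg hγ.le (abs_nonneg s)
    linarith)
  have hdy : HasDerivAt (corB m X a lam c s) _ y :=
    (((hasDerivAt_prof_pos hX.differentiable_U₁ r lam hc y).const_mul (slope a s ^ 2)).fun_add
      ((hasDerivAt_prof_pos hX.differentiable_U₂ r lam hc y).const_mul (bend a s))).div_const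
        (aTilde m a s)
  have hdc : HasDerivAt (fun c => corB m X a lam c s y) _ c :=
    (((hasDerivAt_prof_scale hX.differentiable_U₁ r lam hc y).const_mul (slope a s ^ 2)).fun_add
      ((hasDerivAt_prof_scale hX.differentiable_U₂ r lam hc y).const_mul (bend a s))).div_const
        (aTilde m a s)
  have hexp : Real.exp (-(Real.sqrt c₀ / 2) * max y 0) ≤ 1 := Real.exp_le_one_iff.2 (by
      have := mul_nonneg (Real.sqrt_nonneg c₀) (le_max_right y 0)
      linarith)
  refine ⟨hdy.differentiableAt, ?_, fun hy => ?_, hdc.differentiableAt, fun hy => ?_⟩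
  · rw [hdy.deriv]
    refine (h.abs_combination_le hm ha s _ _).trans ?_
    have e1 := hK₅ c h1 h2 y
    have e2 := hK₆ c h1 h2 y
    rw [pow_zero, one_mul] at e1 e2
    calc _ ≤ (K ^ 2 * (K₅ * 1) + K * (K₆ * 1)) * 1 := by
          gcongr
          · exact e1.trans (by gcongr)
          · exact e2.trans (by gcongr)
      _ = K ^ 2 * K₅ + K * K₆ := by ring
      _ ≤ _ := le_add_of_nonneg_left (by positivity)
  · have e1 := hK₁ c h1 h2 y
    have e2 := hK₂ c h1 h2 y
    rw [max_eq_left hy, max_eq_right (by linarith), add_zero, one_pow, one_mul] at e1 e2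
    refine (h.abs_combination_le hm ha s _ _).trans ?_
    calc _ ≤ (K ^ 2 * (K₁ * Real.exp (-(Real.sqrt c₀ / 2) * y))
          + K * (K₂ * Real.exp (-(Real.sqrt c₀ / 2) * y))) * Real.exp (-γ * |s|) := by gcongr
      _ = (K ^ 2 * K₁ + K * K₂) * Real.exp (-(Real.sqrt c₀ / 2) * y) * Real.exp (-γ * |s|) := by ring
      _ ≤ _ := by
        refine mul_le_mul_of_nonneg_right (mul_le_mul_of_nonneg_right ?_ (Real.exp_pos _).le)
          (Real.exp_pos _).le
        rw [add_assoc]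
        exact le_add_of_nonneg_right (by positivity)
  · have hy' : |y| = -y := abs_of_nonpos (by linarith)
    have e1 := hK₁ c h1 h2 y
    have e2 := hK₂ c h1 h2 y
    have e3 := hK₃ c h1 h2 y
    have e4 := hK₄ c h1 h2 y
    rw [max_eq_right (by linarith : y ≤ 0), mul_zero, Real.exp_zero, mul_one, pow_one,
      max_eq_left (by linarith : 0 ≤ -y)] at e1 e2 e3 e4
    have e5 : 1 + -y ≤ 2 * |y| := by rw [hy']; linarith
    rw [hdc.deriv]
    refine (add_le_add (h.abs_combination_le hm ha s _ _) (h.abs_combination_le hm ha s _ _)).trans ?_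
    calc _ ≤ (K ^ 2 * (K₁ * (2 * |y|)) + K * (K₂ * (2 * |y|))) * Real.exp (-γ * |s|)
          + (K ^ 2 * (K₃ * (2 * |y|)) + K * (K₄ * (2 * |y|))) * Real.exp (-γ * |s|) := by
          gcongr
          · exact e1.trans (by gcongr)
          · exact e2.trans (by gcongr)
          · exact e3.trans (by gcongr)
          · exact e4.trans (by gcongr)
      _ = (2 * (K ^ 2 * K₁ + K * K₂ + (K ^ 2 * K₃ + K * K₄))) * |y| * Real.exp (-γ * |s|) := by ring
      _ ≤ _ := by
        gcongr
        have : 0 ≤ K ^ 2 * K₁ + K * K₂ := by positivity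
        have : 0 ≤ K ^ 2 * K₅ + K * K₆ := by positivity
        linarith

theorem exists_polyG_bound {c₀ : ℝ} (h0 : 0 < c₀) (hlam : |lam| ≤ 1) (G : Fin 3 → ℝ) :
    ∃ K, 0 ≤ K ∧ ∀ c, c₀ ≤ c → |polyG G (lam / c)| ≤ K := by
  obtain ⟨K, hK⟩ := (sca_polyG (γ := 0) (L := 1 / c₀) (M := 0) (d := 0) G).bound
  refine ⟨max K 0, le_max_right _ _, fun c hc => le_max_of_le_left ?_⟩
  have hl : |lam / c| ≤ 1 / c₀ := by
    rw [abs_div, abs_of_pos (h0.trans_le hc)]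
    exact div_le_div₀ zero_le_one hlam h0 hc
  simpa [scaWt] using hK ⟨1, lam / c, 0, 0⟩ ⟨one_pos, le_rfl, hl, by simp⟩ 0

theorem exists_qCoef_bound (hm : 2 ≤ m) (h : PotBound a K γ) (ha : IsPotential m a) :
    ∃ K', 0 ≤ K' ∧ ∀ ε r, |qCoef m a ε r| ≤ K' * ε ^ 2 * Real.exp (-γ * |ε * r|) := by
  obtain ⟨K', hK'⟩ := (h.sca_dSlope (m := m) (L := 0) (M := 0) (d := 0)).bound
  refine ⟨|K'|, abs_nonneg _, fun ε r => ?_⟩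
  have h1 := hK' ⟨1, 0, ε * r, 0⟩ ⟨one_pos, le_rfl, by simp, by simp⟩ 0
  simp only [scaWt, pow_zero, pow_one, one_mul] at h1
  have hT := one_le_aTilde hm ha (ε * r)
  rw [qCoef, abs_div, abs_of_pos (by linarith : 0 < aTilde m a (ε * r))]
  refine (div_le_self (abs_nonneg _) hT).trans ?_
  rw [abs_mul, abs_of_nonneg (sq_nonneg ε)]
  have h2 := mul_le_mul_of_nonneg_right (le_abs_self K') (Real.exp_pos (-γ * |ε * r|)).le
  nlinarith [sq_nonneg ε]

/-! ### Estimates of the remainder -/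

theorem remS_bounds {c₀ M : ℝ} {n : ℕ} (hm : 2 ≤ m) (ha : IsPotential m a)
    (h0 : 0 < c₀) (hM : 0 ≤ M) (hlam : |lam| ≤ 1)
    (herr : Fam γ (1 / c₀) (M / c₀) 1 (n + 2) 1 n 4 (err m X a)) :
    ∃ K', 0 ≤ K' ∧ ∀ ε c r v, 0 < ε → ε ≤ Real.sqrt c₀ → c₀ ≤ c → c ≤ M → |v| ≤ M →
      ContDiff ℝ 1 (remS m X a lam ε c r v) ∧ ∀ x,
      |remS m X a lam ε c r v x| + |deriv (remS m X a lam ε c r v) x|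
        ≤ K' * (ε ^ (n + 2) * Real.exp (-γ * |ε * r|)) * ((1 + max (-(x - r)) 0) ^ n
          * (1 + ε * max (-(x - r)) 0) ^ 4 * Real.exp (-(Real.sqrt c₀ / 2) * max (x - r) 0)) := by
  obtain ⟨K₀, hK₀⟩ := herr.bound
  obtain ⟨K₁, hK₁⟩ := (herr.deriv (d := 0)).bound
  obtain ⟨K₂, hK₂0, hK₂⟩ := exists_rpow_le h0 M (1 / ((m : ℝ) - 1))
  have hσ₀ := Real.sqrt_pos.2 h0
  have hσM := Real.sqrt_nonneg M
  refine ⟨K₂ * Real.sqrt M ^ 3 * (|K₀| + Real.sqrt M * |K₁|) * ((Real.sqrt c₀)⁻¹ ^ (n + 2)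
    * (1 + Real.sqrt M) ^ n), by positivity, fun ε c r v hε hε1 hc hcM hv => ?_⟩
  have hc0 := h0.trans_le hc
  have e3 : Real.sqrt c ≤ Real.sqrt M := Real.sqrt_le_sqrt hcM
  have e4 : Real.sqrt c₀ ≤ Real.sqrt c := Real.sqrt_le_sqrt hc
  have hσ := Real.sqrt_pos.2 hc0
  have hp : par lam ε c r v ∈ parSet (1 / c₀) (M / c₀) := by
    refine ⟨by simp only [par]; positivity, (div_le_one hσ).2 (hε1.trans e4), ?_, ?_⟩
    · simp only [par]
      rw [abs_div, abs_of_pos hc0]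
      exact div_le_div₀ zero_le_one hlam h0 hc
    · simp only [par]
      rw [abs_div, abs_of_pos hc0]
      exact div_le_div₀ hM hv h0 hc
  have hT := one_le_aTilde hm ha (ε * r)
  set k := c ^ (1 / ((m : ℝ) - 1)) * Real.sqrt c ^ 3 / aTilde m a (ε * r) with hk
  have hk0 : 0 ≤ k := by positivity
  have hkK : k ≤ K₂ * Real.sqrt M ^ 3 := by
    rw [hk]
    refine (div_le_self (by positivity) hT).trans ?_
    gcongr
    exact hK₂ c hc hcM
  constructor
  · exact contDiff_const.mul ((herr.contDiff hp).comp
      (contDiff_const.mul (contDiff_id.sub contDiff_const)))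
  intro x
  have hd : deriv (remS m X a lam ε c r v) x
      = k * Real.sqrt c * deriv (err m X a (par lam ε c r v)) (Real.sqrt c * (x - r)) :=
    deriv_scaled _ _ _ _ _
  have h1 := hK₀ _ hp (Real.sqrt c * (x - r))
  have h2 := hK₁ _ hp (Real.sqrt c * (x - r))
  set Wt := famWt γ (n + 2) 1 n 4 (par lam ε c r v) (Real.sqrt c * (x - r)) with hWt
  have hW0 : 0 ≤ Wt := famWt_nonneg hp _
  have f1 : (0 : ℝ) ≤ max (-(x - r)) 0 := le_max_right _ _
  have f2 : (0 : ℝ) ≤ max (x - r) 0 := le_max_right _ _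
  have hW : Wt ≤ (Real.sqrt c₀)⁻¹ ^ (n + 2) * (1 + Real.sqrt M) ^ n
      * ((ε ^ (n + 2) * Real.exp (-γ * |ε * r|)) * ((1 + max (-(x - r)) 0) ^ n
          * (1 + ε * max (-(x - r)) 0) ^ 4 * Real.exp (-(Real.sqrt c₀ / 2) * max (x - r) 0))) := by
    have e6 : 1 + Real.sqrt c * max (-(x - r)) 0 ≤ (1 + Real.sqrt M) * (1 + max (-(x - r)) 0) := by
      nlinarith
    have e7 : Real.exp (-(1 / 2) * (Real.sqrt c * max (x - r) 0))
        ≤ Real.exp (-(Real.sqrt c₀ / 2) * max (x - r) 0) := Real.exp_le_exp.2 (by nlinarith)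
    have e8 : ε / Real.sqrt c ≤ (Real.sqrt c₀)⁻¹ * ε := by
      rw [div_eq_inv_mul]
      gcongr
    have e9 : ε / Real.sqrt c * (Real.sqrt c * max (-(x - r)) 0) = ε * max (-(x - r)) 0 := by
      field_simp
    rw [hWt, famWt, scaWt, ← mul_neg, max_sqrt_mul, max_sqrt_mul]
    simp only [par, e9, pow_one]
    calc _ ≤ ((Real.sqrt c₀)⁻¹ * ε) ^ (n + 2) * Real.exp (-γ * |ε * r|) *
          (((1 + Real.sqrt M) * (1 + max (-(x - r)) 0)) ^ n * (1 + ε * max (-(x - r)) 0) ^ 4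
            * Real.exp (-(Real.sqrt c₀ / 2) * max (x - r) 0)) := by gcongr
      _ = _ := by rw [mul_pow, mul_pow]; ring
  have g1 : |remS m X a lam ε c r v x| ≤ K₂ * Real.sqrt M ^ 3 * (|K₀| * Wt) := by
    rw [remS, abs_mul, abs_of_nonneg hk0]
    gcongr
    exact h1.trans (mul_le_mul_of_nonneg_right (le_abs_self _) hW0)
  have g2 : |deriv (remS m X a lam ε c r v) x| ≤ K₂ * Real.sqrt M ^ 3 * Real.sqrt M * (|K₁| * Wt) := by
    rw [hd, abs_mul, abs_of_nonneg (mul_nonneg hk0 hσ.le)]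
    gcongr
    exact h2.trans (mul_le_mul_of_nonneg_right (le_abs_self _) hW0)
  calc _ ≤ K₂ * Real.sqrt M ^ 3 * (|K₀| + Real.sqrt M * |K₁|) * Wt := by linarith
    _ ≤ _ := by
      have := mul_le_mul_of_nonneg_left hW
        (by positivity : 0 ≤ K₂ * Real.sqrt M ^ 3 * (|K₀| + Real.sqrt M * |K₁|))
      refine this.trans_eq ?_
      ring

/-- The half-line `y ≥ -3 / ε` contributes a factor `ε ^ (-1 / 2)` to the `L²` norm. -/
theorem eLpNorm_le_of_bound {F : ℝ → ℝ} {D δ ε r : ℝ} (hD : 0 ≤ D) (hε : 0 < ε) (hεδ : ε ≤ 2 * δ)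
    (hF : ∀ x, -3 / ε ≤ x - r → |F x| ≤ D * Real.exp (-δ * max (x - r) 0)) :
    eLpNorm F 2 (volume.restrict {x | -3 / ε ≤ x - r})
      ≤ ENNReal.ofReal (Real.exp (3 / 2) * Real.sqrt (∫ x, Real.exp (-1 * |x|))
        * (D * ε ^ (-(1 / 2) : ℝ))) := by
  set g : ℝ → ℝ := fun x => D * Real.exp (3 / 2) * Real.exp (-(ε / 2) * |x - r|) with hg
  have hS : MeasurableSet {x | -3 / ε ≤ x - r} := measurableSet_le measurable_const (by fun_prop)
  have h1 : eLpNorm F 2 (volume.restrict {x | -3 / ε ≤ x - r})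
      ≤ eLpNorm g 2 (volume.restrict {x | -3 / ε ≤ x - r}) := by
    refine eLpNorm_mono_ae_real (ae_restrict_of_forall_mem hS fun x hx => (hF x hx).trans ?_)
    rw [hg]
    simp only
    rw [mul_assoc, ← Real.exp_add]
    gcongr
    rcases le_total 0 (x - r) with h | h
    · rw [max_eq_left h, abs_of_nonneg h]
      nlinarith
    · rw [max_eq_right h, abs_of_nonpos h]
      have : -3 / ε ≤ x - r := hx
      rw [div_le_iff₀ hε] at this
      linarith
  have hsq : ∀ x, g x ^ 2 = (D * Real.exp (3 / 2)) ^ 2 * Real.exp (-1 * |ε * (x - r)|) := fun x => by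
    rw [hg]
    simp only
    rw [mul_pow, ← Real.exp_nat_mul, abs_mul, abs_of_pos hε]
    congr 2
    push_cast
    ring
  have hi : Integrable fun x : ℝ => Real.exp (-1 * |x|) := integrable_exp_neg_mul_abs one_pos
  have hi2 : Integrable fun x => g x ^ 2 := by
    simp only [hsq]
    exact ((hi.comp_mul_left' hε.ne').comp_sub_right r).const_mul _
  have hmem : MemLp g 2 volume := (memLp_two_iff_integrable_sq (by
    have : Continuous g := by fun_prop
    exact this.aestronglyMeasurable)).2 hi2
  refine h1.trans ((eLpNorm_mono_measure g Measure.restrict_le_self).trans ?_)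
  rw [hmem.eLpNorm_eq_integral_rpow_norm (by norm_num) (by norm_num)]
  refine ENNReal.ofReal_le_ofReal (le_of_eq ?_)
  have e1 : ∫ x, ‖g x‖ ^ (2 : ENNReal).toReal
      = (D * Real.exp (3 / 2)) ^ 2 * (ε⁻¹ * ∫ x, Real.exp (-1 * |x|)) := by
    have : ∀ x, ‖g x‖ ^ (2 : ENNReal).toReal = g x ^ 2 := fun x => by
      rw [ENNReal.toReal_ofNat, Real.norm_eq_abs, Real.rpow_two, sq_abs]
    simp only [this, hsq]
    rw [integral_const_mul, integral_sub_right_eq_self (fun x => Real.exp (-1 * |ε * x|)) r,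
      Measure.integral_comp_mul_left (fun x => Real.exp (-1 * |x|)) ε, smul_eq_mul,
      abs_of_pos (inv_pos.2 hε)]
  have hI : 0 ≤ ∫ x, Real.exp (-1 * |x|) := integral_nonneg fun x => (Real.exp_pos _).le
  rw [e1, ENNReal.toReal_ofNat, show (2 : ℝ)⁻¹ = 1 / 2 by norm_num, ← Real.sqrt_eq_rpow, Real.sqrt_mul (by positivity),
    Real.sqrt_sq (by positivity), Real.sqrt_mul (by positivity), Real.rpow_neg hε.le,
    ← Real.sqrt_eq_rpow, Real.sqrt_inv]
  ring

theorem abs_integral_add_le {f g : ℝ → ℝ} {r δ D : ℝ} (hδ : 0 < δ)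
    (h : ∀ x, |f x| + |g x| ≤ D * Real.exp (-δ * |x - r|)) :
    |∫ x, f x| + |∫ x, g x| ≤ 2 * D * ∫ x, Real.exp (-δ * |x|) := by
  have hi : Integrable fun x => D * Real.exp (-δ * |x - r|) :=
    ((integrable_exp_neg_mul_abs hδ).comp_sub_right r).const_mul D
  have e : ∫ x, D * Real.exp (-δ * |x - r|) = D * ∫ x, Real.exp (-δ * |x|) := by
    rw [integral_const_mul, integral_sub_right_eq_self (fun x => Real.exp (-δ * |x|)) r]
  have h1 := norm_integral_le_of_norm_le hi (Eventually.of_forall fun x =>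
    (le_add_of_nonneg_right (abs_nonneg (g x))).trans (h x) : ∀ᵐ x, ‖f x‖ ≤ _)
  have h2 := norm_integral_le_of_norm_le hi (Eventually.of_forall fun x =>
    (le_add_of_nonneg_left (abs_nonneg (f x))).trans (h x) : ∀ᵐ x, ‖g x‖ ≤ _)
  rw [e, Real.norm_eq_abs] at h1 h2
  linarith

theorem exists_Qc_bound {c₀ : ℝ} (hm : 2 ≤ m) (h0 : 0 < c₀) (M : ℝ) :
    ∃ K, 0 ≤ K ∧ ∀ c, c₀ ≤ c → c ≤ M → ∀ y,
      (1 + |y|) ^ 6 * |Qc m c y| ≤ K * Real.exp (-(Real.sqrt c₀ / 2) * |y|) := by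
  obtain ⟨K₁, hK₁⟩ := (loc_Q hm).bound (κ := 3 / 4) (by norm_num)
  obtain ⟨K₂, hK₂0, hK₂⟩ := exists_rpow_le h0 M (1 / ((m : ℝ) - 1))
  have hσ₀ := Real.sqrt_pos.2 h0
  obtain ⟨K₃, hK₃0, hK₃⟩ := exists_one_add_pow_le_exp 6 (δ := Real.sqrt c₀ / 4) (by positivity)
  refine ⟨K₃ * (K₂ * |K₁|), by positivity, fun c h1 h2 y => ?_⟩
  have hc := h0.trans_le h1
  have e4 : Real.sqrt c₀ ≤ Real.sqrt c := Real.sqrt_le_sqrt h1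
  have h3 : |Qc m c y| ≤ K₂ * (|K₁| * Real.exp (-(3 / 4 * Real.sqrt c₀) * |y|)) := by
    rw [Qc, abs_mul, abs_of_pos (Real.rpow_pos_of_pos hc _)]
    gcongr
    · exact hK₂ c h1 h2
    · refine (hK₁ _).trans ?_
      rw [abs_mul, abs_of_nonneg (Real.sqrt_nonneg c)]
      refine (mul_le_mul_of_nonneg_right (le_abs_self K₁) (Real.exp_pos _).le).trans ?_
      refine mul_le_mul_of_nonneg_left (Real.exp_le_exp.2 ?_) (abs_nonneg K₁)
      nlinarith [abs_nonneg y]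
  calc _ ≤ K₃ * Real.exp (Real.sqrt c₀ / 4 * |y|)
        * (K₂ * (|K₁| * Real.exp (-(3 / 4 * Real.sqrt c₀) * |y|))) := by
        gcongr
        exact hK₃ _ (abs_nonneg y)
    _ = K₃ * (K₂ * |K₁|) * (Real.exp (Real.sqrt c₀ / 4 * |y|)
        * Real.exp (-(3 / 4 * Real.sqrt c₀) * |y|)) := by ring
    _ = _ := by rw [← Real.exp_add]; ring_nf

end

section
variable {m : ℕ} {X : Profiles} {a : ℝ → ℝ} {lam γ : ℝ}

theorem remS_estimates {c₀ M : ℝ} {n : ℕ} (hn : n ≤ 1) (hm : 2 ≤ m) (ha : IsPotential m a)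
    (hγ : 0 ≤ γ) (h0 : 0 < c₀) (hM : 0 ≤ M) (hlam : |lam| ≤ 1)
    (herr : Fam γ (1 / c₀) (M / c₀) 1 (n + 2) 1 n 4 (err m X a)) :
    ∃ K, 0 ≤ K ∧ ∀ ε c r v, 0 < ε → ε ≤ 1 → ε ≤ Real.sqrt c₀ → c₀ ≤ c → c ≤ M → |v| ≤ M →
      ContDiff ℝ 1 (remS m X a lam ε c r v) ∧
      (∀ x, x - r ≤ 0 → |remS m X a lam ε c r v x| ≤ K * (1 + |x - r|) ^ 5) ∧
      (∀ x, 0 ≤ x - r →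
        |remS m X a lam ε c r v x| ≤ K * Real.exp (-(Real.sqrt c₀ / 2) * (x - r))) ∧
      eLpNorm (remS m X a lam ε c r v) 2 (volume.restrict {x | -3 / ε ≤ x - r})
          + eLpNorm (deriv (remS m X a lam ε c r v)) 2 (volume.restrict {x | -3 / ε ≤ x - r})
        ≤ ENNReal.ofReal (K * ε ^ (3 / 2 : ℝ) * Real.exp (-γ * |ε * r|)) ∧
      |∫ x, Qc m c (x - r) * remS m X a lam ε c r v x|
          + |∫ x, (x - r) * Qc m c (x - r) * remS m X a lam ε c r v x|
        ≤ K * ε ^ (n + 2) * Real.exp (-γ * |ε * r|) := by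
  obtain ⟨K₁, hK₁0, hK₁⟩ := remS_bounds (a := a) hm ha h0 hM hlam herr
  obtain ⟨K₂, hK₂0, hK₂⟩ := exists_Qc_bound (m := m) hm h0 M
  have hσ₀ := Real.sqrt_pos.2 h0
  set I₁ := Real.exp (3 / 2) * Real.sqrt (∫ x, Real.exp (-1 * |x|)) with hI₁
  set I₂ := ∫ x, Real.exp (-(Real.sqrt c₀ / 2) * |x|) with hI₂
  have hI₁0 : 0 ≤ I₁ := by positivity
  have hI₂0 : 0 ≤ I₂ := integral_nonneg fun x => (Real.exp_pos _).le
  refine ⟨K₁ + 2 * (I₁ * (K₁ * (256 * 4 ^ n))) + 2 * (K₂ * K₁) * I₂, by positivity,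
    fun ε c r v hε hε1 hεσ hc hcM hv => ?_⟩
  obtain ⟨hcd, hb⟩ := hK₁ ε c r v hε hεσ hc hcM hv
  set F := remS m X a lam ε c r v
  set η := Real.exp (-γ * |ε * r|) with hη
  have hη0 : 0 < η := Real.exp_pos _
  have hη1 : η ≤ 1 := Real.exp_le_one_iff.2 (by
    have := mul_nonneg hγ (abs_nonneg (ε * r))
    linarith)
  have hεn : ε ^ (n + 2) ≤ 1 := pow_le_one₀ hε.le hε1
  have hεη : ε ^ (n + 2) * η ≤ 1 := mul_le_one₀ hεn hη0.le hη1
  have hpow : ∀ x, (1 + max (-(x - r)) 0) ^ n * (1 + ε * max (-(x - r)) 0) ^ 4 ≤ (1 + |x - r|) ^ 5 :=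
    fun x => by
      have e1 : max (-(x - r)) 0 ≤ |x - r| := max_le (neg_le_abs _) (abs_nonneg _)
      have e2 : (0 : ℝ) ≤ max (-(x - r)) 0 := le_max_right _ _
      have e3 : ε * max (-(x - r)) 0 ≤ |x - r| := (mul_le_of_le_one_left e2 hε1).trans e1
      calc _ ≤ (1 + |x - r|) ^ n * (1 + |x - r|) ^ 4 := by gcongr
        _ = (1 + |x - r|) ^ (n + 4) := by rw [pow_add]
        _ ≤ _ := pow_le_pow_right₀ (by linarith [abs_nonneg (x - r)]) (by omega)
  have hexp : ∀ x, Real.exp (-(Real.sqrt c₀ / 2) * max (x - r) 0) ≤ 1 := fun x =>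
    Real.exp_le_one_iff.2 (by
      have := mul_nonneg hσ₀.le (le_max_right (x - r) 0)
      linarith)
  have hF : ∀ x, |F x| ≤ K₁ * (ε ^ (n + 2) * η) * (1 + |x - r|) ^ 5 := fun x => by
    have := (le_add_of_nonneg_right (abs_nonneg (deriv F x))).trans (hb x)
    refine this.trans ?_
    have h1 := mul_le_mul (hpow x) (hexp x) (Real.exp_pos _).le (by positivity)
    rw [mul_one] at h1
    gcongr
  have hA : 0 ≤ 2 * (I₁ * (K₁ * (256 * 4 ^ n))) := by positivity
  have hB : 0 ≤ 2 * (K₂ * K₁) * I₂ := by positivity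
  refine ⟨hcd, fun x _ => ?_, fun x hx => ?_, ?_, ?_⟩
  · refine (hF x).trans ?_
    have : K₁ * (ε ^ (n + 2) * η) ≤ K₁ * 1 := by gcongr
    gcongr
    linarith
  · have h1 := (le_add_of_nonneg_right (abs_nonneg (deriv F x))).trans (hb x)
    rw [max_eq_left hx, max_eq_right (by linarith), mul_zero, add_zero, one_pow, one_pow, one_mul,
      one_mul] at h1
    refine h1.trans ?_
    have : K₁ * (ε ^ (n + 2) * η) ≤ K₁ * 1 := by gcongr
    gcongr
    linarith
  · set D := K₁ * (256 * 4 ^ n) * (ε ^ 2 * η) with hD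
    have hD0 : 0 ≤ D := by positivity
    have hloc : ∀ x, -3 / ε ≤ x - r →
        |F x| + |deriv F x| ≤ D * Real.exp (-(Real.sqrt c₀ / 2) * max (x - r) 0) := fun x hx => by
      refine (hb x).trans ?_
      have e1 : max (-(x - r)) 0 ≤ 3 / ε := max_le (by rw [neg_div] at hx; linarith) (by positivity)
      have e2 : (0 : ℝ) ≤ max (-(x - r)) 0 := le_max_right _ _
      have e3 : ε * max (-(x - r)) 0 ≤ 3 := by
        rw [le_div_iff₀ hε] at e1
        linarith
      have e4 : 1 + max (-(x - r)) 0 ≤ 4 * ε⁻¹ := by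
        have : 1 ≤ ε⁻¹ := (one_le_inv₀ hε).2 hε1
        rw [div_eq_mul_inv] at e1
        linarith
      calc _ ≤ K₁ * (ε ^ (n + 2) * η) * ((4 * ε⁻¹) ^ n * (1 + 3) ^ 4
            * Real.exp (-(Real.sqrt c₀ / 2) * max (x - r) 0)) := by gcongr
        _ = D * (ε * ε⁻¹) ^ n * Real.exp (-(Real.sqrt c₀ / 2) * max (x - r) 0) := by
          rw [hD, mul_pow, mul_pow]
          ring
        _ = _ := by rw [mul_inv_cancel₀ hε.ne', one_pow, mul_one]
    have h1 := eLpNorm_le_of_bound hD0 hε (by linarith : ε ≤ 2 * (Real.sqrt c₀ / 2))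
      fun x hx => (le_add_of_nonneg_right (abs_nonneg (deriv F x))).trans (hloc x hx)
    have h2 := eLpNorm_le_of_bound hD0 hε (by linarith : ε ≤ 2 * (Real.sqrt c₀ / 2))
      fun x hx => (le_add_of_nonneg_left (abs_nonneg (F x))).trans (hloc x hx)
    refine (add_le_add h1 h2).trans ?_
    have hε32 : ε ^ (3 / 2 : ℝ) = ε ^ 2 * ε ^ (-(1 / 2) : ℝ) := by
      rw [← Real.rpow_natCast, ← Real.rpow_add hε]
      norm_num
    have hε12 := Real.rpow_pos_of_pos hε (-(1 / 2))
    rw [← ENNReal.ofReal_add (by positivity) (by positivity), hε32]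
    refine ENNReal.ofReal_le_ofReal ?_
    calc _ = 2 * (I₁ * (K₁ * (256 * 4 ^ n))) * (ε ^ 2 * ε ^ (-(1 / 2) : ℝ)) * η := by
          rw [hD, hI₁]; ring
      _ ≤ _ := by
        gcongr
        linarith
  · have h1 := abs_integral_add_le (r := r) (δ := Real.sqrt c₀ / 2) (D := K₂ * (K₁ * (ε ^ (n + 2) * η)))
      (f := fun x => Qc m c (x - r) * F x) (g := fun x => (x - r) * Qc m c (x - r) * F x)
      (by positivity) fun x => by
        have e1 := hK₂ c hc hcM (x - r)
        have e2 := abs_nonneg (x - r)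
        simp only [abs_mul]
        calc _ = (1 + |x - r|) * |Qc m c (x - r)| * |F x| := by ring
          _ ≤ (1 + |x - r|) * |Qc m c (x - r)| * (K₁ * (ε ^ (n + 2) * η) * (1 + |x - r|) ^ 5) := by
            gcongr
            exact hF x
          _ = (1 + |x - r|) ^ 6 * |Qc m c (x - r)| * (K₁ * (ε ^ (n + 2) * η)) := by ring
          _ ≤ K₂ * Real.exp (-(Real.sqrt c₀ / 2) * |x - r|) * (K₁ * (ε ^ (n + 2) * η)) := by gcongr
          _ = _ := by ring
    refine h1.trans ?_
    calc _ = 2 * (K₂ * K₁) * I₂ * ε ^ (n + 2) * η := by rw [hI₂]; ring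
      _ ≤ _ := by
        gcongr
        linarith

end

end GKdV

theorem proposition4p2
    (m : ℕ) (hm : m = 2 ∨ m = 3 ∨ m = 4)
    (lt : ℝ) (hlt : GKdV.IsLambdaTilde m lt)
    (lam : ℝ) (hlam0 : 0 ≤ lam) (hlam1 : lam < 1) (hlam : lam ≠ lt)
    (a : ℝ → ℝ) (ha : GKdV.IsPotential m a) :
    ∃ ε₀ > 0, ∃ γ > 0, ∃ K > 0, ∃ N : ℕ,
    ∃ (A : ℝ → ℝ → ℝ) (B : ℝ → ℝ → ℝ → ℝ) (f41 f42 : ℝ → ℝ),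
    ∀ ε : ℝ, 0 < ε → ε < ε₀ →
    ∀ (C P : ℝ → ℝ), GKdV.IsDynSol m lam a ε C P →
    ∀ Tt : ℝ, GKdV.IsEscapeTime m lam lt ε C P Tt →
    ∀ (c ρ : ℝ → ℝ),
    (∀ t ∈ Icc (-GKdV.Teps lam ε) Tt,
      0 < c t ∧ DifferentiableAt ℝ c t ∧ DifferentiableAt ℝ ρ t ∧
      |c t - C t| + |deriv ρ t - derivWithin P (Ici (-GKdV.Teps lam ε)) t| ≤ ε ^ (1 / 100 : ℝ)) →
    ∃ (q : ℝ → ℝ) (St : ℝ → ℝ → ℝ),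
    ∀ t ∈ Icc (-GKdV.Teps lam ε) Tt,
      -- regularity of the approximate solution, so that `S` is a classical expression
      ContDiff ℝ 4 (fun x => GKdV.uTilde m a A B ε (c t) (ρ t) x) ∧
      (∀ x, DifferentiableAt ℝ (fun τ => GKdV.uTilde m a A B ε (c τ) (ρ τ) x) t) ∧
      -- (1) decomposition of the error
      |q t| ≤ K * ε ^ 2 * Real.exp (-ε * γ * |ρ t|) ∧
      (∀ x, GKdV.S m lam a ε (fun τ z => GKdV.uTilde m a A B ε (c τ) (ρ τ) z) t x =
        (deriv c t - ε * GKdV.f1 m lam a ε (c t) (ρ t)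
            - ε ^ 2 * GKdV.delta3 m * GKdV.f3 lam a ε (c t) (ρ t))
          * deriv (fun c' => GKdV.uTilde m a A B ε c' (ρ t) x) (c t)
        + (deriv ρ t - c t + lam - ε * GKdV.f2 m lam a ε (c t) (ρ t)
            - ε ^ 2 * GKdV.delta3 m * GKdV.f4 f41 f42 a ε (c t) (ρ t))
          * (deriv (fun r => GKdV.R m a ε (c t) r x) (ρ t)
              - deriv (fun y => GKdV.w m a A B ε (c t) (ρ t) y) (x - ρ t)
              + q t * A (c t) (x - ρ t))
        + St t x) ∧
      -- (2) properties of the corrector `A_c`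
      (∀ y, |A (c t) y| ≤ K) ∧
      (∀ y, DifferentiableAt ℝ (fun c' => A c' y) (c t) ∧
        |deriv (fun c' => A c' y) (c t)| ≤ K) ∧
      Differentiable ℝ (A (c t)) ∧ GKdV.MemY m lam (deriv (A (c t))) ∧
      (∀ y ≥ 0, |A (c t) y| ≤ K * Real.exp (-γ * y)) ∧
      (∃ l : ℝ, Tendsto (A (c t)) atBot (𝓝 l) ∧ (3 * GKdV.lambda0 m * c t ≠ lam → l ≠ 0)) ∧
      (∫ y, GKdV.Qc m (c t) y * A (c t) y) = 0 ∧
      (∫ y, y * GKdV.Qc m (c t) y * A (c t) y) = 0 ∧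
      -- properties of the second corrector `B_c` in the cubic case
      (m = 3 →
        Differentiable ℝ (B (c t) (ε * ρ t)) ∧
        (∀ y, |deriv (B (c t) (ε * ρ t)) y| ≤ K) ∧
        (∀ y ≥ 0, |B (c t) (ε * ρ t) y| ≤ K * Real.exp (-γ * y) * Real.exp (-ε * γ * |ρ t|)) ∧
        (∀ y, DifferentiableAt ℝ (fun c' => B c' (ε * ρ t) y) (c t)) ∧
        (∀ y ≤ -1, |B (c t) (ε * ρ t) y| + |deriv (fun c' => B c' (ε * ρ t) y) (c t)|
          ≤ K * |y| * Real.exp (-ε * γ * |ρ t|)) ∧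
        (∫ y, GKdV.Qc m (c t) y * B (c t) (ε * ρ t) y) = 0 ∧
        (∫ y, y * GKdV.Qc m (c t) y * B (c t) (ε * ρ t) y) = 0) ∧
      -- (3) bound of the coefficients of `f₄`; `f₁`, `f₂`, `f₃` are explicit
      |f41 (c t)| ≤ K ∧ |f42 (c t)| ≤ K ∧
      -- (4) estimates of the remainder
      ContDiff ℝ 1 (St t) ∧
      (∀ x, x - ρ t ≤ 0 → |St t x| ≤ K * (1 + |x - ρ t|) ^ N) ∧
      (∀ x, 0 ≤ x - ρ t → |St t x| ≤ K * Real.exp (-γ * (x - ρ t))) ∧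
      eLpNorm (St t) 2 (volume.restrict {x | -3 / ε ≤ x - ρ t})
          + eLpNorm (deriv (St t)) 2 (volume.restrict {x | -3 / ε ≤ x - ρ t})
        ≤ ENNReal.ofReal
            (K * ε ^ (3 / 2 : ℝ) * Real.exp (-ε * γ * |ρ t|) + K * ε ^ 3) ∧
      (m ≠ 3 →
        |∫ x, GKdV.Qc m (c t) (x - ρ t) * St t x|
            + |∫ x, (x - ρ t) * GKdV.Qc m (c t) (x - ρ t) * St t x|
          ≤ K * ε ^ 2 * Real.exp (-ε * γ * |ρ t|) + K * ε ^ 3) ∧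
      (m = 3 →
        |∫ x, GKdV.Qc m (c t) (x - ρ t) * St t x|
            + |∫ x, (x - ρ t) * GKdV.Qc m (c t) (x - ρ t) * St t x|
          ≤ K * ε ^ 3 * Real.exp (-ε * γ * |ρ t|) + K * ε ^ 4) := by
  have hm2 : 2 ≤ m := by omega
  have hμ := GKdV.muDecay_pos (lam := lam) hm
  have hlam' : |lam| ≤ 1 := by rw [abs_of_nonneg hlam0]; exact hlam1.le
  obtain ⟨X, hX⟩ := GKdV.exists_profiles hm
  obtain ⟨K₀, γ, hpot⟩ := ha.exists_potBound
  obtain ⟨ε₁, hε₁, M, hM, hdyn⟩ := GKdV.exists_scaling_bounds hm hlam0 hlam1 ha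
  set c₀ := GKdV.muDecay m lam / 2 with hc₀
  have h0 : 0 < c₀ := by positivity
  have hσ₀ := Real.sqrt_pos.2 h0
  obtain ⟨n, hn, hn3, hn2, herr⟩ : ∃ n ≤ 1, (m = 3 → n = 1) ∧ (m ≠ 3 → n = 0) ∧
      GKdV.Fam γ (1 / c₀) (M / c₀) 1 (n + 2) 1 n 4 (GKdV.err m X a) := by
    by_cases h3 : m = 3
    · subst h3
      exact ⟨1, le_rfl, fun _ => rfl, fun h => absurd rfl h, GKdV.fam_err_of_three hX hpot⟩
    · exact ⟨0, zero_le_one, fun h => absurd h h3, fun _ => rfl,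
        GKdV.fam_err_of_ne_three (by omega) hX hpot⟩
  obtain ⟨KA, hKA0, hKA⟩ := GKdV.corA_bounds (lam := lam) (M := M) hm2 hX h0 hlam'
  obtain ⟨KB, hKB0, hKB⟩ := GKdV.corB_bounds (lam := lam) (M := M) hm2 hX hpot ha h0 hlam'
  obtain ⟨K₁, hK₁0, hK₁⟩ := GKdV.exists_polyG_bound h0 hlam' X.G₁
  obtain ⟨K₂, hK₂0, hK₂⟩ := GKdV.exists_polyG_bound h0 hlam' X.G₂
  obtain ⟨Kq, hKq0, hKq⟩ := GKdV.exists_qCoef_bound hm2 hpot ha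
  obtain ⟨KS, hKS0, hKS⟩ := GKdV.remS_estimates hn hm2 ha hpot.pos.le h0 hM.le hlam' herr
  obtain ⟨K, hK0, hK_A, hK_B, hK_1, hK_2, hK_q, hK_S⟩ : ∃ K > 0, KA ≤ K ∧ KB ≤ K ∧ K₁ ≤ K ∧ K₂ ≤ K ∧
      Kq ≤ K ∧ KS ≤ K :=
    ⟨KA + KB + K₁ + K₂ + Kq + KS + 1, by positivity, by linarith, by linarith, by linarith,
      by linarith, by linarith, by linarith⟩
  have hγ := hpot.pos
  set γ' := min γ (Real.sqrt c₀ / 2) with hγ'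
  have hγ'0 : 0 < γ' := by positivity
  have hγ1 : γ' ≤ γ := min_le_left _ _
  have hγ2 : γ' ≤ Real.sqrt c₀ / 2 := min_le_right _ _
  have hdec : ∀ y ≥ 0, Real.exp (-(Real.sqrt c₀ / 2) * y) ≤ Real.exp (-γ' * y) := fun y hy =>
    Real.exp_le_exp.2 (by nlinarith)
  refine ⟨min ε₁ (min 1 (Real.sqrt c₀)), by positivity, γ', hγ'0, K, hK0, 5, GKdV.corA m X lam,
    GKdV.corB m X a lam, fun c => GKdV.polyG X.G₁ (lam / c), fun c => GKdV.polyG X.G₂ (lam / c),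
    fun ε hε hε0 C P hsol Tt _ c ρ hcρ => ?_⟩
  have hεε₁ : ε < ε₁ := hε0.trans_le (min_le_left _ _)
  have hε1 : ε ≤ 1 := hε0.le.trans ((min_le_right _ _).trans (min_le_left _ _))
  have hεσ : ε ≤ Real.sqrt c₀ := hε0.le.trans ((min_le_right _ _).trans (min_le_right _ _))
  refine ⟨fun t => GKdV.qCoef m a ε (ρ t),
    fun t => GKdV.remS m X a lam ε (c t) (ρ t) (deriv ρ t), fun t ht => ?_⟩
  obtain ⟨hc, hdc, hdρ, hclose⟩ := hcρ t ht
  obtain ⟨hcl, hcM, hv⟩ := hdyn ε hε hεε₁ C P hsol t ht.1 (c t) (deriv ρ t) hclose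
  have hη : Real.exp (-γ * |ε * ρ t|) ≤ Real.exp (-ε * γ' * |ρ t|) := Real.exp_le_exp.2 (by
    rw [abs_mul, abs_of_pos hε]
    have := mul_le_mul_of_nonneg_right hγ1 (mul_nonneg hε.le (abs_nonneg (ρ t)))
    linarith)
  obtain ⟨hS1, hS2, hS3, hS4, hS5⟩ := hKS ε (c t) (ρ t) (deriv ρ t) hε hε1 hεσ hcl hcM hv
  have hA := hKA (c t) hcl hcM
  have hB := hKB (c t) hcl hcM (ε * ρ t)
  have hS5' : KS * ε ^ (n + 2) * Real.exp (-γ * |ε * ρ t|)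
      ≤ K * ε ^ (n + 2) * Real.exp (-ε * γ' * |ρ t|) := by gcongr
  refine ⟨contDiff_infty.1 (GKdV.contDiff_uTilde hm2 hX ha hc _) 4,
    fun x => (GKdV.hasDerivAt_uTilde hm2 hX ha hdc.hasDerivAt hdρ.hasDerivAt (hasDerivAt_const t x) hc 0
      rfl rfl).differentiableAt,
    (hKq ε (ρ t)).trans (by gcongr), fun x => GKdV.S_eq hm2 hX ha hdc hdρ hc x, fun y => ?_,
    fun y => ⟨(hA y).2.1, (hA y).2.2.trans hK_A⟩, GKdV.differentiable_corA hX hc,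
    GKdV.memY_deriv_corA hm hX hcl, fun y hy => ?_, GKdV.corA_tendsto_atBot hm hX hc,
    (GKdV.integral_Qc_mul_corA hm2 hX hc).1, (GKdV.integral_Qc_mul_corA hm2 hX hc).2, fun h3 => ?_,
    (hK₁ _ hcl).trans hK_1, (hK₂ _ hcl).trans hK_2, hS1, fun x hx => (hS2 x hx).trans (by gcongr),
    fun x hx => (hS3 x hx).trans ?_, hS4.trans (ENNReal.ofReal_le_ofReal ?_), fun h3 => ?_,
    fun h3 => ?_⟩
  · refine (hA y).1.trans ?_
    have h1 : Real.exp (-(Real.sqrt c₀ / 2) * max y 0) ≤ 1 := Real.exp_le_one_iff.2 (by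
      have := mul_nonneg hσ₀.le (le_max_right y 0)
      linarith)
    nlinarith
  · have h1 := (hA y).1
    rw [max_eq_left hy] at h1
    exact h1.trans (mul_le_mul hK_A (hdec y hy) (Real.exp_pos _).le hK0.le)
  · refine ⟨fun y => (hB y).1, fun y => (hB y).2.1.trans hK_B, fun y hy => ?_,
      fun y => (hB y).2.2.2.1, fun y hy => ?_, ?_⟩
    · exact ((hB y).2.2.1 hy).trans (mul_le_mul (mul_le_mul hK_B (hdec y hy) (Real.exp_pos _).le hK0.le)
        hη (Real.exp_pos _).le (by positivity))
    · refine ((hB y).2.2.2.2 hy).trans ?_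
      gcongr
    · subst h3
      exact GKdV.integral_Qc_mul_corB hX hc _
  · exact mul_le_mul hK_S (hdec _ hx) (Real.exp_pos _).le hK0.le
  · refine le_add_of_le_of_nonneg ?_ (by positivity)
    gcongr
  · rw [hn2 h3] at hS5 hS5'
    exact le_add_of_le_of_nonneg (hS5.trans hS5') (by positivity)
  · rw [hn3 h3] at hS5 hS5'
    exact le_add_of_le_of_nonneg (hS5.trans hS5') (by positivity)
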